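/- Let $k$ be a field of characteristic zero. A standard graded artinian algebra is $A=R/I$, where $R=k[x_1,\dots,x_r]$ and $I$ is a homogeneous ideal containing no nonzero linear form, with $\dim_k A<\infty$. Its $h$-vector is $h=(h_0,h_1,\dots,h_e)$, where $h_j=\dim_k A_j$ and the socle degree $e$ is the last index with $A_e\neq 0$; its codimension is $r=h_1$. The algebra $A$ is level of type $2$ if its socle (the annihilator of the ideal generated by the classes of the variables) is concentrated in degree $e$ and has dimension $2$; then $h_e=2$. A level $h$-vector of type $2$ is the $h$-vector of such an algebra; we write it as $(1,r,\dots,a,2)$, where $a=h_{e-1}$. Let $r\ge 2$ and $e\ge 4$ be integers. (i) Suppose $r\le 5$ and $2\le i\le e-2$. If $h=(1,r,\dots,h_{e-i},\dots,r,2)$ is a level $h$-vector of type $2$ and socle degree $e$ (so $a=r$), then $$h_{e-i}=h_i\le \min\left\{\binom{r-2+i}{i}+1,\ \binom{r-2+e-i}{e-i}+1\right\}.$$ Conversely, for every integer $v$ between $r$ and this minimum (inclusive) there is a level $h$-vector of type $2$ and socle degree $e$ of the form $(1,r,\dots,h_{e-i},\dots,r,2)$ with $h_{e-i}=v$. (ii)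 Suppose $r<a\le 2r$ and $2\le i\le e-2$. If $h=(1,r,\dots,h_{e-i},\dots,a,2)$ is a level $h$-vector of type $2$ and socle degree $e$, then $$h_{e-i}\le \min\left\{\binom{r-1+i}{i}+\binom{a-r-1+i}{i},\ \binom{r-1+e-i}{e-i}\right\}.$$ Conversely, for every integer $v$ between $a$ and this minimum (inclusive) there is a level $h$-vector of type $2$ and socle degree $e$ of the form $(1,r,\dots,h_{e-i},\dots,a,2)$ with $h_{e-i}=v$. (iii) Let $r\le a\le 2r$, and assume $r\le 5$ if $a=r$. Then all the upper bounds above are attained simultaneously: the vector $H=(1,r,H_2,\dots,H_{e-2},a,2)$, in which $H_{e-i}$ equals the upper bound for $h_{e-i}$ given in (i) (if $a=r$) or in (ii) (if $a>r$) for every $i=2,\dots,e-2$, is itself a level $h$-vector, and it is the entry by entry maximum of all level $h$-vectors of type $2$ and socle degree $e$ of the form $(1,r,\dots,a,2)$. -/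

import Mathlib

open MvPolynomial

noncomputable section

namespace LevelAlg

attribute [local instance] MvPolynomial.gradedAlgebra

variable {k : Type*} [Field k] {r : ℕ}

/-- The degree `d` component `A_d` of `A = k[x_1, …, x_r] / I`. -/
def gradedPiece (I : Ideal (MvPolynomial (Fin r) k)) (d : ℕ) :
    Submodule k (MvPolynomial (Fin r) k ⧸ I) :=
  (homogeneousSubmodule (Fin r) k d).map (Ideal.Quotient.mkₐ k I).toLinearMap

/-- The `h`-vector `d ↦ dim_k A_d` of `A = k[x_1, …, x_r] / I`, extended by zero beyond the last
nonzero entry. -/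
def hVector (I : Ideal (MvPolynomial (Fin r) k)) (d : ℕ) : ℕ :=
  Module.finrank k (gradedPiece I d)

/-- The ideal of `A = k[x_1, …, x_r] / I` generated by the classes of the variables. -/
def maxHomIdeal (I : Ideal (MvPolynomial (Fin r) k)) : Ideal (MvPolynomial (Fin r) k ⧸ I) :=
  Ideal.span (Set.range fun j : Fin r => Ideal.Quotient.mk I (X j))

/-- The socle of `A`: the annihilator of the maximal homogeneous ideal. -/
def socle (I : Ideal (MvPolynomial (Fin r) k)) : Ideal (MvPolynomial (Fin r) k ⧸ I) :=
  Submodule.annihilator (maxHomIdeal I)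

/-- The socle-vector `d ↦ dim_k soc(A)_d`. -/
def socleVector (I : Ideal (MvPolynomial (Fin r) k)) (d : ℕ) : ℕ :=
  Module.finrank k ((socle I).restrictScalars k ⊓ gradedPiece I d : Submodule k _)

/-- `A = k[x_1, …, x_r] / I` is a standard graded artinian algebra of codimension `r`
and socle degree `e` (the last index with `A_e ≠ 0`). -/
structure IsGradedArtinian (I : Ideal (MvPolynomial (Fin r) k)) (e : ℕ) : Prop where
  homogeneous : I.IsHomogeneous (homogeneousSubmodule (Fin r) k)
  artinian : IsArtinianRing (MvPolynomial (Fin r) k ⧸ I)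
  /-- `I` contains no nonzero linear form, that is, `h_1 = r`. -/
  no_linear_form : ∀ f ∈ I, f.IsHomogeneous 1 → f = 0
  top_ne_zero : hVector I e ≠ 0
  eq_zero_above : ∀ d, e < d → hVector I d = 0

/-- `A = k[x_1, …, x_r] / I` is a level algebra of codimension `r`, socle degree `e` and type `t`:
its socle-vector is `(0, …, 0, t)`, with `t` in degree `e`. -/
structure IsLevel (I : Ideal (MvPolynomial (Fin r) k)) (e t : ℕ) : Prop
    extends IsGradedArtinian I e where
  socleVector_eq : ∀ d, socleVector I d = if d = e then t else 0

end LevelAlg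

/-- `h` is the `h`-vector of a level algebra over `k` of codimension `r`, socle degree `e`
and type `t`. -/
def IsLevelHVector (k : Type*) [Field k] (r e t : ℕ) (h : ℕ → ℕ) : Prop :=
  ∃ I : Ideal (MvPolynomial (Fin r) k), LevelAlg.IsLevel I e t ∧ LevelAlg.hVector I = h

/-- The upper bound for the entry `h_{e-i}` of a level `h`-vector `(1, r, …, a, 2)` of socle
degree `e`. -/
def entryBound (r a e i : ℕ) : ℕ :=
  if a = r then
    min ((r - 2 + i).choose i + 1) ((r - 2 + (e - i)).choose (e - i) + 1)
  else
    min ((r - 1 + i).choose i + (a - r - 1 + i).choose i) ((r - 1 + (e - i)).choose (e - i))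

/-- The vector `(1, r, h_2, …, h_{e-2}, a, 2)` in which `h_{e-i}` is the upper bound for each
`2 ≤ i ≤ e - 2`, extended by zero beyond degree `e`. -/
def maxHVector (r a e : ℕ) (j : ℕ) : ℕ :=
  if j = 0 then 1
  else if j = 1 then r
  else if j + 2 ≤ e then entryBound r a e (e - j)
  else if j + 1 = e then a
  else if j = e then 2
  else 0

end

set_option linter.unusedSectionVars false

/-! ### Pencils in which every member `F + c • G` is killed by a nonzero element of `V`. -/

noncomputable section

namespace LevelAlg

section Pencil

variable {k R D : Type*} [Field k] [CommRing R] [Algebra k R] [AddCommGroup D] [Module k D]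
  [Module R D] [IsScalarTower k R D]

/-! By Macaulay duality, a level algebra of type 2 and socle degree e is R/Ann(F, G), where F and G
are linear functionals on R concentrated in degree e and R acts by contraction. If V is the space of
linear forms, then h_{e-i} = dim(V^i F + V^i G), so the theorem is about dimensions of contraction
spaces. Characteristic zero enters through the infinitude of k.

Upper bound for a > r. Put s = dim VF. Modulo V^i F, the space V^i G comes from T^i G, where T is a
complement, of dimension a - s, of the linear forms that move G into VF. This gives multichoose(s,
i) + multichoose(a - s, i) (`finrank_act_pow_sup_le`), which by convexity is largest at s = r. The
other term of the minimum is dim R_{e-i}.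

Upper bound for a = r ≤ 5. By `Nondegenerate.dichotomy`, after replacing F by some F + cG, either V
acts faithfully on F with VG ≤ VF, or a linear form kills F and G contributes exactly one further
dimension, that of z^i G, for 1 ≤ i ≤ e - 1. In both cases h_{e-i} = dim V^i F + δ with δ
independent of i, so the symmetry of dim V^i F in i and e - i gives h_{e-i} = h_i. In the second
case F needs at most r - 1 variables. In the first, vG = wF with v, w independent turns every
product with w into a product with v on F, and the same numerical bound follows. The dichotomy comes
from elements x_c killing F + cG: products of distinct ones kill both F and G, and r ≤ 5, e ≥ 4
force the stable span U of the x_c to have dimension 2 and UF + UG to have dimension 1.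

Existence. Contractions of a point evaluation are multiples of a point evaluation, so adding one
changes a contraction space by at most one dimension. A pairing with nonzero kernels on both sides
gains rank when a suitable point is added (`exists_point_pairingRank_lt`), and a generic multiple of
it lowers none of the other ranks. Hence all intermediate values occur, and all maxima can be
reached at once. For a > r, F uses r variables and G uses a - r of them; for a = r, F uses r - 1
variables and G is the last coordinate point. -/

/-- The subspace `S • F` of a module, for a subspace `S` of the algebra. -/
def act (S : Submodule k R) (F : D) : Submodule k D :=
  S.map ((LinearMap.toSpanSingleton R D F).restrictScalars k)

theorem mem_act {S : Submodule k R} {F y : D} : y ∈ act S F ↔ ∃ x ∈ S, x • F = y := by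
  simp [act]

theorem smul_mem_act {S : Submodule k R} {x : R} (hx : x ∈ S) (F : D) : x • F ∈ act S F :=
  mem_act.2 ⟨x, hx, rfl⟩

instance (S : Submodule k R) [FiniteDimensional k S] (F : D) : FiniteDimensional k (act S F) := by
  unfold act; infer_instance

theorem smul_pow_eq {V : Submodule k R} {P : D} {z : R}
    (h : ∀ v ∈ V, ∃ a : k, v • P = a • z • P) (n : ℕ) {x : R} (hx : x ∈ V ^ n) :
    ∃ a : k, x • P = a • z ^ n • P := by
  induction hx using Submodule.pow_induction_on_left' with
  | algebraMap a => exact ⟨a, by simp [algebraMap_smul]⟩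
  | add x y i hx hy h1 h2 =>
    obtain ⟨a, ha⟩ := h1
    obtain ⟨b, hb⟩ := h2
    exact ⟨a + b, by rw [add_smul, add_smul, ha, hb]⟩
  | mem_mul v hv i x hx ih =>
    obtain ⟨a, ha⟩ := ih
    obtain ⟨b, hb⟩ := h v hv
    refine ⟨a * b, ?_⟩
    rw [mul_smul, ha, smul_comm v a, smul_comm v (z ^ i), hb, pow_succ, mul_smul, mul_smul,
      smul_comm (z ^ i) b]

/-- If every combination `F + c • G` is killed by a nonzero element of `V`, then almost all of
these elements span a subspace whose square kills both `F` and `G`. -/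
theorem exists_stable_kernel [Infinite k] {V : Submodule k R} [FiniteDimensional k V] {F G : D}
    (h : ∀ c : k, ∃ x ∈ V, x ≠ 0 ∧ x • (F + c • G) = 0) :
    ∃ (U : Submodule k R) (s : Finset k) (x : k → R), U ≤ V ∧ (∀ c, x c ∈ V) ∧ (∀ c, x c ≠ 0) ∧
      (∀ c, x c • F = -(c • x c • G)) ∧
      (∀ t : Finset k, s ⊆ t → Submodule.span k (x '' {c | c ∉ t}) = U) ∧
      (∀ u ∈ U, ∀ w ∈ U, u • w • F = 0 ∧ u • w • G = 0) := by
  choose x hxV hx0 hx using h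
  have hxF : ∀ c, x c • F = -(c • x c • G) := fun c => by
    have := hx c
    rw [smul_add, smul_comm (x c) c] at this
    exact eq_neg_of_add_eq_zero_left this
  let W : Finset k → Submodule k R := fun t => Submodule.span k (x '' {c | c ∉ t})
  have hWV : ∀ t, W t ≤ V := fun t => Submodule.span_le.2 (by rintro _ ⟨c, -, rfl⟩; exact hxV c)
  -- Removing more parameters only shrinks the span, so a removed set `s` of minimal span dimension
  -- makes the span insensitive to further finite removals.
  obtain ⟨s, hs⟩ : ∃ s, ∀ t, Module.finrank k (W s) ≤ Module.finrank k (W t) := by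
    obtain ⟨s, hs⟩ := WellFounded.has_min (measure fun t => Module.finrank k (W t)).wf Set.univ
      ⟨∅, trivial⟩
    exact ⟨s, fun t => not_lt.1 (hs.2 t trivial)⟩
  have hfin : ∀ t, FiniteDimensional k (W t) := fun t => Submodule.finiteDimensional_of_le (hWV t)
  have hst : ∀ t : Finset k, s ⊆ t → W t = W s := fun t ht => by
    have := hfin s
    exact Submodule.eq_of_le_of_finrank_le
      (Submodule.span_mono (Set.image_mono fun c hc hcs => hc (ht hcs))) (hs t)
  -- The vector x_c x_d F equals both -d x_c x_d G and -c x_c x_d G.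
  have hcd : ∀ c d, c ≠ d → x c • x d • G = 0 ∧ x c • x d • F = 0 := fun c d hne => by
    have h1 : x c • x d • F = -(d • x c • x d • G) := by
      rw [hxF d, smul_neg, smul_comm (x c) d]
    have h2 : x c • x d • F = -(c • x c • x d • G) := by
      rw [smul_comm (x c) (x d) F, hxF c, smul_neg, smul_comm (x d) c, smul_comm (x d) (x c) G]
    have h3 : (c - d) • x c • x d • G = 0 := by
      rw [sub_smul, sub_eq_zero]; rw [h1] at h2; exact (neg_injective h2).symm
    have h4 := (smul_eq_zero.1 h3).resolve_left (sub_ne_zero.2 hne)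
    exact ⟨h4, by rw [h1, h4, smul_zero, neg_zero]⟩
  refine ⟨W s, s, x, hWV s, hxV, hx0, hxF, hst, fun u hu w hw => ?_⟩
  classical
  -- `hcd` says nothing about squares, so `c` itself is first removed from the spanning family; by
  -- stability the span does not change.
  have key : ∀ c, ∀ w ∈ W s, x c • w • F = 0 ∧ x c • w • G = 0 := fun c w hw => by
    rw [← hst (insert c s) (Finset.subset_insert _ _)] at hw
    induction hw using Submodule.span_induction with
    | mem y hy =>
      obtain ⟨d, hd, rfl⟩ := hy
      have : c ≠ d := fun hcd => hd (by simp [hcd])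
      exact (hcd c d this).symm
    | zero => simp
    | add y y' _ _ h1 h2 => simp [add_smul, smul_add, h1, h2]
    | smul a y _ h1 => simp [smul_comm (x c) a, h1]
  induction hu using Submodule.span_induction with
  | mem y hy =>
    obtain ⟨c, -, rfl⟩ := hy
    exact key c w hw
  | zero => simp
  | add y y' _ _ h1 h2 => simp [add_smul, h1, h2]
  | smul a y _ h1 => simp [h1]

end Pencil
end LevelAlg
end

/-! ### Kernel families: elementary relations and dimension counts. -/

noncomputable section

namespace LevelAlg

section Pencil

variable {k R D : Type*} [Field k] [CommRing R] [Algebra k R] [AddCommGroup D] [Module k D]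
  [Module R D] [IsScalarTower k R D]

theorem finrank_span_singleton_le {M : Type*} [AddCommGroup M] [Module k M] (y : M) :
    Module.finrank k (Submodule.span k {y}) ≤ 1 :=
  (finrank_span_le_card _).trans (by simp)

theorem finrank_span_pair {M : Type*} [AddCommGroup M] [Module k M] {y z : M}
    (h : LinearIndependent k ![y, z]) : Module.finrank k (Submodule.span k {y, z}) = 2 := by
  have := finrank_span_eq_card h
  rwa [Matrix.range_cons, Matrix.range_cons, Matrix.range_empty, Set.union_empty,
    Set.singleton_union] at this

/-- The elements of `V` that annihilate the subspace `Q`. -/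
def killer (V : Submodule k R) (Q : Submodule k D) : Submodule k R where
  carrier := {v | v ∈ V ∧ ∀ q ∈ Q, v • q = 0}
  zero_mem' := ⟨V.zero_mem, by simp⟩
  add_mem' := fun ha hb => ⟨V.add_mem ha.1 hb.1, fun q hq => by
    rw [add_smul, ha.2 q hq, hb.2 q hq, add_zero]⟩
  smul_mem' := fun c _ ha => ⟨V.smul_mem c ha.1, fun q hq => by
    rw [smul_assoc, ha.2 q hq, smul_zero]⟩

theorem killer_le (V : Submodule k R) (Q : Submodule k D) : killer V Q ≤ V := fun _ h => h.1

/-- The map `(z, w) ↦ z • F + w • G` on `S × S`. -/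
def pairMap (S : Submodule k R) (F G : D) : S × S →ₗ[k] D :=
  (((LinearMap.toSpanSingleton R D F).restrictScalars k).domRestrict S).coprod
    (((LinearMap.toSpanSingleton R D G).restrictScalars k).domRestrict S)

@[simp] theorem pairMap_apply (S : Submodule k R) (F G : D) (z : S × S) :
    pairMap S F G z = (z.1 : R) • F + (z.2 : R) • G := rfl

theorem range_pairMap (S : Submodule k R) (F G : D) :
    LinearMap.range (pairMap S F G) = act S F ⊔ act S G := by
  rw [pairMap, LinearMap.range_coprod, act, act, LinearMap.range_domRestrict,
    LinearMap.range_domRestrict]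

theorem finrank_act_sup_add_finrank_ker (S : Submodule k R) [FiniteDimensional k S] (F G : D) :
    Module.finrank k (act S F ⊔ act S G : Submodule k D) +
      Module.finrank k (LinearMap.ker (pairMap S F G)) = 2 * Module.finrank k S := by
  rw [← range_pairMap, LinearMap.finrank_range_add_finrank_ker, Module.finrank_prod, two_mul]

theorem finrank_ker_pairMap_le {S T : Submodule k R} [FiniteDimensional k T] {F G : D}
    (h : ∀ z ∈ S, ∀ w ∈ S, z • F + w • G = 0 → z ∈ T ∧ w ∈ T) :
    Module.finrank k (LinearMap.ker (pairMap S F G)) ≤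
      Module.finrank k (LinearMap.ker (pairMap T F G)) := by
  let f : LinearMap.ker (pairMap S F G) →ₗ[k] LinearMap.ker (pairMap T F G) :=
    { toFun := fun p => ⟨(⟨p.1.1, (h _ p.1.1.2 _ p.1.2.2 p.2).1⟩,
        ⟨p.1.2, (h _ p.1.1.2 _ p.1.2.2 p.2).2⟩), p.2⟩
      map_add' := fun _ _ => rfl
      map_smul' := fun _ _ => rfl }
  refine LinearMap.finrank_le_finrank_of_injective (f := f) fun p q hpq => ?_
  have e1 := congrArg (fun y => (y.1.1 : R)) hpq
  have e2 := congrArg (fun y => (y.1.2 : R)) hpq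
  exact Subtype.ext (Prod.ext (Subtype.ext e1) (Subtype.ext e2))

theorem exists_sup_span_of_finrank_le {V A : Submodule k R} [FiniteDimensional k V] (hA : A ≤ V)
    (h : Module.finrank k V ≤ Module.finrank k A + 1) (h0 : A ≠ V) :
    ∃ z ∈ V, z ∉ A ∧ A ⊔ Submodule.span k {z} = V := by
  obtain ⟨z, hzV, hzA⟩ := SetLike.exists_of_lt (lt_of_le_of_ne hA h0)
  refine ⟨z, hzV, hzA, ?_⟩
  have hle : A ⊔ Submodule.span k {z} ≤ V := sup_le hA (by simpa using hzV)
  refine Submodule.eq_of_le_of_finrank_le hle (h.trans ?_)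
  have : FiniteDimensional k (A ⊔ Submodule.span k {z} : Submodule k R) :=
    Submodule.finiteDimensional_of_le hle
  refine Nat.succ_le_of_lt (Submodule.finrank_lt_finrank_of_lt
    (lt_of_le_of_ne le_sup_left fun heq => hzA ?_))
  rw [heq]
  exact Submodule.mem_sup_right (Submodule.mem_span_singleton_self z)

/-- A family `x c` of elements killing `F + c • G`, spanning the subspace `U` after the removal
of any finite set of parameters containing `s`, with `U ^ 2` killing `F` and `G`. -/
structure KernelFamily (V : Submodule k R) (F G : D) (U : Submodule k R) (s : Finset k)
    (x : k → R) : Prop where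
  le : U ≤ V
  mem : ∀ c, x c ∈ V
  ne_zero : ∀ c, x c ≠ 0
  smul_fst : ∀ c, x c • F = -(c • x c • G)
  span_eq : ∀ t : Finset k, s ⊆ t → Submodule.span k (x '' {c | c ∉ t}) = U
  sq_zero : ∀ u ∈ U, ∀ w ∈ U, u • w • F = 0 ∧ u • w • G = 0

namespace KernelFamily

variable {V : Submodule k R} {F G : D} {U : Submodule k R} {s : Finset k} {x : k → R}

theorem mem_of_notMem (hx : KernelFamily V F G U s x) {c : k} (hc : c ∉ s) : x c ∈ U := by
  rw [← hx.span_eq s subset_rfl]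
  exact Submodule.subset_span ⟨c, hc, rfl⟩

theorem smul_ne_zero (hx : KernelFamily V F G U s x)
    (hker : ∀ v ∈ V, v • F = 0 → v • G = 0 → v = 0) (c : k) : x c • G ≠ 0 := fun h =>
  hx.ne_zero c (hker _ (hx.mem c) (by rw [hx.smul_fst, h, smul_zero, neg_zero]) h)

theorem act_sup_eq_span (hx : KernelFamily V F G U s x) {t : Finset k} (ht : s ⊆ t) :
    act U F ⊔ act U G = Submodule.span k ((fun c => x c • G) '' {c | c ∉ t}) := by
  apply le_antisymm
  · have key : ∀ u ∈ U, u • F ∈ Submodule.span k ((fun c => x c • G) '' {c | c ∉ t}) ∧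
        u • G ∈ Submodule.span k ((fun c => x c • G) '' {c | c ∉ t}) := fun u hu => by
      rw [← hx.span_eq t ht] at hu
      induction hu using Submodule.span_induction with
      | mem y hy =>
        obtain ⟨c, hc, rfl⟩ := hy
        have : x c • G ∈ Submodule.span k ((fun c => x c • G) '' {c | c ∉ t}) :=
          Submodule.subset_span ⟨c, hc, rfl⟩
        exact ⟨by rw [hx.smul_fst]; exact Submodule.neg_mem _ (Submodule.smul_mem _ _ this), this⟩
      | zero => simp
      | add y y' _ _ h1 h2 =>
        rw [add_smul, add_smul]
        exact ⟨Submodule.add_mem _ h1.1 h2.1, Submodule.add_mem _ h1.2 h2.2⟩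
      | smul a y _ h1 =>
        rw [smul_assoc, smul_assoc]
        exact ⟨Submodule.smul_mem _ _ h1.1, Submodule.smul_mem _ _ h1.2⟩
    refine sup_le ?_ ?_
    · rintro _ h
      obtain ⟨u, hu, rfl⟩ := mem_act.1 h
      exact (key u hu).1
    · rintro _ h
      obtain ⟨u, hu, rfl⟩ := mem_act.1 h
      exact (key u hu).2
  · rw [Submodule.span_le]
    rintro _ ⟨c, hc, rfl⟩
    exact Submodule.mem_sup_right (smul_mem_act (hx.mem_of_notMem fun h => hc (ht h)) G)

theorem mem_killer_of (hx : KernelFamily V F G U s x) {t : Finset k} (ht : s ⊆ t) {v : R}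
    (hv : v ∈ V) (h : ∀ c ∉ t, v • x c • G = 0) : v ∈ killer V (act U F ⊔ act U G) := by
  refine ⟨hv, fun q hq => ?_⟩
  rw [hx.act_sup_eq_span ht] at hq
  induction hq using Submodule.span_induction with
  | mem y hy => obtain ⟨c, hc, rfl⟩ := hy; exact h c hc
  | zero => simp
  | add y y' _ _ h1 h2 => rw [smul_add, h1, h2, add_zero]
  | smul a y _ h1 => rw [smul_comm, h1, smul_zero]

theorem le_killer (hx : KernelFamily V F G U s x) : U ≤ killer V (act U F ⊔ act U G) :=
  fun u hu => hx.mem_killer_of subset_rfl (hx.le hu) fun c hc =>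
    (hx.sq_zero u hu (x c) (hx.mem_of_notMem hc)).2

/-- Contract the relation by x_c and use x_c F = -c x_c G. On x_c G the element w thus acts as c z;
varying c turns one relation into many. -/
theorem smul_eq_zero_of_relation (hx : KernelFamily V F G U s x) {z w : R}
    (h : z • F + w • G = 0) (c : k) : (w - c • z) • x c • G = 0 := by
  have h1 : x c • (z • F + w • G) = 0 := by rw [h, smul_zero]
  rw [smul_add, smul_comm (x c) z, hx.smul_fst, smul_neg, smul_comm z c, smul_comm (x c) w] at h1
  rw [sub_smul, smul_assoc, ← h1]
  abel

/-- A linear relation applied to G and to F gives two equations in x_c G and x_d G whose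
coefficients differ by the distinct weights c and d. -/
theorem linearIndependent_pair (hx : KernelFamily V F G U s x)
    (hker : ∀ v ∈ V, v • F = 0 → v • G = 0 → v = 0) {c d : k} (hcd : c ≠ d) :
    LinearIndependent k ![x c, x d] := by
  rw [LinearIndependent.pair_iff]
  intro a b hab
  have hG : a • x c • G + b • x d • G = 0 := by
    rw [← smul_assoc, ← smul_assoc, ← add_smul, hab, zero_smul]
  have hF : a • c • x c • G + b • d • x d • G = 0 := by
    have : a • x c • F + b • x d • F = 0 := by
      rw [← smul_assoc, ← smul_assoc, ← add_smul, hab, zero_smul]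
    rw [hx.smul_fst, hx.smul_fst, smul_neg, smul_neg, ← neg_add, neg_eq_zero] at this
    exact this
  have h1 : (a * (c - d)) • x c • G = 0 := by
    have : (a * (c - d)) • x c • G =
      (a • c • x c • G + b • d • x d • G) - d • (a • x c • G + b • x d • G) := by module
    rw [this, hF, hG, smul_zero, sub_zero]
  have h2 : (b * (d - c)) • x d • G = 0 := by
    have : (b * (d - c)) • x d • G =
      (a • c • x c • G + b • d • x d • G) - c • (a • x c • G + b • x d • G) := by module
    rw [this, hF, hG, smul_zero, sub_zero]
  have h3 := (smul_eq_zero.1 h1).resolve_right (hx.smul_ne_zero hker c)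
  have h4 := (smul_eq_zero.1 h2).resolve_right (hx.smul_ne_zero hker d)
  exact ⟨(mul_eq_zero.1 h3).resolve_right (sub_ne_zero.2 hcd),
    (mul_eq_zero.1 h4).resolve_right (sub_ne_zero.2 hcd.symm)⟩

variable [FiniteDimensional k V]

theorem finiteDimensional (hx : KernelFamily V F G U s x) : FiniteDimensional k U :=
  Submodule.finiteDimensional_of_le hx.le

theorem two_le_finrank [Infinite k] (hx : KernelFamily V F G U s x)
    (hker : ∀ v ∈ V, v • F = 0 → v • G = 0 → v = 0) : 2 ≤ Module.finrank k U := by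
  classical
  have := hx.finiteDimensional
  obtain ⟨c, hc⟩ := Infinite.exists_notMem_finset s
  obtain ⟨d, hd⟩ := Infinite.exists_notMem_finset (insert c s)
  rw [← finrank_span_pair (hx.linearIndependent_pair hker (c := c) (d := d)
    (by rintro rfl; simp at hd))]
  apply Submodule.finrank_mono
  rw [Submodule.span_le]
  rintro _ (rfl | rfl)
  · exact hx.mem_of_notMem hc
  · exact hx.mem_of_notMem fun h => hd (Finset.mem_insert_of_mem h)

/-- The injective map `u ↦ (u • F, u • G)` on `U`. -/
theorem exists_injective (hx : KernelFamily V F G U s x)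
    (hker : ∀ v ∈ V, v • F = 0 → v • G = 0 → v = 0) {Q : Submodule k D}
    (hQ : act U F ⊔ act U G ≤ Q) :
    ∃ f : U →ₗ[k] Q × Q, Function.Injective f ∧
      ∀ u, ((f u).1 : D) = (u : R) • F ∧ ((f u).2 : D) = (u : R) • G := by
  refine ⟨((((LinearMap.toSpanSingleton R D F).restrictScalars k).domRestrict U).codRestrict Q
    fun u => hQ (Submodule.mem_sup_left (smul_mem_act u.2 F))).prod
    ((((LinearMap.toSpanSingleton R D G).restrictScalars k).domRestrict U).codRestrict Q
    fun u => hQ (Submodule.mem_sup_right (smul_mem_act u.2 G))), ?_, fun u => ⟨rfl, rfl⟩⟩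
  rw [← LinearMap.ker_eq_bot, LinearMap.ker_eq_bot']
  intro u hu
  have h1 := congrArg (fun q => (q.1 : D)) hu
  have h2 := congrArg (fun q => (q.2 : D)) hu
  exact Subtype.ext (hker _ (hx.le u.2) h1 h2)

theorem finrank_le_two_mul (hx : KernelFamily V F G U s x)
    (hker : ∀ v ∈ V, v • F = 0 → v • G = 0 → v = 0) :
    Module.finrank k U ≤ 2 * Module.finrank k (act U F ⊔ act U G : Submodule k D) := by
  have := hx.finiteDimensional
  obtain ⟨f, hf, -⟩ := hx.exists_injective hker le_rfl
  have := LinearMap.finrank_le_finrank_of_injective hf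
  rwa [Module.finrank_prod, ← two_mul] at this

/-- Any three of the x_c are dependent. Applying such a dependence to both G and F and eliminating
x_f G makes x_c G proportional to x_d G. -/
theorem finrank_act_le_one_of_finrank_eq_two [Infinite k] (hx : KernelFamily V F G U s x)
    (hker : ∀ v ∈ V, v • F = 0 → v • G = 0 → v = 0) (hU : Module.finrank k U = 2) :
    Module.finrank k (act U F ⊔ act U G : Submodule k D) ≤ 1 := by
  classical
  have := hx.finiteDimensional
  obtain ⟨d, hd⟩ := Infinite.exists_notMem_finset s
  have hle : (act U F ⊔ act U G : Submodule k D) ≤ Submodule.span k {x d • G} := by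
    rw [hx.act_sup_eq_span (Finset.subset_insert d s), Submodule.span_le]
    rintro _ ⟨c, hc, rfl⟩
    rw [Set.mem_ofPred_eq, Finset.mem_insert, not_or] at hc
    obtain ⟨f, hf⟩ := Infinite.exists_notMem_finset (insert c (insert d s))
    simp only [Finset.mem_insert, not_or] at hf
    have hspan : Submodule.span k {x c, x d} = U := by
      refine Submodule.eq_of_le_of_finrank_le ?_ ?_
      · rw [Submodule.span_le]
        rintro _ (rfl | rfl)
        · exact hx.mem_of_notMem hc.2
        · exact hx.mem_of_notMem hd
      · rw [finrank_span_pair (hx.linearIndependent_pair hker hc.1), hU]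
    have hf' := hx.mem_of_notMem hf.2.2
    rw [← hspan, Submodule.mem_span_pair] at hf'
    obtain ⟨a, b, hab⟩ := hf'
    have hG : x f • G = a • x c • G + b • x d • G := by
      rw [← hab, add_smul, smul_assoc, smul_assoc]
    have hF : f • x f • G = a • c • x c • G + b • d • x d • G := by
      have h : x f • F = a • x c • F + b • x d • F := by
        rw [← hab, add_smul, smul_assoc, smul_assoc]
      rw [hx.smul_fst, hx.smul_fst, hx.smul_fst, smul_neg, smul_neg, ← neg_add] at h
      exact neg_injective h
    have hrel : (a * (f - c)) • x c • G = (b * (d - f)) • x d • G := by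
      have : (a * (f - c)) • x c • G - (b * (d - f)) • x d • G =
          f • (a • x c • G + b • x d • G) - (a • c • x c • G + b • d • x d • G) := by module
      rw [← sub_eq_zero, this, ← hG, ← hF, sub_self]
    have ha : a * (f - c) ≠ 0 := by
      intro h0
      have ha : a = 0 := (mul_eq_zero.1 h0).resolve_right (sub_ne_zero.2 hf.1)
      rw [h0, zero_smul, eq_comm, smul_eq_zero] at hrel
      have hb : b = 0 := (mul_eq_zero.1 (hrel.resolve_right (hx.smul_ne_zero hker d))).resolve_right
        (sub_ne_zero.2 (Ne.symm hf.2.1))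
      exact hx.ne_zero f (by rw [← hab, ha, hb]; simp)
    rw [SetLike.mem_coe, Submodule.mem_span_singleton]
    refine ⟨(a * (f - c))⁻¹ * (b * (d - f)), ?_⟩
    rw [mul_smul, ← hrel, inv_smul_smul₀ ha]
  exact (Submodule.finrank_mono hle).trans (finrank_span_singleton_le _)

end KernelFamily
end Pencil
end LevelAlg
end

/-! ### Nondegenerate pencils: `act U F ⊔ act U G` is at most a line. -/

noncomputable section

namespace LevelAlg

section Pencil

variable {k R D : Type*} [Field k] [CommRing R] [Algebra k R] [AddCommGroup D] [Module k D]
  [Module R D] [IsScalarTower k R D]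

theorem exists_smul_eq_of_sup_span {V A : Submodule k R} {Q : Submodule k D} {z : R}
    (hA : A ≤ killer V Q) (hz : V ≤ A ⊔ Submodule.span k {z}) {P : D} (hP : P ∈ Q) :
    ∀ v ∈ V, ∃ a : k, v • P = a • z • P := fun v hv => by
  obtain ⟨w, hw, y, hy, rfl⟩ := Submodule.mem_sup.1 (hz hv)
  obtain ⟨a, rfl⟩ := Submodule.mem_span_singleton.1 hy
  exact ⟨a, by rw [add_smul, (hA hw).2 P hP, zero_add, smul_assoc]⟩

theorem act_mono {S T : Submodule k R} (h : S ≤ T) (F : D) : act S F ≤ act T F :=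
  Submodule.map_mono h

/-- The pencil spanned by `F` and `G` is nondegenerate of degree `m + 1`. -/
structure Nondegenerate (V : Submodule k R) (F G : D) (m : ℕ) (ε : D →ₗ[k] k) : Prop where
  eq_zero : ∀ P ∈ act V F ⊔ act V G, (∀ y ∈ V ^ m, ε (y • P) = 0) → P = 0
  ker : ∀ v ∈ V, v • F = 0 → v • G = 0 → v = 0
  finrank_eq : Module.finrank k (act V F ⊔ act V G : Submodule k D) = Module.finrank k V

/-- Here V^m P is spanned by z^m P, so the nondegeneracy of the pairing with V^m is tested on this
single vector. -/
theorem Nondegenerate.map_ne_zero {V : Submodule k R} {F G : D} {m : ℕ} {ε : D →ₗ[k] k}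
    (hN : Nondegenerate V F G m ε) {P : D} (hP : P ∈ act V F ⊔ act V G) (hP0 : P ≠ 0) {z : R}
    (hz : ∀ v ∈ V, ∃ a : k, v • P = a • z • P) : ε (z ^ m • P) ≠ 0 := fun h0 => by
  refine hP0 (hN.eq_zero P hP fun y hy => ?_)
  obtain ⟨a, ha⟩ := smul_pow_eq hz m hy
  rw [ha, map_smul, h0, smul_zero]

namespace KernelFamily

variable {V : Submodule k R} {F G : D} {U : Submodule k R} {s : Finset k} {x : k → R}
  [FiniteDimensional k V] {m : ℕ} {ε : D →ₗ[k] k}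

theorem act_sup_le (hx : KernelFamily V F G U s x) :
    act U F ⊔ act U G ≤ act V F ⊔ act V G :=
  sup_le_sup (act_mono hx.le F) (act_mono hx.le G)

/-- When the killer of Q = UF + UG has codimension at most one in V, all of V acts on Q through one
element z, and P ↦ ε(z^m P) embeds Q into k. -/
theorem finrank_act_le_one_of_killer (hx : KernelFamily V F G U s x)
    (hN : Nondegenerate V F G m ε)
    (hA : Module.finrank k V ≤ Module.finrank k (killer V (act U F ⊔ act U G)) + 1) :
    Module.finrank k (act U F ⊔ act U G : Submodule k D) ≤ 1 := by
  obtain ⟨z, hz⟩ : ∃ z, V ≤ killer V (act U F ⊔ act U G) ⊔ Submodule.span k {z} := by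
    by_cases h0 : killer V (act U F ⊔ act U G) = V
    · exact ⟨0, h0.ge.trans le_sup_left⟩
    · obtain ⟨z, -, -, hz⟩ := exists_sup_span_of_finrank_le (killer_le _ _) hA h0
      exact ⟨z, hz.ge⟩
  let f : (act U F ⊔ act U G : Submodule k D) →ₗ[k] k :=
    { toFun := fun P => ε (z ^ m • (P : D))
      map_add' := fun P P' => by rw [Submodule.coe_add, smul_add, map_add]
      map_smul' := fun a P => by
        rw [Submodule.coe_smul, smul_comm, map_smul, RingHom.id_apply] }
  have hf : Function.Injective f := by
    rw [← LinearMap.ker_eq_bot, LinearMap.ker_eq_bot']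
    intro P hP
    by_contra hP0
    exact hN.map_ne_zero (hx.act_sup_le P.2) (fun h => hP0 (Subtype.ext h))
      (exists_smul_eq_of_sup_span le_rfl hz P.2) hP
  simpa using LinearMap.finrank_le_finrank_of_injective hf

/-- By the relation, w acts on each x_c G as c z, so the vectors x_c G behave like eigenvectors with
distinct eigenvalues. A dependence among four of them is separated by a Lagrange-type product, which
kills some x_c G by z^3; but V acts on this vector through z, so z^m cannot kill it. -/
theorem false_of_relation [Infinite k] (hx : KernelFamily V F G U s x)
    (hN : Nondegenerate V F G m ε) (hm : 3 ≤ m) (hU : Module.finrank k U = 3) {z w : R}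
    (hzw : z • F + w • G = 0)
    (hV : V ≤ killer V (act U F ⊔ act U G) ⊔ Submodule.span k {z, w}) : False := by
  classical
  have := hx.finiteDimensional
  -- Four parameters, one more than dim U, so the x_c are dependent.
  obtain ⟨t, ht, htcard⟩ : ∃ t : Finset k, Disjoint t s ∧ t.card = 4 := by
    obtain ⟨t, hts, htcard⟩ :=
      (s.finite_toSet.infinite_compl).exists_subset_card_eq 4
    refine ⟨t, Finset.disjoint_left.2 fun c hc hcs => hts hc (by simpa using hcs), htcard⟩
  have hdep : ¬ LinearIndependent k (fun c : t => (⟨x c, hx.mem_of_notMem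
      (Finset.disjoint_left.1 ht c.2)⟩ : U)) := fun h => by
    have := h.fintype_card_le_finrank
    rw [hU, Fintype.card_coe, htcard] at this
    omega
  rw [Fintype.not_linearIndependent_iff] at hdep
  obtain ⟨g, hg, c₀, hc₀⟩ := hdep
  have hsum : ∑ c : t, g c • x c • G = 0 := by
    have := congrArg (fun u : U => (u : R) • G) hg
    simpa [Finset.sum_smul] using this
  have hP : x c₀ • G ∈ act U F ⊔ act U G := Submodule.mem_sup_right
    (smul_mem_act (hx.mem_of_notMem (Finset.disjoint_left.1 ht c₀.2)) G)
  have hw : ∀ c : k, w • x c • G = c • z • x c • G := fun c => by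
    have := hx.smul_eq_zero_of_relation hzw c
    rwa [sub_smul, smul_assoc, sub_eq_zero] at this
  have hz : ∀ v ∈ V, ∃ a : k, v • x c₀ • G = a • z • x c₀ • G := fun v hv => by
    obtain ⟨y, hy, y', hy', rfl⟩ := Submodule.mem_sup.1 (hV hv)
    obtain ⟨a, b, rfl⟩ := Submodule.mem_span_pair.1 hy'
    refine ⟨a + b * c₀, ?_⟩
    rw [add_smul, hy.2 _ hP, zero_add, add_smul, smul_assoc, smul_assoc, hw, add_smul, mul_smul]
  have hprod : ∀ (q : Finset t) (c : k), (∏ d ∈ q, (w - (d : k) • z)) • x c • G =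
      (∏ d ∈ q, (c - d)) • z ^ q.card • x c • G := fun q c => by
    induction q using Finset.induction_on with
    | empty => simp
    | insert d q hd ih =>
      rw [Finset.prod_insert hd, mul_smul, ih, Finset.prod_insert hd, Finset.card_insert_of_notMem hd,
        pow_succ, mul_smul, smul_comm (w - (d : k) • z), smul_comm (w - (d : k) • z), sub_smul, hw,
        smul_assoc, ← sub_smul, smul_comm (z ^ q.card) (c - (d : k)), smul_comm (∏ d ∈ q, (c - (d : k))) (c - (d : k)), ← mul_smul (z ^ q.card) z]
  -- The product over the three parameters other than `c₀` annihilates every other term and leaves a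
  -- nonzero multiple of z^3; this cube is the source of the condition m ≥ 3.
  have h3 : z ^ 3 • x c₀ • G = 0 := by
    have h1 := congrArg (fun y => (∏ d ∈ Finset.univ.erase c₀, (w - (d : k) • z)) • y) hsum
    simp only [smul_zero, Finset.smul_sum] at h1
    rw [Finset.sum_eq_single c₀] at h1
    · rw [smul_comm, hprod, Finset.card_erase_of_mem (Finset.mem_univ _), Finset.card_univ,
        Fintype.card_coe, htcard] at h1
      have h2 := (smul_eq_zero.1 ((smul_eq_zero.1 h1).resolve_left hc₀)).resolve_left ?_
      · simpa using h2
      · refine Finset.prod_ne_zero_iff.2 ?_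
        intro d hd
        rw [sub_ne_zero]
        exact fun h => (Finset.mem_erase.1 hd).1 (Subtype.ext h.symm)
    · intro d _ hd
      rw [smul_comm, hprod, Finset.prod_eq_zero (i := d) (by simp [hd]) (sub_self _), zero_smul,
        smul_zero]
    · simp
  refine hN.map_ne_zero (hx.act_sup_le hP) (hx.smul_ne_zero hN.ker c₀) hz ?_
  rw [← Nat.sub_add_cancel hm, pow_add, mul_smul, h3, smul_zero, map_zero]

theorem finrank_ker_pairMap (hN : Nondegenerate V F G m ε) :
    Module.finrank k (LinearMap.ker (pairMap V F G)) = Module.finrank k V := by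
  have := finrank_act_sup_add_finrank_ker V F G
  rw [hN.finrank_eq] at this
  omega

/-- Let A be the killer of Q = UF + UG, so U ≤ A ≤ V. If dim Q ≥ 2, the previous lemmas exclude
codimension at most 1 for A and dimension 2 for U; with dim V ≤ 5 only U = A of dimension 3 and dim
V = 5 remain. The relations zF + wG = 0 over V form a space of dimension 5; if all had z, w in U,
then dim Q ≤ 6 - 5. Any other relation gives V = A + ⟨z, w⟩, which `false_of_relation` rules out. -/
theorem finrank_act_le_one [Infinite k] (hx : KernelFamily V F G U s x)
    (hN : Nondegenerate V F G m ε) (hm : 3 ≤ m) (hV : Module.finrank k V ≤ 5) :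
    Module.finrank k (act U F ⊔ act U G : Submodule k D) ≤ 1 := by
  classical
  have := hx.finiteDimensional
  by_contra! hQ
  set A := killer V (act U F ⊔ act U G) with hA
  have hAV : A ≤ V := killer_le _ _
  have hAfin : FiniteDimensional k A := Submodule.finiteDimensional_of_le hAV
  have h1 : Module.finrank k A + 1 < Module.finrank k V := by
    by_contra! h
    exact hQ.not_ge (hx.finrank_act_le_one_of_killer hN h)
  have h2 := hx.two_le_finrank hN.ker
  have h3 : Module.finrank k U ≠ 2 := fun h =>
    hQ.not_ge (hx.finrank_act_le_one_of_finrank_eq_two hN.ker h)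
  have h4 : Module.finrank k U ≤ Module.finrank k A := Submodule.finrank_mono hx.le_killer
  have hU : Module.finrank k U = 3 := by omega
  have hV5 : Module.finrank k V = 5 := by omega
  have hUA : U = A := Submodule.eq_of_le_of_finrank_le hx.le_killer (by omega)
  obtain ⟨z, w, hz, hw, hzw, hnot⟩ : ∃ z w : R, z ∈ V ∧ w ∈ V ∧ z • F + w • G = 0 ∧
      ¬ (z ∈ A ∧ w ∈ A) := by
    by_contra! hcon
    have hle : Module.finrank k (LinearMap.ker (pairMap V F G)) ≤
        Module.finrank k (LinearMap.ker (pairMap U F G)) :=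
      finrank_ker_pairMap_le fun z hz w hw h => hUA ▸ hcon z w hz hw h
    rw [finrank_ker_pairMap hN] at hle
    have := finrank_act_sup_add_finrank_ker U F G
    omega
  have hrel := fun c => hx.smul_eq_zero_of_relation hzw c
  have hzA : z ∉ A := fun h => hnot ⟨h, hx.mem_killer_of subset_rfl hw fun c hc => by
    have h5 := hrel c
    rwa [sub_smul, smul_assoc, h.2 _ (Submodule.mem_sup_right
      (smul_mem_act (hx.mem_of_notMem hc) G)), smul_zero, sub_zero] at h5⟩
  -- If w = y + a z with y in A, then (a - c) z kills x_c G, so z kills x_c G for all c ≠ a outside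
  -- `s`, and z would lie in A.
  have hwz : w ∉ A ⊔ Submodule.span k {z} := fun h => hzA <| by
    obtain ⟨y, hy, y', hy', rfl⟩ := Submodule.mem_sup.1 h
    obtain ⟨a, rfl⟩ := Submodule.mem_span_singleton.1 hy'
    refine hx.mem_killer_of (Finset.subset_insert a s) hz fun c hc => ?_
    rw [Finset.mem_insert, not_or] at hc
    have h5 := hrel c
    rw [sub_smul, add_smul, hy.2 _ (Submodule.mem_sup_right
      (smul_mem_act (hx.mem_of_notMem hc.2) G)), zero_add, smul_assoc, smul_assoc,
      ← sub_smul] at h5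
    exact (smul_eq_zero.1 h5).resolve_left (sub_ne_zero.2 (Ne.symm hc.1))
  refine hx.false_of_relation hN hm hU hzw (Eq.ge ?_)
  rw [← hA]
  have hle : A ⊔ Submodule.span k {z, w} ≤ V := sup_le hAV (by
    rw [Submodule.span_le]
    rintro _ (rfl | rfl)
    exacts [hz, hw])
  have hfin : FiniteDimensional k (A ⊔ Submodule.span k {z, w} : Submodule k R) :=
    Submodule.finiteDimensional_of_le hle
  refine Submodule.eq_of_le_of_finrank_le hle ?_
  have hAz : A < A ⊔ Submodule.span k {z} := lt_of_le_of_ne le_sup_left fun h =>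
    hzA (h ▸ Submodule.mem_sup_right (Submodule.mem_span_singleton_self z))
  have hzw' : A ⊔ Submodule.span k {z} < A ⊔ Submodule.span k {z, w} :=
    lt_of_le_of_ne (sup_le_sup_left (Submodule.span_mono (by simp)) _) fun h =>
      hwz (h ▸ Submodule.mem_sup_right (Submodule.subset_span (by simp)))
  have hfin' : FiniteDimensional k (A ⊔ Submodule.span k {z} : Submodule k R) :=
    Submodule.finiteDimensional_of_le (hzw'.le.trans hle)
  have h5 := Submodule.finrank_lt_finrank_of_lt hAz
  have h6 := Submodule.finrank_lt_finrank_of_lt hzw'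
  omega

end KernelFamily
end Pencil
end LevelAlg
end

/-! ### The dichotomy for nondegenerate pencils with dim V ≤ 5. -/

noncomputable section

namespace LevelAlg

section Pencil

variable {k R D : Type*} [Field k] [CommRing R] [Algebra k R] [AddCommGroup D] [Module k D]
  [Module R D] [IsScalarTower k R D]

theorem finrank_lt_finrank_sup_span {M : Type*} [AddCommGroup M] [Module k M] {A : Submodule k M}
    [FiniteDimensional k A] {z : M} (hz : z ∉ A) :
    Module.finrank k A < Module.finrank k (A ⊔ Submodule.span k {z} : Submodule k M) :=
  Submodule.finrank_lt_finrank_of_lt (lt_of_le_of_ne le_sup_left fun h =>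
    hz (h ▸ Submodule.mem_sup_right (Submodule.mem_span_singleton_self z)))

namespace KernelFamily

variable {V : Submodule k R} {F G : D} {U : Submodule k R} {s : Finset k} {x : k → R}
  [FiniteDimensional k V] {m : ℕ} {ε : D →ₗ[k] k}

theorem smul_mem_act_sup (hx : KernelFamily V F G U s x) {c : k} (hc : c ∉ s) :
    x c • G ∈ act U F ⊔ act U G :=
  Submodule.mem_sup_right (smul_mem_act (hx.mem_of_notMem hc) G)

/-- The line Q is spanned by x_c G and also by x_d G, so both w - c z and w - d z kill it, hence so
do z and w. -/
theorem mem_killer_of_relation [Infinite k] (hx : KernelFamily V F G U s x)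
    (hN : Nondegenerate V F G m ε)
    (hQ : Module.finrank k (act U F ⊔ act U G : Submodule k D) = 1)
    {z w : R} (hz : z ∈ V) (hw : w ∈ V) (h : z • F + w • G = 0) :
    z ∈ killer V (act U F ⊔ act U G) ∧ w ∈ killer V (act U F ⊔ act U G) := by
  classical
  obtain ⟨c, hc⟩ := Infinite.exists_notMem_finset s
  have hall : ∀ y ∈ act U F ⊔ act U G, ∃ a : k, a • x c • G = y := fun y hy => by
    obtain ⟨a, ha⟩ := exists_smul_eq_of_finrank_eq_one hQ
      (x := ⟨x c • G, hx.smul_mem_act_sup hc⟩)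
      (fun h => hx.smul_ne_zero hN.ker c (congrArg Subtype.val h)) ⟨y, hy⟩
    exact ⟨a, congrArg Subtype.val ha⟩
  obtain ⟨d, hd⟩ := Infinite.exists_notMem_finset (insert c s)
  rw [Finset.mem_insert, not_or] at hd
  obtain ⟨a, ha⟩ := hall _ (hx.smul_mem_act_sup hd.2)
  have ha0 : a ≠ 0 := by
    rintro rfl
    exact hx.smul_ne_zero hN.ker d (by rw [← ha, zero_smul])
  have h1 := hx.smul_eq_zero_of_relation h c
  have h2 := hx.smul_eq_zero_of_relation h d
  rw [← ha, smul_comm, smul_eq_zero, or_iff_right ha0] at h2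
  have hzc : z • x c • G = 0 := by
    have h3 : (d - c) • z • x c • G = 0 := by
      rw [sub_smul, smul_assoc] at h1 h2
      rw [sub_smul, sub_eq_zero, ← sub_eq_zero.1 h1, ← sub_eq_zero.1 h2]
    exact (smul_eq_zero.1 h3).resolve_left (sub_ne_zero.2 hd.1)
  have hwc : w • x c • G = 0 := by
    rwa [sub_smul, smul_assoc, hzc, smul_zero, sub_zero] at h1
  constructor
  · refine ⟨hz, fun q hq => ?_⟩
    obtain ⟨b, rfl⟩ := hall q hq
    rw [smul_comm, hzc, smul_zero]
  · refine ⟨hw, fun q hq => ?_⟩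
    obtain ⟨b, rfl⟩ := hall q hq
    rw [smul_comm, hwc, smul_zero]

/-- The injection of U into Q × Q is onto by dimension, so some u in U acts on F and G as w does,
and `hN.ker` gives w = u. -/
theorem mem_of_smul_mem (hx : KernelFamily V F G U s x) (hN : Nondegenerate V F G m ε)
    (hQ : Module.finrank k (act U F ⊔ act U G : Submodule k D) = 1)
    (hU : Module.finrank k U = 2) {w : R} (hw : w ∈ V) (hF : w • F ∈ act U F ⊔ act U G)
    (hG : w • G ∈ act U F ⊔ act U G) : w ∈ U := by
  have := hx.finiteDimensional
  obtain ⟨f, hf, hfu⟩ := hx.exists_injective hN.ker le_rfl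
  have hsurj := (LinearMap.injective_iff_surjective_of_finrank_eq_finrank (f := f)
    (by rw [Module.finrank_prod, hQ, hU])).1 hf
  obtain ⟨u, hu⟩ := hsurj (⟨_, hF⟩, ⟨_, hG⟩)
  have h1 : (u : R) • F = w • F := by rw [← (hfu u).1, hu]
  have h2 : (u : R) • G = w • G := by rw [← (hfu u).2, hu]
  have h3 := hN.ker (w - u) (V.sub_mem hw (hx.le u.2)) (by rw [sub_smul, h1, sub_self])
    (by rw [sub_smul, h2, sub_self])
  rw [sub_eq_zero.1 h3]
  exact u.2

/-- Otherwise each c ∉ s has some w_c in A outside U with w_c (F + cG) in Q. Since dim A ≤ 4, two of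
these together with U span A, and a third forces AF + AG into Q + ⟨w_d G⟩, of dimension at most 2;
this contradicts the lower bound dim A - 1 = 3. -/
theorem exists_forall_mem [Infinite k] (hx : KernelFamily V F G U s x)
    (hN : Nondegenerate V F G m ε)
    (hQ : Module.finrank k (act U F ⊔ act U G : Submodule k D) = 1)
    (hU : Module.finrank k U = 2) {A : Submodule k R} (hUA : U ≤ A) (hAV : A ≤ V)
    (hA4 : Module.finrank k A ≤ 4)
    (hAN : Module.finrank k A ≤ Module.finrank k (act A F ⊔ act A G : Submodule k D) + 1) :
    ∃ c ∉ s, ∀ w ∈ A, w • (F + c • G) ∈ act U F ⊔ act U G → w ∈ U := by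
  classical
  have := hx.finiteDimensional
  have hAfin : FiniteDimensional k A := Submodule.finiteDimensional_of_le hAV
  by_contra! hcon
  set Q : Submodule k D := act U F ⊔ act U G with hQdef
  have huQ : ∀ u ∈ U, u • F ∈ Q ∧ u • G ∈ Q := fun u hu =>
    ⟨Submodule.mem_sup_left (smul_mem_act hu F), Submodule.mem_sup_right (smul_mem_act hu G)⟩
  have hexp : ∀ (w : R) (c : k), w • (F + c • G) = w • F + c • w • G := fun w c => by
    rw [smul_add, smul_comm w c]
  -- If w were in U + ⟨w'⟩, then both w (F + cG) and w (F + dG) would lie in Q, hence also wF and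
  -- wG, and w would be in U.
  have hind : ∀ (c d : k) (w w' : R), c ≠ d → w ∈ A → w ∉ U → w • (F + c • G) ∈ Q → w' • (F + d • G) ∈ Q →
      w ∉ U ⊔ Submodule.span k {w'} := fun c d w w' hcd hwA hwU hw hw' hmem => by
    obtain ⟨u, hu, y, hy, rfl⟩ := Submodule.mem_sup.1 hmem
    obtain ⟨a, rfl⟩ := Submodule.mem_span_singleton.1 hy
    have h1 : (u + a • w') • (F + d • G) ∈ Q := by
      rw [add_smul, smul_assoc]
      refine Q.add_mem ?_ (Q.smul_mem _ hw')
      rw [hexp]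
      exact Q.add_mem (huQ u hu).1 (Q.smul_mem _ (huQ u hu).2)
    have h2 := Q.sub_mem hw h1
    rw [hexp, hexp, add_sub_add_left_eq_sub, ← sub_smul] at h2
    have h3 := (Q.smul_mem_iff (sub_ne_zero.2 hcd)).1 h2
    rw [hexp] at hw
    exact hwU (hx.mem_of_smul_mem hN hQ hU (hAV hwA)
      ((Q.add_mem_iff_left (Q.smul_mem _ h3)).1 hw) h3)
  obtain ⟨c, hc⟩ := Infinite.exists_notMem_finset s
  obtain ⟨d, hd⟩ := Infinite.exists_notMem_finset (insert c s)
  obtain ⟨f, hf⟩ := Infinite.exists_notMem_finset (insert d (insert c s))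
  simp only [Finset.mem_insert, not_or] at hd hf
  obtain ⟨wc, hcA, hcQ, hcU⟩ := hcon c hc
  obtain ⟨wd, hdA, hdQ, hdU⟩ := hcon d hd.2
  obtain ⟨wf, hfA, hfQ, hfU⟩ := hcon f hf.2.2
  have h1 := finrank_lt_finrank_sup_span hdU
  have h2 := finrank_lt_finrank_sup_span (hind c d wc wd (Ne.symm hd.1) hcA hcU hcQ hdQ)
  have hspan : U ⊔ Submodule.span k {wd} ⊔ Submodule.span k {wc} = A := by
    refine Submodule.eq_of_le_of_finrank_le (sup_le (sup_le hUA ?_) ?_) (by omega)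
    · simpa using hdA
    · simpa using hcA
  have hdec : ∀ w ∈ A, ∃ u ∈ U, ∃ a b : k, w = u + b • wd + a • wc := fun w hw => by
    rw [← hspan] at hw
    obtain ⟨y, hy, y', hy', rfl⟩ := Submodule.mem_sup.1 hw
    obtain ⟨u, hu, y'', hy'', rfl⟩ := Submodule.mem_sup.1 hy
    obtain ⟨a, rfl⟩ := Submodule.mem_span_singleton.1 hy'
    obtain ⟨b, rfl⟩ := Submodule.mem_span_singleton.1 hy''
    exact ⟨u, hu, a, b, rfl⟩
  set T : Submodule k D := Q ⊔ Submodule.span k {wd • G} with hT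
  have hQT : Q ≤ T := le_sup_left
  have hdG : wd • G ∈ T := Submodule.mem_sup_right (Submodule.mem_span_singleton_self _)
  have hdF : wd • F ∈ T := by
    have := hQT hdQ
    rw [hexp] at this
    exact (T.add_mem_iff_left (T.smul_mem _ hdG)).1 this
  -- Expanding w_f (F + fG) in terms of U, w_d and w_c, and using w_c (F + cG) ∈ Q, isolates a (f -
  -- c) w_c G.
  have hcG : wc • G ∈ T := by
    obtain ⟨u, hu, a, b, hw⟩ := hdec wf hfA
    have ha : a ≠ 0 := by
      rintro rfl
      refine hind f d wf wd hf.1 hfA hfU hfQ hdQ ?_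
      rw [hw, zero_smul, add_zero]
      exact Submodule.add_mem_sup hu (Submodule.mem_span_singleton.2 ⟨b, rfl⟩)
    have h3 : a • (f - c) • wc • G = wf • (F + f • G) - (u • F + f • u • G) -
        b • (wd • F + f • wd • G) - a • wc • (F + c • G) := by
      rw [hexp, hexp, hw]
      simp only [add_smul, smul_assoc]
      module
    have h4 : a • (f - c) • wc • G ∈ T := by
      rw [h3]
      refine T.sub_mem (T.sub_mem (T.sub_mem (hQT hfQ) ?_) ?_) (T.smul_mem _ (hQT hcQ))
      · exact T.add_mem (hQT (huQ u hu).1) (T.smul_mem _ (hQT (huQ u hu).2))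
      · exact T.smul_mem _ (T.add_mem hdF (T.smul_mem _ hdG))
    exact (T.smul_mem_iff (sub_ne_zero.2 hf.2.1)).1 ((T.smul_mem_iff ha).1 h4)
  have hcF : wc • F ∈ T := by
    have := hQT hcQ
    rw [hexp] at this
    exact (T.add_mem_iff_left (T.smul_mem _ hcG)).1 this
  have hNT : act A F ⊔ act A G ≤ T := by
    refine sup_le ?_ ?_
    · intro y hy
      obtain ⟨w, hw, rfl⟩ := mem_act.1 hy
      obtain ⟨u, hu, a, b, rfl⟩ := hdec w hw
      rw [add_smul, add_smul, smul_assoc, smul_assoc]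
      exact T.add_mem (T.add_mem (hQT (huQ u hu).1) (T.smul_mem _ hdF)) (T.smul_mem _ hcF)
    · intro y hy
      obtain ⟨w, hw, rfl⟩ := mem_act.1 hy
      obtain ⟨u, hu, a, b, rfl⟩ := hdec w hw
      rw [add_smul, add_smul, smul_assoc, smul_assoc]
      exact T.add_mem (T.add_mem (hQT (huQ u hu).2) (T.smul_mem _ hdG)) (T.smul_mem _ hcG)
  have h5 := Submodule.finrank_mono hNT
  have h6 := Submodule.finrank_add_le_finrank_add_finrank Q (Submodule.span k {wd • G})
  have h7 := finrank_span_singleton_le (k := k) (wd • G)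
  rw [← hT, hQ] at h6
  rw [hspan] at h2
  omega

end KernelFamily

/-- The structure of a nondegenerate pencil: after replacing `F` by `F + c • G`, either `V` acts
faithfully on `F` and `V • G ≤ V • F`, or `G` extends `F` by one power in each degree. -/
theorem Nondegenerate.dichotomy [Infinite k] {V : Submodule k R} [FiniteDimensional k V] {F G : D}
    {m : ℕ} {ε : D →ₗ[k] k} (hN : Nondegenerate V F G m ε) (hm : 3 ≤ m)
    (hV : Module.finrank k V ≤ 5) :
    ∃ c : k, ((∀ v ∈ V, v • (F + c • G) = 0 → v = 0) ∧ act V G ≤ act V (F + c • G)) ∨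
      ∃ (A : Submodule k R) (x z : R), x ∈ V ∧ x ≠ 0 ∧ A ⊔ Submodule.span k {z} = V ∧
        x • (F + c • G) = 0 ∧ act A G ≤ act V (F + c • G) ∧ ∀ j ≤ m, x • z ^ j • G ≠ 0 := by
  classical
  by_cases hcase : ∃ c : k, ∀ v ∈ V, v • (F + c • G) = 0 → v = 0
  · obtain ⟨c, hc⟩ := hcase
    refine ⟨c, Or.inl ⟨hc, ?_⟩⟩
    have hle : act V (F + c • G) ≤ act V F ⊔ act V G := fun y hy => by
      obtain ⟨v, hv, rfl⟩ := mem_act.1 hy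
      rw [smul_add, smul_comm v c]
      exact Submodule.add_mem_sup (smul_mem_act hv F)
        (Submodule.smul_mem _ _ (smul_mem_act hv G))
    have hfin : Module.finrank k (act V (F + c • G)) = Module.finrank k V := by
      let f : V →ₗ[k] act V (F + c • G) :=
        (((LinearMap.toSpanSingleton R D (F + c • G)).restrictScalars k).domRestrict V).codRestrict
          _ fun v => smul_mem_act v.2 _
      have hf : Function.Injective f := by
        rw [← LinearMap.ker_eq_bot, LinearMap.ker_eq_bot']
        exact fun v hv => Subtype.ext (hc v v.2 (congrArg Subtype.val hv))
      refine le_antisymm ?_ (LinearMap.finrank_le_finrank_of_injective hf)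
      exact Submodule.finrank_map_le _ _
    -- Faithfulness makes V (F + cG) as large as VF + VG, whose dimension is dim V by nondegeneracy.
    have := Submodule.eq_of_le_of_finrank_le hle (by rw [hfin, hN.finrank_eq])
    rw [this]
    exact le_sup_right
  push Not at hcase
  obtain ⟨U, s, x, h1, h2, h3, h4, h5, h6⟩ :=
    exists_stable_kernel (V := V) (F := F) (G := G) fun c => by
      obtain ⟨v, hv, hv1, hv2⟩ := hcase c
      exact ⟨v, hv, hv2, hv1⟩
  have hx : KernelFamily V F G U s x := ⟨h1, h2, h3, h4, h5, h6⟩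
  have := hx.finiteDimensional
  clear h1 h2 h3 h4 h5 h6
  set Q : Submodule k D := act U F ⊔ act U G with hQdef
  set A := killer V Q with hA
  have hAV : A ≤ V := killer_le _ _
  have hAfin : FiniteDimensional k A := Submodule.finiteDimensional_of_le hAV
  have hUA : U ≤ A := hx.le_killer
  obtain ⟨c₀, hc₀⟩ := Infinite.exists_notMem_finset s
  have hQ0 : Q ≠ ⊥ := fun h => hx.smul_ne_zero hN.ker c₀ (by
    have := hx.smul_mem_act_sup hc₀
    rw [← hQdef, h] at this
    exact (Submodule.mem_bot k).1 this)
  have hQ : Module.finrank k Q = 1 := by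
    have h1 := hx.finrank_act_le_one hN hm hV
    have h2 := mt Submodule.finrank_eq_zero.1 hQ0
    rw [← hQdef] at h1
    omega
  have hU : Module.finrank k U = 2 := by
    have h1 := hx.two_le_finrank hN.ker
    have h2 := hx.finrank_le_two_mul hN.ker
    rw [← hQdef, hQ] at h2
    omega
  -- If A were V, then V would act on x_{c₀} G through z = 0, and 0 ^ m = 0 contradicts
  -- nondegeneracy.
  have hAneV : A ≠ V := fun h => by
    refine hN.map_ne_zero (hx.act_sup_le (hx.smul_mem_act_sup hc₀)) (hx.smul_ne_zero hN.ker c₀)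
      (z := 0) (exists_smul_eq_of_sup_span (A := A) le_rfl (h.ge.trans le_sup_left)
        (hx.smul_mem_act_sup hc₀)) ?_
    rw [zero_pow (by omega), zero_smul, map_zero]
  have hAltV := Submodule.finrank_lt_finrank_of_lt (lt_of_le_of_ne hAV hAneV)
  have hQN : Q ≤ act A F ⊔ act A G := sup_le_sup (act_mono hUA F) (act_mono hUA G)
  -- All relations over V are relations over A, so the relation spaces of V and A have the same
  -- dimension, dim V.
  have hNA : Module.finrank k (act A F ⊔ act A G : Submodule k D) + Module.finrank k V =
      2 * Module.finrank k A := by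
    rw [← finrank_act_sup_add_finrank_ker A F G, ← KernelFamily.finrank_ker_pairMap hN]
    congr 1
    exact le_antisymm
      (finrank_ker_pairMap_le fun z hz w hw h => hx.mem_killer_of_relation hN hQ hz hw h)
      (finrank_ker_pairMap_le fun z hz w hw _ => ⟨hAV hz, hAV hw⟩)
  have hQN' := Submodule.finrank_mono hQN
  -- In codimension at least 2 one has dim A ≤ 3, so AF + AG has dimension 2 dim A - dim V ≤ 1 and
  -- equals Q. Then A ≤ U has dimension 2, and 4 - dim V ≥ 1 contradicts dim V ≥ 4.
  have hAcodim : Module.finrank k V ≤ Module.finrank k A + 1 := by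
    by_contra! hlt
    have hQeq : Q = act A F ⊔ act A G := Submodule.eq_of_le_of_finrank_le hQN (by omega)
    have hAU : A ≤ U := fun w hw => hx.mem_of_smul_mem hN hQ hU (hAV hw)
      (by rw [← hQdef, hQeq]; exact Submodule.mem_sup_left (smul_mem_act hw F))
      (by rw [← hQdef, hQeq]; exact Submodule.mem_sup_right (smul_mem_act hw G))
    have := Submodule.finrank_mono hAU
    omega
  obtain ⟨z, hzV, hzA, hz⟩ := exists_sup_span_of_finrank_le hAV hAcodim hAneV
  obtain ⟨c, hc, hcU⟩ := hx.exists_forall_mem hN hQ hU hUA hAV (by omega) (by omega)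
  rw [← hQdef] at hcU
  refine ⟨c, Or.inr ⟨A, x c, z, hx.mem c, hx.ne_zero c, hz, ?_, ?_, fun j hj h0 => ?_⟩⟩
  · rw [smul_add, hx.smul_fst, smul_comm (x c) c, neg_add_cancel]
  -- Q is a line, spanned by x_d G for any d ≠ c outside `s`, and x_d (F + cG) = (c - d) x_d G.
  · have hQF : Q ≤ act V (F + c • G) := by
      obtain ⟨d, hd⟩ := Infinite.exists_notMem_finset (insert c s)
      rw [Finset.mem_insert, not_or] at hd
      intro y hy
      obtain ⟨a, ha⟩ := exists_smul_eq_of_finrank_eq_one hQ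
        (x := ⟨x d • G, hx.smul_mem_act_sup hd.2⟩)
        (fun h => hx.smul_ne_zero hN.ker d (congrArg Subtype.val h)) ⟨y, hy⟩
      have ha' : a • x d • G = y := congrArg Subtype.val ha
      refine mem_act.2 ⟨(a * (c - d)⁻¹) • x d, V.smul_mem _ (hx.mem d), ?_⟩
      rw [← ha', smul_assoc, smul_add, hx.smul_fst, smul_comm (x d) c, neg_add_eq_sub, ← sub_smul,
        smul_smul, mul_assoc, inv_mul_cancel₀ (sub_ne_zero.2 (Ne.symm hd.1)), mul_one]
    have hle : act A (F + c • G) ⊔ Q ≤ act A F ⊔ act A G := by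
      refine sup_le (fun y hy => ?_) hQN
      obtain ⟨v, hv, rfl⟩ := mem_act.1 hy
      rw [smul_add, smul_comm v c]
      exact Submodule.add_mem_sup (smul_mem_act hv F)
        (Submodule.smul_mem _ _ (smul_mem_act hv G))
    -- By the choice of c, the kernel embeds in U, of dimension 2. So A (F + cG) + Q has dimension
    -- at least dim A - 1 = dim(AF + AG), and the two spaces coincide.
    let f : A × Q →ₗ[k] D :=
      (((LinearMap.toSpanSingleton R D (F + c • G)).restrictScalars k).domRestrict A).coprod
        Q.subtype
    have hf : ∀ p, f p = (p.1 : R) • (F + c • G) + p.2 := fun _ => rfl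
    have hrange : LinearMap.range f = act A (F + c • G) ⊔ Q := by
      rw [LinearMap.range_coprod, act, LinearMap.range_domRestrict, Submodule.range_subtype]
    have hkerf : ∀ p ∈ LinearMap.ker f, (p.1 : R) ∈ U := fun p hp => by
      rw [LinearMap.mem_ker, hf] at hp
      refine hcU _ p.1.2 ?_
      rw [eq_neg_of_add_eq_zero_left hp]
      exact Q.neg_mem p.2.2
    have hker : Module.finrank k (LinearMap.ker f) ≤ Module.finrank k U := by
      let g : LinearMap.ker f →ₗ[k] U :=
        { toFun := fun p => ⟨p.1.1, hkerf p.1 p.2⟩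
          map_add' := fun _ _ => rfl
          map_smul' := fun _ _ => rfl }
      refine LinearMap.finrank_le_finrank_of_injective (f := g) fun p q hpq => ?_
      have e1 : (p.1.1 : R) = q.1.1 := congrArg (fun y : U => (y : R)) hpq
      have e2 : f p.1 = f q.1 := p.2.trans q.2.symm
      rw [hf, hf, e1, add_right_inj] at e2
      exact Subtype.ext (Prod.ext (Subtype.ext e1) (Subtype.ext e2))
    have hrk := LinearMap.finrank_range_add_finrank_ker f
    rw [hrange, Module.finrank_prod] at hrk
    have hEq := Submodule.eq_of_le_of_finrank_le hle (by omega)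
    refine (le_sup_right.trans hEq.ge).trans (sup_le (act_mono hAV _) hQF)
  · refine hN.map_ne_zero (hx.act_sup_le (hx.smul_mem_act_sup hc)) (hx.smul_ne_zero hN.ker c)
      (exists_smul_eq_of_sup_span (A := A) le_rfl hz.ge (hx.smul_mem_act_sup hc)) ?_
    rw [← Nat.sub_add_cancel hj, pow_add, mul_smul, smul_comm (z ^ j) (x c), h0, smul_zero,
      map_zero]

end Pencil
end LevelAlg
end

/-! ### Growth of the spaces V^i F and V^i F + V^i G. -/

noncomputable section

namespace LevelAlg

theorem finrank_homogeneousSubmodule (k : Type*) [Field k] (n d : ℕ) :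
    Module.finrank k (homogeneousSubmodule (Fin n) k d) = n.multichoose d := by
  rw [homogeneousSubmodule_eq_finsupp_supported,
    (AddMonoidAlgebra.supportedEquivFinsupp _).finrank_eq]
  have hs : {f : Fin n →₀ ℕ | f.degree = d} =
      ((Finset.univ.finsuppAntidiag d : Finset (Fin n →₀ ℕ)) : Set (Fin n →₀ ℕ)) := by
    ext f
    simp [Finset.mem_finsuppAntidiag, Finsupp.degree_eq_sum]
  rw [hs, Module.finrank_finsupp_self, ← Nat.card_eq_fintype_card,
    Nat.card_coe_set_eq, Set.ncard_coe_finset,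
    Finset.card_finsuppAntidiag_nat_eq_multichoose, Finset.card_univ, Fintype.card_fin]

section
variable {k R D : Type*} [Field k] [CommRing R] [Algebra k R] [AddCommGroup D] [Module k D]
  [Module R D] [IsScalarTower k R D]

instance (V : Submodule k R) [FiniteDimensional k V] (i : ℕ) : FiniteDimensional k ↥(V ^ i) :=
  Module.Finite.iff_fg.2 ((Module.Finite.iff_fg.1 ‹_›).pow i)

/-- T^i is the image of the forms of degree i in dim T variables. -/
theorem finrank_pow_le (T : Submodule k R) [FiniteDimensional k T] (i : ℕ) :
    Module.finrank k ↥(T ^ i) ≤ (Module.finrank k T).multichoose i := by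
  let b := Module.finBasis k T
  let f : MvPolynomial (Fin (Module.finrank k T)) k →ₐ[k] R := aeval fun j => (b j : R)
  have hT : T = (homogeneousSubmodule (Fin (Module.finrank k T)) k 1).map f.toLinearMap := by
    rw [homogeneousSubmodule_one_eq_span_X, Submodule.map_span, ← Set.range_comp]
    have h1 : (f.toLinearMap ∘ X) = (T.subtype ∘ b) := by
      funext j
      simp [f]
    rw [h1, Set.range_comp, ← Submodule.map_span, b.span_eq, Submodule.map_top,
      Submodule.range_subtype]
  rw [← finrank_homogeneousSubmodule k, ← homogeneousSubmodule_one_pow]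
  conv_lhs => rw [hT, ← Submodule.map_pow]
  have : FiniteDimensional k ↥(homogeneousSubmodule (Fin (Module.finrank k T)) k 1) :=
    Module.Finite.iff_fg.2 (homogeneousSubmodule_fg ..)
  exact Submodule.finrank_map_le _ _

theorem exists_relative_complement {V K : Submodule k R} [FiniteDimensional k V] (hK : K ≤ V) :
    ∃ T ≤ V, K ⊔ T = V ∧ Module.finrank k K + Module.finrank k T = Module.finrank k V := by
  obtain ⟨T, hT⟩ := Submodule.exists_isCompl K
  have h1 : K ⊔ (T ⊓ V) = V := by rw [← sup_inf_assoc_of_le T hK, hT.sup_eq_top, top_inf_eq]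
  have h2 : K ⊓ (T ⊓ V) = ⊥ := by rw [← inf_assoc, hT.inf_eq_bot, bot_inf_eq]
  have : FiniteDimensional k K := Submodule.finiteDimensional_of_le hK
  have : FiniteDimensional k ↥(T ⊓ V) := Submodule.finiteDimensional_of_le inf_le_right
  refine ⟨T ⊓ V, inf_le_right, h1, ?_⟩
  have h3 := Submodule.finrank_sup_add_finrank_inf_eq K (T ⊓ V)
  rw [h1, h2, finrank_bot] at h3
  omega

theorem act_mul_le {S T : Submodule k R} {F : D} {N : Submodule k D}
    (h : ∀ s ∈ S, ∀ t ∈ T, s • t • F ∈ N) : act (S * T) F ≤ N := by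
  rw [act, Submodule.map_le_iff_le_comap, Submodule.mul_le]
  intro s hs t ht
  simpa [mul_smul] using h s hs t ht

theorem act_sup_left (S T : Submodule k R) (F : D) : act (S ⊔ T) F = act S F ⊔ act T F :=
  Submodule.map_sup _ _ _

/-- A product of i + 1 elements of A + T either uses only T or contains a factor from A. -/
theorem pow_succ_le_sup {V A T : Submodule k R} (h : A ⊔ T = V) (i : ℕ) :
    V ^ (i + 1) ≤ T ^ (i + 1) ⊔ A * V ^ i := by
  induction i with
  | zero => simp [← h, sup_comm]
  | succ i ih =>
    have hTV : T ≤ V := h ▸ le_sup_right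
    calc V ^ (i + 1 + 1) = (A ⊔ T) * V ^ (i + 1) := by rw [h, pow_succ' V (i + 1)]
      _ = A * V ^ (i + 1) ⊔ T * V ^ (i + 1) := Submodule.sup_mul _ _ _
      _ ≤ A * V ^ (i + 1) ⊔ T * (T ^ (i + 1) ⊔ A * V ^ i) :=
          sup_le_sup_left (mul_le_mul' le_rfl ih) _
      _ = A * V ^ (i + 1) ⊔ (T ^ (i + 1 + 1) ⊔ A * (T * V ^ i)) := by
          rw [Submodule.mul_sup, ← pow_succ' T, mul_left_comm]
      _ ≤ T ^ (i + 1 + 1) ⊔ A * V ^ (i + 1) := by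
          refine sup_le le_sup_right (sup_le le_sup_left (le_sup_of_le_right ?_))
          refine mul_le_mul' le_rfl ?_
          rw [pow_succ' V i]
          exact mul_le_mul' hTV le_rfl

theorem act_mul_pow_le {A V : Submodule k R} {F G : D} (h : act A G ≤ act V F) (i : ℕ) :
    act (A * V ^ i) G ≤ act (V ^ (i + 1)) F := by
  refine act_mul_le fun a ha v hv => ?_
  obtain ⟨u, hu, hu'⟩ := mem_act.1 (h (smul_mem_act ha G))
  rw [smul_comm, ← hu', ← mul_smul, pow_succ]
  exact smul_mem_act (Submodule.mul_mem_mul hv hu) F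

/-- Modulo V^{i+1} F, only products from T matter for G: a factor in A converts G into an element of
VF. Taking F = 0 covers linear forms that kill G. -/
theorem act_pow_succ_le {A T V : Submodule k R} {F G : D} (hV : A ⊔ T = V)
    (h : act A G ≤ act V F) (i : ℕ) :
    act (V ^ (i + 1)) G ≤ act (T ^ (i + 1)) G ⊔ act (V ^ (i + 1)) F :=
  (act_mono (pow_succ_le_sup hV i) G).trans (by
    rw [act_sup_left]
    exact sup_le_sup_left (act_mul_pow_le h i) _)

theorem finrank_act_le (S : Submodule k R) [FiniteDimensional k S] (F : D) :
    Module.finrank k (act S F) ≤ Module.finrank k S := Submodule.finrank_map_le _ _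

/-- The elements of `V` that send `G` into the subspace `N`. -/
def transporter (V : Submodule k R) (G : D) (N : Submodule k D) : Submodule k R :=
  V ⊓ N.comap ((LinearMap.toSpanSingleton R D G).restrictScalars k)

theorem mem_transporter {V : Submodule k R} {G : D} {N : Submodule k D} {v : R} :
    v ∈ transporter V G N ↔ v ∈ V ∧ v • G ∈ N := by
  simp [transporter]

/-- Rank-nullity for (n, v) ↦ n + vG, whose kernel is a copy of the transporter. -/
theorem finrank_sup_le_transporter (V : Submodule k R) [FiniteDimensional k V] (G : D)
    (N : Submodule k D) [FiniteDimensional k N] :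
    Module.finrank k (N ⊔ act V G : Submodule k D) + Module.finrank k (transporter V G N) =
      Module.finrank k N + Module.finrank k V := by
  let f : N × V →ₗ[k] D := N.subtype.coprod
    (((LinearMap.toSpanSingleton R D G).restrictScalars k).domRestrict V)
  have hf : ∀ p, f p = p.1 + (p.2 : R) • G := fun _ => rfl
  have hrange : LinearMap.range f = N ⊔ act V G := by
    rw [LinearMap.range_coprod, act, LinearMap.range_domRestrict, Submodule.range_subtype]
  have hfin : FiniteDimensional k (transporter V G N) :=
    Submodule.finiteDimensional_of_le inf_le_left
  have hker : Module.finrank k (LinearMap.ker f) = Module.finrank k (transporter V G N) := by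
    let g : LinearMap.ker f →ₗ[k] transporter V G N :=
      { toFun := fun p => ⟨p.1.2, mem_transporter.2 ⟨p.1.2.2, by
          have h : f p.1 = 0 := p.2
          rw [hf] at h
          rw [eq_neg_of_add_eq_zero_right h]
          exact N.neg_mem p.1.1.2⟩⟩
        map_add' := fun _ _ => rfl
        map_smul' := fun _ _ => rfl }
    refine (LinearEquiv.ofBijective g ⟨fun p q hpq => ?_, fun v => ?_⟩).finrank_eq
    · have e1 : (p.1.2 : R) = q.1.2 := congrArg (fun y : transporter V G N => (y : R)) hpq
      have e2 : f p.1 = f q.1 := p.2.trans q.2.symm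
      rw [hf, hf, e1, add_left_inj] at e2
      exact Subtype.ext (Prod.ext (Subtype.ext e2) (Subtype.ext e1))
    · have hv := mem_transporter.1 v.2
      refine ⟨⟨(⟨-((v : R) • G), N.neg_mem hv.2⟩, ⟨v, hv.1⟩), ?_⟩, rfl⟩
      rw [LinearMap.mem_ker, hf]
      exact neg_add_cancel _
  have := LinearMap.finrank_range_add_finrank_ker f
  rwa [hrange, hker, Module.finrank_prod] at this

/-- Only a complement T of the annihilator of F in V contributes, and dim T = dim VF. -/
theorem finrank_act_pow_le (V : Submodule k R) [FiniteDimensional k V] (F : D) (i : ℕ) :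
    Module.finrank k (act (V ^ (i + 1)) F) ≤
      (Module.finrank k (act V F)).multichoose (i + 1) := by
  have h0 : (⊥ : Submodule k D) ⊔ act V F = act V F := bot_sup_eq _
  obtain ⟨T, hTV, hT, hfin⟩ :=
    exists_relative_complement (V := V) (K := transporter V F ⊥) inf_le_left
  have : FiniteDimensional k T := Submodule.finiteDimensional_of_le hTV
  have h1 := finrank_sup_le_transporter V F ⊥
  rw [h0, finrank_bot] at h1
  have h2 : Module.finrank k T = Module.finrank k (act V F) := by omega
  have h3 := act_pow_succ_le (G := F) (F := (0 : D)) hT (fun y hy => by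
    obtain ⟨v, hv, rfl⟩ := mem_act.1 hy
    rw [(Submodule.mem_bot k).1 (mem_transporter.1 hv).2]
    exact Submodule.zero_mem _) i
  have h4 : act (V ^ (i + 1)) (0 : D) = ⊥ := by
    rw [eq_bot_iff]
    intro y hy
    obtain ⟨v, hv, rfl⟩ := mem_act.1 hy
    simp
  rw [h4, sup_bot_eq] at h3
  rw [← h2]
  exact (Submodule.finrank_mono h3).trans ((finrank_act_le _ F).trans (finrank_pow_le T _))

/-- T is a complement of the elements moving G into VF; its dimension is that of (VF + VG)/VF. -/
theorem finrank_act_pow_sup_le (V : Submodule k R) [FiniteDimensional k V] (F G : D) (i : ℕ) :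
    Module.finrank k (act (V ^ (i + 1)) F ⊔ act (V ^ (i + 1)) G : Submodule k D) ≤
      (Module.finrank k (act V F)).multichoose (i + 1) +
      (Module.finrank k (act V F ⊔ act V G : Submodule k D) -
        Module.finrank k (act V F)).multichoose (i + 1) := by
  obtain ⟨T, hTV, hT, hfin⟩ :=
    exists_relative_complement (V := V) (K := transporter V G (act V F)) inf_le_left
  have : FiniteDimensional k T := Submodule.finiteDimensional_of_le hTV
  have h1 := finrank_sup_le_transporter V G (act V F)
  have h2 : Module.finrank k T = Module.finrank k (act V F ⊔ act V G : Submodule k D) -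
        Module.finrank k (act V F) := by omega
  have h3 := act_pow_succ_le (G := G) (F := F) hT (fun y hy => by
    obtain ⟨v, hv, rfl⟩ := mem_act.1 hy
    exact (mem_transporter.1 hv).2) i
  have h4 : act (V ^ (i + 1)) F ⊔ act (V ^ (i + 1)) G ≤
      act (V ^ (i + 1)) F ⊔ act (T ^ (i + 1)) G :=
    sup_le le_sup_left (h3.trans (sup_comm _ _).le)
  refine (Submodule.finrank_mono h4).trans
    ((Submodule.finrank_add_le_finrank_add_finrank _ _).trans ?_)
  rw [← h2]
  exact add_le_add (finrank_act_pow_le V F i) ((finrank_act_le _ G).trans (finrank_pow_le T _))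

theorem finrank_act_pow_le_of_smul_eq_zero {V : Submodule k R} [FiniteDimensional k V] {F : D}
    {x : R} (hx : x ∈ V) (hx0 : x ≠ 0) (h : x • F = 0) (i : ℕ) :
    Module.finrank k (act (V ^ (i + 1)) F) ≤ (Module.finrank k V - 1).multichoose (i + 1) := by
  obtain ⟨T, hTV, hT, hfin⟩ := exists_relative_complement (V := V)
    (K := Submodule.span k {x}) (by simpa using hx)
  have : FiniteDimensional k T := Submodule.finiteDimensional_of_le hTV
  rw [finrank_span_singleton hx0] at hfin
  have h3 := act_pow_succ_le (G := F) (F := (0 : D)) hT (fun y hy => by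
    obtain ⟨v, hv, rfl⟩ := mem_act.1 hy
    obtain ⟨a, rfl⟩ := Submodule.mem_span_singleton.1 hv
    rw [smul_assoc, h, smul_zero]
    exact Submodule.zero_mem _) i
  have h4 : act (V ^ (i + 1)) (0 : D) = ⊥ := by
    rw [eq_bot_iff]
    intro y hy
    obtain ⟨v, hv, rfl⟩ := mem_act.1 hy
    simp
  rw [h4, sup_bot_eq] at h3
  rw [show Module.finrank k V - 1 = Module.finrank k T by omega]
  exact (Submodule.finrank_mono h3).trans ((finrank_act_le _ F).trans (finrank_pow_le T _))

/-- Modulo V^{i+1} F only z^{i+1} G survives from G. It does not lie in V^{i+1} F, because x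
annihilates that space but not z^{i+1} G. -/
theorem finrank_act_pow_sup_of_extension {V A : Submodule k R} [FiniteDimensional k V] {F G : D}
    {x z : R} (hA : A ⊔ Submodule.span k {z} = V) (hx : x • F = 0)
    (hAG : act A G ≤ act V F) {i : ℕ} (hi : x • z ^ (i + 1) • G ≠ 0) :
    Module.finrank k (act (V ^ (i + 1)) F ⊔ act (V ^ (i + 1)) G : Submodule k D) =
      Module.finrank k (act (V ^ (i + 1)) F) + 1 := by
  have hz : z ∈ V := hA ▸ Submodule.mem_sup_right (Submodule.mem_span_singleton_self z)
  have h1 : act (V ^ (i + 1)) F ⊔ act (V ^ (i + 1)) G =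
      act (V ^ (i + 1)) F ⊔ Submodule.span k {z ^ (i + 1) • G} := by
    refine le_antisymm (sup_le le_sup_left ?_) (sup_le_sup_left ?_ _)
    · refine (act_pow_succ_le hA hAG i).trans (sup_le (le_sup_of_le_right ?_) le_sup_left)
      intro y hy
      obtain ⟨v, hv, rfl⟩ := mem_act.1 hy
      rw [Submodule.span_pow, Set.singleton_pow] at hv
      obtain ⟨a, rfl⟩ := Submodule.mem_span_singleton.1 hv
      rw [smul_assoc]
      exact Submodule.smul_mem _ _ (Submodule.mem_span_singleton_self _)
    · rw [Submodule.span_singleton_le_iff_mem]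
      exact smul_mem_act (Submodule.pow_mem_pow V hz _) G
  have h2 : z ^ (i + 1) • G ∉ act (V ^ (i + 1)) F := fun h => by
    obtain ⟨v, hv, hv'⟩ := mem_act.1 h
    rw [← hv', smul_comm, hx, smul_zero] at hi
    exact hi rfl
  rw [h1]
  refine le_antisymm ?_ (Nat.succ_le_of_lt (finrank_lt_finrank_sup_span h2))
  exact (Submodule.finrank_add_le_finrank_add_finrank _ _).trans
    (Nat.add_le_add_left (finrank_span_singleton_le _) _)

theorem act_pow_le_of_act_le {V : Submodule k R} {F G : D} (h : act V G ≤ act V F) (i : ℕ) :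
    act (V ^ (i + 1)) G ≤ act (V ^ (i + 1)) F := by
  have := act_mul_pow_le h i
  rwa [← pow_succ' V i] at this

/-- Faithfulness defines an endomorphism B of V by vG = B(v)F. An endomorphism for which every v and
B v are dependent is scalar, which `hne` excludes. -/
theorem exists_linearIndependent_smul_eq {V : Submodule k R} {F G : D}
    (hF : ∀ v ∈ V, v • F = 0 → v = 0) (h : act V G ≤ act V F)
    (hne : ∀ c : k, ∃ v ∈ V, v • G ≠ c • v • F) :
    ∃ v ∈ V, ∃ w ∈ V, LinearIndependent k ![v, w] ∧ v • G = w • F := by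
  let f : V →ₗ[k] act V F :=
    (((LinearMap.toSpanSingleton R D F).restrictScalars k).domRestrict V).codRestrict
      _ fun v => smul_mem_act v.2 _
  have hf : Function.Bijective f := by
    constructor
    · rw [← LinearMap.ker_eq_bot, LinearMap.ker_eq_bot']
      exact fun v hv => Subtype.ext (hF v v.2 (congrArg Subtype.val hv))
    · rintro ⟨y, hy⟩
      obtain ⟨v, hv, rfl⟩ := mem_act.1 hy
      exact ⟨⟨v, hv⟩, rfl⟩
  let e := LinearEquiv.ofBijective f hf
  let g : V →ₗ[k] act V F :=
    (((LinearMap.toSpanSingleton R D G).restrictScalars k).domRestrict V).codRestrict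
      _ fun v => h (smul_mem_act v.2 _)
  let B : V →ₗ[k] V := e.symm.toLinearMap ∘ₗ g
  have hB : ∀ v, (B v : R) • F = (v : R) • G := fun v => by
    have h1 : e (B v) = g v := e.apply_symm_apply _
    exact congrArg Subtype.val h1
  by_cases hlin : ∀ v, ¬ LinearIndependent k ![v, B v]
  · obtain ⟨a, ha⟩ := LinearMap.exists_eq_smul_id_of_forall_notLinearIndependent hlin
    obtain ⟨v, hv, hv'⟩ := hne a
    refine absurd ?_ hv'
    rw [← hB ⟨v, hv⟩, ha]
    simp
  · push Not at hlin
    obtain ⟨v, hv⟩ := hlin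
    refine ⟨v, v.2, B v, (B v).2, ?_, (hB v).symm⟩
    rw [LinearIndependent.pair_iff] at hv ⊢
    exact fun a b hab => hv a b (Subtype.ext hab)

/-- For u in V, w u F = u v G = v u' F with u' in V: multiplication by w can be traded for
multiplication by v. Hence V^{j+1} F is spanned by products from a hyperplane T that contains v but
not w, together with the single vector w v^j F. -/
theorem finrank_act_pow_le_of_linearIndependent {V : Submodule k R} [FiniteDimensional k V]
    {F G : D} (h : act V G ≤ act V F) {v w : R} (hv : v ∈ V) (hw : w ∈ V)
    (hvw : LinearIndependent k ![v, w]) (hvG : v • G = w • F) (i : ℕ) :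
    Module.finrank k (act (V ^ (i + 1)) F) ≤
      (Module.finrank k V - 1).multichoose (i + 1) + 1 := by
  have hwV : ∀ u ∈ V, ∃ u' ∈ V, w • u • F = v • u' • F := fun u hu => by
    obtain ⟨u', hu', hu''⟩ := mem_act.1 (h (smul_mem_act hu G))
    exact ⟨u', hu', by rw [hu'', smul_comm w u, ← hvG, smul_comm]⟩
  have hwpow : ∀ (j : ℕ), ∀ y ∈ V ^ (j + 1), ∃ y' ∈ V ^ (j + 1), w • y • F = v • y' • F := by
    intro j y hy
    rw [pow_succ V j] at hy ⊢
    induction hy using Submodule.mul_induction_on' with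
    | mem_mul_mem m hm u hu =>
      obtain ⟨u', hu', hu''⟩ := hwV u hu
      refine ⟨m * u', Submodule.mul_mem_mul hm hu', ?_⟩
      rw [mul_smul, smul_comm w m, hu'', smul_comm m v, mul_smul]
    | add y _ z _ hy hz =>
      obtain ⟨y', hy', hy''⟩ := hy
      obtain ⟨z', hz', hz''⟩ := hz
      exact ⟨y' + z', Submodule.add_mem _ hy' hz', by
        rw [add_smul, smul_add, hy'', hz'', add_smul, smul_add]⟩
  obtain ⟨T₀, hT₀V, hT₀, hfin⟩ := exists_relative_complement (V := V)
    (K := Submodule.span k {v, w}) (by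
      rw [Submodule.span_le]
      rintro _ (rfl | rfl)
      exacts [hv, hw])
  rw [finrank_span_pair hvw] at hfin
  have : FiniteDimensional k T₀ := Submodule.finiteDimensional_of_le hT₀V
  set T := Submodule.span k {v} ⊔ T₀ with hT
  have hTV : T ≤ V := sup_le (by simpa using hv) hT₀V
  have hvT : v ∈ T := Submodule.mem_sup_left (Submodule.mem_span_singleton_self v)
  have hTw : V = T ⊔ Submodule.span k {w} := by
    rw [hT, ← hT₀, Submodule.span_insert, sup_assoc, sup_assoc, sup_comm T₀]
  have hTfin : Module.finrank k T ≤ Module.finrank k V - 1 := by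
    have h1 := Submodule.finrank_add_le_finrank_add_finrank (Submodule.span k {v}) T₀
    have h2 := finrank_span_singleton_le (k := k) v
    rw [← hT] at h1
    omega
  -- In the inductive step a leading w is traded for v in T; for t in T, the term t w v^j F becomes
  -- v times an element of V^{j+1} F, to which the induction hypothesis applies once more.
  have key : ∀ j : ℕ, act (V ^ (j + 1)) F ≤
      act (T ^ (j + 1)) F ⊔ Submodule.span k {w • v ^ j • F} := by
    intro j
    induction j with
    | zero =>
      rw [zero_add, pow_one, pow_one, pow_zero, one_smul]
      intro y hy
      obtain ⟨u, hu, rfl⟩ := mem_act.1 hy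
      rw [hTw] at hu
      obtain ⟨t, ht, y', hy', rfl⟩ := Submodule.mem_sup.1 hu
      obtain ⟨a, rfl⟩ := Submodule.mem_span_singleton.1 hy'
      rw [add_smul, smul_assoc]
      exact Submodule.add_mem_sup (smul_mem_act ht F) (Submodule.mem_span_singleton.2 ⟨a, rfl⟩)
    | succ j ih =>
      set N := act (T ^ (j + 1 + 1)) F ⊔ Submodule.span k {w • v ^ (j + 1) • F} with hN
      have hwN : w • v ^ (j + 1) • F ∈ N :=
        Submodule.mem_sup_right (Submodule.mem_span_singleton_self _)
      have hTN : ∀ t ∈ T ^ (j + 1 + 1), t • F ∈ N := fun t ht =>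
        Submodule.mem_sup_left (smul_mem_act ht F)
      have hTT : ∀ t ∈ T, ∀ t' ∈ T ^ (j + 1), t • t' • F ∈ N := fun t ht t' ht' => by
        rw [← mul_smul]
        refine hTN _ ?_
        rw [pow_succ' T (j + 1)]
        exact Submodule.mul_mem_mul ht ht'
      have hvN : ∀ y ∈ V ^ (j + 1), v • y • F ∈ N := fun y hy => by
        obtain ⟨y₁, hy₁, y₂, hy₂, hy₃⟩ := Submodule.mem_sup.1 (ih (smul_mem_act hy F))
        obtain ⟨t, ht, rfl⟩ := mem_act.1 hy₁
        obtain ⟨a, rfl⟩ := Submodule.mem_span_singleton.1 hy₂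
        rw [← hy₃, smul_add, smul_comm v a, smul_comm v w, ← mul_smul v (v ^ j),
          ← pow_succ' v]
        exact N.add_mem (hTT v hvT t ht) (N.smul_mem _ hwN)
      rw [pow_succ' V (j + 1)]
      refine act_mul_le fun u hu y hy => ?_
      rw [hTw] at hu
      obtain ⟨t, ht, u', hu', rfl⟩ := Submodule.mem_sup.1 hu
      obtain ⟨a, rfl⟩ := Submodule.mem_span_singleton.1 hu'
      rw [add_smul, smul_assoc]
      refine N.add_mem ?_ (N.smul_mem _ ?_)
      · obtain ⟨y₁, hy₁, y₂, hy₂, hy₃⟩ := Submodule.mem_sup.1 (ih (smul_mem_act hy F))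
        obtain ⟨t', ht', rfl⟩ := mem_act.1 hy₁
        obtain ⟨b, rfl⟩ := Submodule.mem_span_singleton.1 hy₂
        rw [← hy₃, smul_add, smul_comm t b]
        refine N.add_mem (hTT t ht t' ht') (N.smul_mem _ ?_)
        obtain ⟨u', hu', hu''⟩ := hwV t (hTV ht)
        have h1 : t • w • v ^ j • F = v • (v ^ j * u') • F := by
          rw [smul_comm t w, smul_comm t (v ^ j), smul_comm w (v ^ j), hu'', smul_comm (v ^ j) v,
            mul_smul]
        rw [h1]
        refine hvN _ ?_
        rw [pow_succ V j]
        exact Submodule.mul_mem_mul (Submodule.pow_mem_pow V hv _) hu'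
      · obtain ⟨y', hy', hy''⟩ := hwpow j y hy
        rw [hy'']
        exact hvN y' hy'
  have : FiniteDimensional k T := Submodule.finiteDimensional_of_le hTV
  refine (Submodule.finrank_mono (key i)).trans
    ((Submodule.finrank_add_le_finrank_add_finrank _ _).trans ?_)
  refine add_le_add ((finrank_act_le _ F).trans ((finrank_pow_le T _).trans ?_))
    (finrank_span_singleton_le _)
  rw [Nat.multichoose_eq, Nat.multichoose_eq]
  exact Nat.choose_le_choose _ (by omega)

end
end LevelAlg
end

/-! ### Contraction of functionals and Macaulay duality. -/

noncomputable section

namespace LevelAlg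

variable {k : Type*} [Field k] {r : ℕ}

/-- The space of forms of degree `d` in `r` variables. -/
abbrev forms (k : Type*) [Field k] (r d : ℕ) : Submodule k (MvPolynomial (Fin r) k) :=
  homogeneousSubmodule (Fin r) k d

instance (d : ℕ) : FiniteDimensional k (forms k r d) :=
  Module.Finite.iff_fg.2 (homogeneousSubmodule_fg ..)

theorem mul_mem_forms {p q : MvPolynomial (Fin r) k} {i j : ℕ} (hp : p ∈ forms k r i)
    (hq : q ∈ forms k r j) : p * q ∈ forms k r (i + j) :=
  IsHomogeneous.mul hp hq

/-- The linear functionals on the polynomial ring. -/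
abbrev Functional (k : Type*) [Field k] (r : ℕ) : Type _ :=
  Module.Dual k (MvPolynomial (Fin r) k)

/-- Polynomials act on functionals by contraction: `(p • φ) q = φ (p * q)`. -/
instance contraction : Module (MvPolynomial (Fin r) k) (Functional k r) where
  smul p φ := φ ∘ₗ LinearMap.mulLeft k p
  one_smul φ := LinearMap.ext fun q => congrArg φ (one_mul q)
  mul_smul p q φ := LinearMap.ext fun m => congrArg φ (by
    change p * q * m = q * (p * m)
    ring)
  smul_zero _ := rfl
  smul_add _ _ _ := rfl
  add_smul p q φ := LinearMap.ext fun m => by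
    change φ ((p + q) * m) = φ (p * m) + φ (q * m)
    rw [add_mul, map_add]
  zero_smul φ := LinearMap.ext fun m => by
    change φ (0 * m) = 0
    rw [zero_mul, map_zero]

theorem contract_apply (p q : MvPolynomial (Fin r) k) (φ : Functional k r) :
    (p • φ) q = φ (p * q) := rfl

instance : IsScalarTower k (MvPolynomial (Fin r) k) (Functional k r) where
  smul_assoc c p φ := LinearMap.ext fun m => by
    rw [contract_apply, LinearMap.smul_apply, contract_apply, smul_mul_assoc, map_smul]

theorem functional_ext {φ ψ : Functional k r} (h : ∀ d, ∀ q ∈ forms k r d, φ q = ψ q) :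
    φ = ψ := by
  refine LinearMap.ext fun p => ?_
  rw [← sum_homogeneousComponent p, map_sum, map_sum]
  exact Finset.sum_congr rfl fun i _ => h i _ (homogeneousComponent_mem i p)

/-- The functionals that are concentrated in degree `e`. -/
def functionals (k : Type*) [Field k] (r e : ℕ) : Submodule k (Functional k r) where
  carrier := {φ | ∀ d, d ≠ e → ∀ q ∈ forms k r d, φ q = 0}
  zero_mem' := fun _ _ _ _ => rfl
  add_mem' := fun h1 h2 d hd q hq => by rw [LinearMap.add_apply, h1 d hd q hq, h2 d hd q hq, add_zero]
  smul_mem' := fun c _ h d hd q hq => by rw [LinearMap.smul_apply, h d hd q hq, smul_zero]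

theorem eq_of_mem_functionals {e : ℕ} {φ ψ : Functional k r} (hφ : φ ∈ functionals k r e)
    (hψ : ψ ∈ functionals k r e) (h : ∀ q ∈ forms k r e, φ q = ψ q) : φ = ψ :=
  functional_ext fun d q hq => by
    by_cases hd : d = e
    · subst hd
      exact h q hq
    · rw [hφ d hd q hq, hψ d hd q hq]

theorem contract_mem_functionals {i j e : ℕ} (hij : i + j = e) {p : MvPolynomial (Fin r) k}
    (hp : p ∈ forms k r i) {φ : Functional k r} (hφ : φ ∈ functionals k r e) :
    p • φ ∈ functionals k r j := fun d hd q hq =>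
  hφ (i + d) (by omega) _ (mul_mem_forms hp hq)

theorem contract_eq_zero {i e : ℕ} (hi : e < i) {p : MvPolynomial (Fin r) k}
    (hp : p ∈ forms k r i) {φ : Functional k r} (hφ : φ ∈ functionals k r e) : p • φ = 0 :=
  functional_ext fun d q hq => hφ (i + d) (by omega) _ (mul_mem_forms hp hq)

theorem act_le_functionals {i j e : ℕ} (hij : i + j = e) {φ : Functional k r}
    (hφ : φ ∈ functionals k r e) : act (forms k r i) φ ≤ functionals k r j := fun y hy => by
  obtain ⟨p, hp, rfl⟩ := mem_act.1 hy
  exact contract_mem_functionals hij hp hφ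

theorem map_mul_eq_component {i j e : ℕ} (hij : i + j = e) {φ : Functional k r}
    (hφ : φ ∈ functionals k r e) (p : MvPolynomial (Fin r) k) {q : MvPolynomial (Fin r) k}
    (hq : q ∈ forms k r j) : φ (p * q) = φ (homogeneousComponent i p * q) := by
  have h0 : ∀ d, d ≠ i → φ (homogeneousComponent d p * q) = 0 := fun d hd =>
    hφ (d + j) (by omega) _ (mul_mem_forms (homogeneousComponent_mem d p) hq)
  conv_lhs => rw [← sum_homogeneousComponent p, Finset.sum_mul, map_sum]
  by_cases hi : i ∈ Finset.range (p.totalDegree + 1)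
  · exact Finset.sum_eq_single_of_mem i hi fun d _ hd => h0 d hd
  · rw [Finset.sum_eq_zero fun d hd => h0 d (fun h => hi (h ▸ hd)),
      homogeneousComponent_eq_zero i p (by rw [Finset.mem_range] at hi; omega), zero_mul,
      map_zero]

theorem component_contract_eq_zero {e : ℕ} {φ : Functional k r} (hφ : φ ∈ functionals k r e)
    {p : MvPolynomial (Fin r) k} (hp : p • φ = 0) (i : ℕ) :
    homogeneousComponent i p • φ = 0 := functional_ext fun d q hq => by
  by_cases hd : i + d = e
  · rw [contract_apply, ← map_mul_eq_component hd hφ p hq, ← contract_apply, hp]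
  · exact hφ (i + d) hd _ (mul_mem_forms (homogeneousComponent_mem i p) hq)

/-- Evaluation of a functional at the constant polynomial `1`. -/
def evalOne (k : Type*) [Field k] (r : ℕ) : Functional k r →ₗ[k] k := LinearMap.applyₗ 1

theorem evalOne_contract (p : MvPolynomial (Fin r) k) (φ : Functional k r) :
    evalOne k r (p • φ) = φ p := by
  change φ (p * 1) = φ p
  rw [mul_one]

/-- The common annihilator of two functionals. -/
def pairAnn (F G : Functional k r) : Ideal (MvPolynomial (Fin r) k) :=
  LinearMap.ker (LinearMap.toSpanSingleton _ _ F) ⊓ LinearMap.ker (LinearMap.toSpanSingleton _ _ G)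

theorem mem_pairAnn {F G : Functional k r} {p : MvPolynomial (Fin r) k} :
    p ∈ pairAnn F G ↔ p • F = 0 ∧ p • G = 0 := by
  simp [pairAnn]

/-- The forms of degree `d` on which all functionals in `N` vanish. -/
def vanishing (d : ℕ) (N : Submodule k (Functional k r)) : Submodule k (MvPolynomial (Fin r) k) where
  carrier := {q | q ∈ forms k r d ∧ ∀ φ ∈ N, φ q = 0}
  zero_mem' := ⟨Submodule.zero_mem _, fun φ _ => map_zero φ⟩
  add_mem' := fun h1 h2 => ⟨Submodule.add_mem _ h1.1 h2.1, fun φ hφ => by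
    rw [map_add, h1.2 φ hφ, h2.2 φ hφ, add_zero]⟩
  smul_mem' := fun c _ h => ⟨Submodule.smul_mem _ c h.1, fun φ hφ => by
    rw [map_smul, h.2 φ hφ, smul_zero]⟩

theorem mem_vanishing {d : ℕ} {N : Submodule k (Functional k r)} {q : MvPolynomial (Fin r) k} :
    q ∈ vanishing d N ↔ q ∈ forms k r d ∧ ∀ φ ∈ N, φ q = 0 := Iff.rfl

theorem vanishing_le (d : ℕ) (N : Submodule k (Functional k r)) : vanishing d N ≤ forms k r d :=
  fun _ h => h.1

theorem finrank_map_add_finrank_inf_ker {M M' : Type*} [AddCommGroup M] [Module k M]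
    [AddCommGroup M'] [Module k M'] (f : M →ₗ[k] M') (S : Submodule k M) [FiniteDimensional k S] :
    Module.finrank k (S.map f) + Module.finrank k (S ⊓ LinearMap.ker f : Submodule k M) =
      Module.finrank k S := by
  rw [← LinearMap.finrank_range_add_finrank_ker (f.domRestrict S), LinearMap.range_domRestrict,
    LinearMap.ker_domRestrict, ← Submodule.finrank_map_subtype_eq S, Submodule.map_comap_subtype]

theorem finrank_add_finrank_vanishing {d : ℕ} {N : Submodule k (Functional k r)}
    (hN : N ≤ functionals k r d) :
    Module.finrank k N + Module.finrank k (vanishing d N) =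
      Module.finrank k (forms k r d) := by
  have hinj : Function.Injective ((forms k r d).dualRestrict.domRestrict N) := by
    intro φ ψ h
    refine Subtype.ext (eq_of_mem_functionals (hN φ.2) (hN ψ.2) fun q hq => ?_)
    exact LinearMap.congr_fun h ⟨q, hq⟩
  have h1 : Module.finrank k (N.map (forms k r d).dualRestrict) = Module.finrank k N := by
    rw [← LinearMap.range_domRestrict]
    exact LinearMap.finrank_range_of_inj hinj
  have h2 := Subspace.finrank_add_finrank_dualCoannihilator_eq
    (N.map (forms k r d).dualRestrict)
  have : vanishing d N = Submodule.map (forms k r d).subtype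
      (N.map (forms k r d).dualRestrict).dualCoannihilator := by
    ext q
    simp only [mem_vanishing, Submodule.mem_map, Submodule.mem_dualCoannihilator,
      forall_exists_index, and_imp, forall_apply_eq_imp_iff₂, Submodule.dualRestrict_apply]
    constructor
    · rintro ⟨h3, h4⟩
      exact ⟨⟨q, h3⟩, h4, rfl⟩
    · rintro ⟨q, h3, rfl⟩
      exact ⟨q.2, h3⟩
  rw [← h2, h1, this, Submodule.finrank_map_subtype_eq]

instance {d : ℕ} : FiniteDimensional k (functionals k r d) := by
  have hinj : Function.Injective ((forms k r d).dualRestrict.domRestrict (functionals k r d)) := by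
    intro φ ψ h
    refine Subtype.ext (eq_of_mem_functionals φ.2 ψ.2 fun q hq => ?_)
    exact LinearMap.congr_fun h ⟨q, hq⟩
  exact Module.Finite.of_injective _ hinj

/-- F(pq) is symmetric in p and q: a form q kills F exactly when all contractions pF of
complementary degree vanish at q. -/
theorem vanishing_act_sup {i d e : ℕ} (hid : i + d = e) {F G : Functional k r}
    (hF : F ∈ functionals k r e) (hG : G ∈ functionals k r e) :
    vanishing d (act (forms k r i) F ⊔ act (forms k r i) G) =
      forms k r d ⊓ (pairAnn F G).restrictScalars k := by
  have key : ∀ {F : Functional k r}, F ∈ functionals k r e → ∀ {q}, q ∈ forms k r d →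
      (q • F = 0 ↔ ∀ φ ∈ act (forms k r i) F, φ q = 0) := fun {F} hF {q} hq => by
    constructor
    · intro h φ hφ
      obtain ⟨p, hp, rfl⟩ := mem_act.1 hφ
      rw [contract_apply, mul_comm, ← contract_apply, h, LinearMap.zero_apply]
    · intro h
      refine eq_of_mem_functionals (contract_mem_functionals (by omega : d + i = e) hq hF)
        (Submodule.zero_mem _) fun p hp => ?_
      rw [contract_apply, mul_comm, ← contract_apply]
      exact h _ (smul_mem_act hp F)
  ext q
  rw [mem_vanishing, Submodule.mem_inf, Submodule.restrictScalars_mem, mem_pairAnn]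
  refine and_congr_right fun hq => ?_
  rw [key hF hq, key hG hq]
  constructor
  · exact fun h => ⟨fun φ hφ => h φ (Submodule.mem_sup_left hφ),
      fun φ hφ => h φ (Submodule.mem_sup_right hφ)⟩
  · rintro ⟨h1, h2⟩ φ hφ
    obtain ⟨φ₁, hφ₁, φ₂, hφ₂, rfl⟩ := Submodule.mem_sup.1 hφ
    rw [LinearMap.add_apply, h1 _ hφ₁, h2 _ hφ₂, add_zero]

theorem hVector_add_finrank (I : Ideal (MvPolynomial (Fin r) k)) (d : ℕ) :
    hVector I d + Module.finrank k (forms k r d ⊓ I.restrictScalars k : Submodule k _) =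
      Module.finrank k (forms k r d) := by
  have h : I.restrictScalars k = LinearMap.ker (Ideal.Quotient.mkₐ k I).toLinearMap := by
    ext q
    simp [Ideal.Quotient.eq_zero_iff_mem]
  rw [← finrank_map_add_finrank_inf_ker (Ideal.Quotient.mkₐ k I).toLinearMap (forms k r d), h]
  rfl

/-- Macaulay duality: the `h`-vector counts contractions of the defining functionals. -/
theorem hVector_pairAnn {i d e : ℕ} (hid : i + d = e) {F G : Functional k r}
    (hF : F ∈ functionals k r e) (hG : G ∈ functionals k r e) :
    hVector (pairAnn F G) d =
      Module.finrank k (act (forms k r i) F ⊔ act (forms k r i) G : Submodule k _) := by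
  have h1 := hVector_add_finrank (pairAnn F G) d
  have h2 := finrank_add_finrank_vanishing (d := d)
    (sup_le (act_le_functionals hid hF) (act_le_functionals hid hG))
  rw [vanishing_act_sup hid hF hG] at h2
  omega

theorem act_zero (S : Submodule k (MvPolynomial (Fin r) k)) :
    act S (0 : Functional k r) = ⊥ := by
  rw [eq_bot_iff]
  intro y hy
  obtain ⟨v, hv, rfl⟩ := mem_act.1 hy
  rw [smul_zero]
  exact Submodule.zero_mem _

/-- Symmetry of the Gorenstein h-vector: h_d of R/Ann(F) is computed once by duality, with G = 0,
and once by rank-nullity for q ↦ qF. -/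
theorem finrank_act_symm {i d e : ℕ} (hid : i + d = e) {F : Functional k r}
    (hF : F ∈ functionals k r e) :
    Module.finrank k (act (forms k r i) F) = Module.finrank k (act (forms k r d) F) := by
  have h1 := hVector_pairAnn hid hF (Submodule.zero_mem _)
  rw [act_zero, sup_bot_eq] at h1
  rw [← h1]
  have h2 := hVector_add_finrank (pairAnn F 0) d
  have h3 := finrank_map_add_finrank_inf_ker
    ((LinearMap.toSpanSingleton (MvPolynomial (Fin r) k) _ F).restrictScalars k) (forms k r d)
  have h4 : (pairAnn F 0).restrictScalars k = LinearMap.ker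
      ((LinearMap.toSpanSingleton (MvPolynomial (Fin r) k) _ F).restrictScalars k) := by
    ext q
    simp [mem_pairAnn]
  rw [h4] at h2
  unfold act
  omega

end LevelAlg
end

/-! ### Level algebras of type 2 as annihilators of two functionals. -/

noncomputable section

namespace LevelAlg

attribute [local instance] MvPolynomial.gradedAlgebra

variable {k : Type*} [Field k] {r : ℕ}

instance (I : Ideal (MvPolynomial (Fin r) k)) (d : ℕ) : FiniteDimensional k (gradedPiece I d) := by
  unfold gradedPiece
  infer_instance

theorem mem_gradedPiece {I : Ideal (MvPolynomial (Fin r) k)} {d : ℕ}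
    {a : MvPolynomial (Fin r) k ⧸ I} :
    a ∈ gradedPiece I d ↔ ∃ p ∈ forms k r d, Ideal.Quotient.mk I p = a := by
  simp [gradedPiece]

theorem mk_mem_gradedPiece (I : Ideal (MvPolynomial (Fin r) k)) {d : ℕ}
    {p : MvPolynomial (Fin r) k} (hp : p ∈ forms k r d) :
    Ideal.Quotient.mk I p ∈ gradedPiece I d := mem_gradedPiece.2 ⟨p, hp, rfl⟩

theorem mem_socle {I : Ideal (MvPolynomial (Fin r) k)} {p : MvPolynomial (Fin r) k} :
    Ideal.Quotient.mk I p ∈ socle I ↔ ∀ j, p * X j ∈ I := by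
  rw [socle, maxHomIdeal, Ideal.span, Submodule.mem_annihilator_span]
  simp [← map_mul, Ideal.Quotient.eq_zero_iff_mem]

theorem X_mem_forms (j : Fin r) : (X j : MvPolynomial (Fin r) k) ∈ forms k r 1 :=
  isHomogeneous_X k j

theorem hVector_eq_zero_iff {I : Ideal (MvPolynomial (Fin r) k)} {d : ℕ} :
    hVector I d = 0 ↔ ∀ p ∈ forms k r d, p ∈ I := by
  rw [hVector, Submodule.finrank_eq_zero, eq_bot_iff]
  constructor
  · intro h p hp
    exact Ideal.Quotient.eq_zero_iff_mem.1 ((Submodule.mem_bot k).1 (h (mk_mem_gradedPiece I hp)))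
  · intro h a ha
    obtain ⟨p, hp, rfl⟩ := mem_gradedPiece.1 ha
    exact (Submodule.mem_bot k).2 (Ideal.Quotient.eq_zero_iff_mem.2 (h p hp))

theorem gradedPiece_le_socle {I : Ideal (MvPolynomial (Fin r) k)} {e : ℕ}
    (h : hVector I (e + 1) = 0) : gradedPiece I e ≤ (socle I).restrictScalars k := fun a ha => by
  obtain ⟨p, hp, rfl⟩ := mem_gradedPiece.1 ha
  exact mem_socle.2 fun j => hVector_eq_zero_iff.1 h _ (mul_mem_forms hp (X_mem_forms j))

theorem IsLevel.hVector_top {I : Ideal (MvPolynomial (Fin r) k)} {e t : ℕ} (h : IsLevel I e t) :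
    hVector I e = t := by
  have h1 := h.socleVector_eq e
  rw [if_pos rfl, socleVector,
    inf_eq_right.2 (gradedPiece_le_socle (h.eq_zero_above _ e.lt_succ_self))] at h1
  exact h1

/-- The coordinate functionals of the top degree component. -/
theorem IsLevel.exists_functionals {I : Ideal (MvPolynomial (Fin r) k)} {e : ℕ}
    (h : IsLevel I e 2) :
    ∃ F ∈ functionals k r e, ∃ G ∈ functionals k r e, I = pairAnn F G := by
  let b : Module.Basis (Fin 2) k (gradedPiece I e) :=
    Module.finBasisOfFinrankEq k _ h.hVector_top
  let π : MvPolynomial (Fin r) k →ₗ[k] gradedPiece I e :=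
    ((Ideal.Quotient.mkₐ k I).toLinearMap ∘ₗ homogeneousComponent e).codRestrict _
      fun p => mk_mem_gradedPiece I (homogeneousComponent_mem e p)
  have hπ : ∀ p, ((π p : gradedPiece I e) : MvPolynomial (Fin r) k ⧸ I) =
      Ideal.Quotient.mk I (homogeneousComponent e p) := fun _ => rfl
  have hπ0 : ∀ p, π p = 0 ↔ homogeneousComponent e p ∈ I := fun p => by
    rw [← Ideal.Quotient.eq_zero_iff_mem, ← hπ, ZeroMemClass.coe_eq_zero]
  let F : Fin 2 → Functional k r := fun i => b.coord i ∘ₗ π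
  have hF : ∀ i, F i ∈ functionals k r e := fun i d hd q hq => by
    have : π q = 0 := by
      rw [hπ0, homogeneousComponent_of_mem hq, if_neg (Ne.symm hd)]
      exact I.zero_mem
    change b.coord i (π q) = 0
    rw [this, map_zero]
  have hF0 : ∀ p, (∀ i, F i p = 0) ↔ homogeneousComponent e p ∈ I := fun p => by
    rw [← hπ0]
    exact b.forall_coord_eq_zero_iff
  have hIle : I ≤ pairAnn (F 0) (F 1) := fun p hp => by
    have key : ∀ i, p • F i = 0 := fun i => LinearMap.ext fun m =>
      (hF0 (p * m)).2 (homogeneousComponent_mem_of_mem h.homogeneous (I.mul_mem_right m hp) e) i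
    exact mem_pairAnn.2 ⟨key 0, key 1⟩
  -- Descending induction on the degree: if p lies in the annihilator, every p X_j is in I by
  -- induction, so p is a socle element of degree d < e and vanishes by levelness.
  have hform : ∀ n d, e - d = n → ∀ p ∈ forms k r d, p ∈ pairAnn (F 0) (F 1) → p ∈ I := by
    intro n
    induction n with
    | zero =>
      intro d hd p hp hpA
      rcases (Nat.sub_eq_zero_iff_le.1 hd).lt_or_eq with hlt | rfl
      · exact hVector_eq_zero_iff.1 (h.eq_zero_above d hlt) p hp
      · rw [← homogeneousComponent_eq_self hp, ← hF0]
        have h1 := mem_pairAnn.1 hpA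
        intro i
        have h2 : p • F i = 0 := by fin_cases i; exacts [h1.1, h1.2]
        rw [← evalOne_contract, h2, map_zero]
    | succ n ih =>
      intro d hd p hp hpA
      have h1 : Ideal.Quotient.mk I p ∈
          ((socle I).restrictScalars k ⊓ gradedPiece I d : Submodule k _) :=
        ⟨mem_socle.2 fun j => ih (d + 1) (by omega) _ (mul_mem_forms hp (X_mem_forms j))
          (Ideal.mul_mem_right _ _ hpA), mk_mem_gradedPiece I hp⟩
      have h2 := h.socleVector_eq d
      rw [if_neg (by omega), socleVector] at h2
      have : FiniteDimensional k
          ((socle I).restrictScalars k ⊓ gradedPiece I d : Submodule k _) :=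
        Submodule.finiteDimensional_of_le inf_le_right
      rw [Submodule.finrank_eq_zero] at h2
      rw [h2] at h1
      exact Ideal.Quotient.eq_zero_iff_mem.1 ((Submodule.mem_bot k).1 h1)
  refine ⟨F 0, hF 0, F 1, hF 1, le_antisymm hIle fun p hp => ?_⟩
  rw [mem_iff_homogeneousComponent_mem h.homogeneous]
  intro d
  refine hform _ d rfl _ (homogeneousComponent_mem d p) ?_
  rw [mem_pairAnn] at hp ⊢
  exact ⟨component_contract_eq_zero (hF 0) hp.1 d, component_contract_eq_zero (hF 1) hp.2 d⟩

theorem pairAnn_isHomogeneous {e : ℕ} {F G : Functional k r} (hF : F ∈ functionals k r e)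
    (hG : G ∈ functionals k r e) :
    (pairAnn F G).IsHomogeneous (homogeneousSubmodule (Fin r) k) := by
  intro i p hp
  rw [mem_pairAnn] at hp
  have h : ((DirectSum.decompose (homogeneousSubmodule (Fin r) k) p i : homogeneousSubmodule (Fin r) k i) :
      MvPolynomial (Fin r) k) = homogeneousComponent i p := decomposition.decompose'_apply p i
  rw [h, mem_pairAnn]
  exact ⟨component_contract_eq_zero hF hp.1 i, component_contract_eq_zero hG hp.2 i⟩

/-- Forms of degree d + 1 are sums of products of a linear form and a form of degree d; positivity
of the degree is essential. -/
theorem eq_zero_of_X_contract {d : ℕ} {φ : Functional k r} (hφ : φ ∈ functionals k r (d + 1))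
    (h : ∀ j, (X j : MvPolynomial (Fin r) k) • φ = 0) : φ = 0 := by
  refine eq_of_mem_functionals hφ (Submodule.zero_mem _) fun q hq => ?_
  rw [forms, ← homogeneousSubmodule_one_pow, pow_succ', homogeneousSubmodule_one_eq_span_X] at hq
  induction hq using Submodule.mul_induction_on' with
  | mem_mul_mem v hv m hm =>
    rw [← contract_apply]
    suffices v • φ = 0 by rw [this, LinearMap.zero_apply, LinearMap.zero_apply]
    induction hv using Submodule.span_induction with
    | mem y hy => obtain ⟨j, rfl⟩ := hy; exact h j
    | zero => exact zero_smul _ _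
    | add y y' _ _ h1 h2 => rw [add_smul, h1, h2, add_zero]
    | smul a y _ h1 => rw [smul_assoc, h1, smul_zero]
  | add y _ z _ hy hz => rw [map_add, hy, hz, map_add]

/-- Two functionals of degree `e` define a level algebra of type `2`. -/
theorem isLevel_pairAnn {e : ℕ} {F G : Functional k r} (hF : F ∈ functionals k r e)
    (hG : G ∈ functionals k r e)
    (h2 : Module.finrank k (act (forms k r 0) F ⊔ act (forms k r 0) G : Submodule k _) = 2)
    (h1 : ∀ x ∈ forms k r 1, x • F = 0 → x • G = 0 → x = 0) :
    IsLevel (pairAnn F G) e 2 := by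
  have htop : hVector (pairAnn F G) e = 2 := by
    rw [hVector_pairAnn (zero_add e) hF hG, h2]
  have habove : ∀ d, e < d → hVector (pairAnn F G) d = 0 := fun d hd =>
    hVector_eq_zero_iff.2 fun p hp =>
      mem_pairAnn.2 ⟨contract_eq_zero hd hp hF, contract_eq_zero hd hp hG⟩
  refine { homogeneous := pairAnn_isHomogeneous hF hG, artinian := ?_, no_linear_form := ?_,
           top_ne_zero := by rw [htop]; decide, eq_zero_above := habove, socleVector_eq := ?_ }
  · have hfin : FiniteDimensional k (MvPolynomial (Fin r) k ⧸ pairAnn F G) := by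
      have hS : (⨆ d : Fin (e + 1), gradedPiece (pairAnn F G) d) = ⊤ := by
        rw [eq_top_iff]
        rintro a -
        obtain ⟨p, rfl⟩ := Ideal.Quotient.mk_surjective a
        rw [← sum_homogeneousComponent p, map_sum]
        refine Submodule.sum_mem _ fun d _ => ?_
        by_cases hd : d < e + 1
        · exact Submodule.mem_iSup_of_mem (⟨d, hd⟩ : Fin (e + 1))
            (mk_mem_gradedPiece _ (homogeneousComponent_mem d p))
        · rw [Ideal.Quotient.eq_zero_iff_mem.2 (hVector_eq_zero_iff.1 (habove d (by omega)) _
            (homogeneousComponent_mem d p))]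
          exact Submodule.zero_mem _
      have : FiniteDimensional k (⨆ d : Fin (e + 1), gradedPiece (pairAnn F G) d :
        Submodule k (MvPolynomial (Fin r) k ⧸ pairAnn F G)) := inferInstance
      rw [hS] at this
      exact Module.finite_def.2 (Module.Finite.iff_fg.1 this)
    exact IsArtinianRing.of_finite k _
  · intro f hf hf1
    rw [mem_pairAnn] at hf
    exact h1 f hf1 hf.1 hf.2
  · intro d
    split_ifs with hd
    · subst hd
      rw [socleVector, inf_eq_right.2 (gradedPiece_le_socle (habove _ d.lt_succ_self))]
      exact htop
    · rcases lt_or_gt_of_ne hd with hlt | hgt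
      · have hbot : ((socle (pairAnn F G)).restrictScalars k ⊓ gradedPiece (pairAnn F G) d :
            Submodule k _) = ⊥ := by
          rw [eq_bot_iff]
          rintro a ⟨ha1, ha2⟩
          obtain ⟨p, hp, rfl⟩ := mem_gradedPiece.1 ha2
          have h3 : ∀ j, p * X j ∈ pairAnn F G := mem_socle.1 ha1
          obtain ⟨n, hn⟩ := Nat.exists_eq_add_of_lt hlt
          -- If all p X_j kill φ, then pφ has positive degree n + 1 and is killed by every variable,
          -- so it is zero.
          have key : ∀ {φ : Functional k r}, φ ∈ functionals k r e →
              (∀ j, (p * X j) • φ = 0) → p • φ = 0 := fun {φ} hφ h4 =>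
            eq_zero_of_X_contract (d := n)
              (contract_mem_functionals (by omega : d + (n + 1) = e) hp hφ)
              fun j => by rw [← mul_smul, mul_comm, h4 j]
          exact (Submodule.mem_bot k).2 (Ideal.Quotient.eq_zero_iff_mem.2 (mem_pairAnn.2
            ⟨key hF fun j => (mem_pairAnn.1 (h3 j)).1, key hG fun j => (mem_pairAnn.1 (h3 j)).2⟩))
        rw [socleVector, hbot, finrank_bot]
      · rw [socleVector, Submodule.finrank_eq_zero.1 (habove d hgt), inf_bot_eq, finrank_bot]

end LevelAlg
end

/-! ### Upper bounds and symmetry of the entries. -/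

noncomputable section

namespace LevelAlg

variable {k : Type*} [Field k] {r : ℕ}

theorem multichoose_mono (i : ℕ) {m n : ℕ} (h : m ≤ n) : m.multichoose i ≤ n.multichoose i := by
  rw [Nat.multichoose_eq, Nat.multichoose_eq]
  exact Nat.choose_le_choose _ (by omega)

/-- Convexity in the first argument: the increments multichoose(m + 1, i) of m ↦ multichoose(m, i +
1) are nondecreasing in m. -/
theorem multichoose_add_le {b t : ℕ} (h : b ≤ t) (n i : ℕ) :
    (b + n).multichoose i + t.multichoose i ≤ (t + n).multichoose i + b.multichoose i := by
  cases i with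
  | zero => simp
  | succ i =>
    induction n with
    | zero => simp [add_comm]
    | succ n ih =>
      rw [← add_assoc, ← add_assoc, Nat.multichoose_succ_succ, Nat.multichoose_succ_succ]
      have := multichoose_mono i (show b + n + 1 ≤ t + n + 1 by omega)
      omega

theorem forms_one_pow (i : ℕ) : forms k r 1 ^ i = forms k r i :=
  homogeneousSubmodule_one_pow ..

theorem finrank_forms (k : Type*) [Field k] (r d : ℕ) :
    Module.finrank k (forms k r d) = r.multichoose d := finrank_homogeneousSubmodule k r d

theorem hVector_le (I : Ideal (MvPolynomial (Fin r) k)) (d : ℕ) :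
    hVector I d ≤ r.multichoose d := by
  have := hVector_add_finrank I d
  rw [finrank_forms] at this
  omega

theorem act_add_smul_sup {R D : Type*} [CommRing R] [Algebra k R] [AddCommGroup D] [Module k D]
    [Module R D] [IsScalarTower k R D] (S : Submodule k R) (F G : D) (c : k) :
    act S (F + c • G) ⊔ act S G = act S F ⊔ act S G := by
  refine le_antisymm (sup_le ?_ le_sup_right) (sup_le ?_ le_sup_right)
  · intro y hy
    obtain ⟨v, hv, rfl⟩ := mem_act.1 hy
    rw [smul_add, smul_comm v c]
    exact Submodule.add_mem_sup (smul_mem_act hv F) (Submodule.smul_mem _ _ (smul_mem_act hv G))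
  · intro y hy
    obtain ⟨v, hv, rfl⟩ := mem_act.1 hy
    have : v • F = v • (F + c • G) + (-c) • v • G := by
      rw [smul_add, smul_comm v c, neg_smul, add_neg_cancel_right]
    rw [this]
    exact Submodule.add_mem_sup (smul_mem_act hv _) (Submodule.smul_mem _ _ (smul_mem_act hv G))

/-- The upper bound for the entries of a level `h`-vector `(1, r, …, a, 2)` with `r < a`. -/
theorem IsLevel.hVector_le_of_lt {I : Ideal (MvPolynomial (Fin r) k)} {e : ℕ} (h : IsLevel I e 2)
    (hr : r ≤ hVector I (e - 1)) {i : ℕ} (hi : 1 ≤ i) (hie : i ≤ e) :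
    hVector I (e - i) ≤ min (r.multichoose i + (hVector I (e - 1) - r).multichoose i)
      (r.multichoose (e - i)) := by
  refine le_min ?_ (hVector_le I _)
  obtain ⟨F, hF, G, hG, rfl⟩ := h.exists_functionals
  obtain ⟨j, rfl⟩ := Nat.exists_eq_add_of_le' hi
  rw [hVector_pairAnn (by omega : j + 1 + (e - (j + 1)) = e) hF hG]
  rw [hVector_pairAnn (by omega : 1 + (e - 1) = e) hF hG] at hr ⊢
  have h1 := finrank_act_pow_sup_le (forms k r 1) F G j
  rw [forms_one_pow] at h1
  refine h1.trans ?_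
  have hFr := finrank_act_le (forms k r 1) F
  have hGr := finrank_act_le (forms k r 1) G
  have hsum := Submodule.finrank_add_le_finrank_add_finrank (act (forms k r 1) F)
    (act (forms k r 1) G)
  have hFle := Submodule.finrank_mono
    (le_sup_left : act (forms k r 1) F ≤ act (forms k r 1) F ⊔ act (forms k r 1) G)
  rw [finrank_forms, Nat.multichoose_one_right] at hFr hGr
  set s := Module.finrank k (act (forms k r 1) F)
  set a := Module.finrank k (act (forms k r 1) F ⊔ act (forms k r 1) G : Submodule k _)
  -- Both s and a - s lie between a - r and r, so by convexity the sum is largest at the extreme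
  -- split r + (a - r).
  have h2 := multichoose_add_le (show a - r ≤ a - s by omega) (r - (a - s)) (j + 1)
  rw [show a - r + (r - (a - s)) = s by omega, show a - s + (r - (a - s)) = r by omega] at h2
  exact h2

/-- Nonproportional functionals from the type being `2`. -/
theorem exists_contract_ne {e : ℕ} (he : 1 ≤ e) {F G : Functional k r}
    (hF : F ∈ functionals k r e) (hG : G ∈ functionals k r e)
    (h2 : Module.finrank k (act (forms k r 0) F ⊔ act (forms k r 0) G : Submodule k _) = 2)
    (c : k) : ∃ v ∈ forms k r 1, v • G ≠ c • v • F := by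
  by_contra! hcon
  obtain ⟨d, rfl⟩ := Nat.exists_eq_add_of_le' he
  -- Were G proportional to F on all first contractions, it would equal cF, and the type would be at
  -- most 1.
  have h0 : G - c • F = 0 := eq_zero_of_X_contract (d := d)
    (Submodule.sub_mem _ hG (Submodule.smul_mem _ _ hF)) fun j => by
      rw [smul_sub, hcon _ (X_mem_forms j), smul_comm, sub_self]
  rw [sub_eq_zero] at h0
  have hle : act (forms k r 0) F ⊔ act (forms k r 0) G ≤ act (forms k r 0) F := by
    refine sup_le le_rfl fun y hy => ?_
    obtain ⟨v, hv, rfl⟩ := mem_act.1 hy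
    rw [h0, smul_comm]
    exact Submodule.smul_mem _ _ (smul_mem_act hv F)
  have h3 := (Submodule.finrank_mono hle).trans (finrank_act_le _ F)
  rw [h2, finrank_forms, Nat.multichoose_zero_right] at h3
  omega

theorem IsLevel.nondegenerate {e : ℕ} (he : 1 ≤ e) {F G : Functional k r}
    (hF : F ∈ functionals k r e) (hG : G ∈ functionals k r e) (h : IsLevel (pairAnn F G) e 2)
    (hr : hVector (pairAnn F G) (e - 1) = r) :
    Nondegenerate (forms k r 1) F G (e - 1) (evalOne k r) where
  eq_zero := fun P hP h0 => by
    rw [forms_one_pow] at h0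
    have hP' : P ∈ functionals k r (e - 1) := sup_le
      (act_le_functionals (by omega : 1 + (e - 1) = e) hF)
      (act_le_functionals (by omega : 1 + (e - 1) = e) hG) hP
    refine eq_of_mem_functionals hP' (Submodule.zero_mem _) fun q hq => ?_
    rw [← evalOne_contract, h0 q hq, LinearMap.zero_apply]
  ker := fun v hv h1 h2 => h.no_linear_form v (mem_pairAnn.2 ⟨h1, h2⟩) hv
  finrank_eq := by
    rw [finrank_forms, Nat.multichoose_one_right,
      ← hVector_pairAnn (by omega : 1 + (e - 1) = e) hF hG, hr]

/-- The structure of level `h`-vectors `(1, r, …, r, 2)` with `r ≤ 5`. -/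
theorem IsLevel.exists_gorenstein [Infinite k] {I : Ideal (MvPolynomial (Fin r) k)} {e : ℕ}
    (he : 4 ≤ e) (hr5 : r ≤ 5) (h : IsLevel I e 2) (hr : hVector I (e - 1) = r) :
    ∃ F ∈ functionals k r e, ∃ δ : ℕ, ∀ i, 1 ≤ i → i ≤ e - 1 →
      hVector I (e - i) = Module.finrank k (act (forms k r i) F) + δ ∧
      Module.finrank k (act (forms k r i) F) + δ ≤ (r - 1).multichoose i + 1 := by
  obtain ⟨F, hF, G, hG, rfl⟩ := h.exists_functionals
  have hN := h.nondegenerate (by omega) hF hG hr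
  have hfin : Module.finrank k (forms k r 1) = r := by
    rw [finrank_forms, Nat.multichoose_one_right]
  obtain ⟨c, hc⟩ := hN.dichotomy (by omega) (by rw [hfin]; exact hr5)
  refine ⟨F + c • G, Submodule.add_mem _ hF (Submodule.smul_mem _ _ hG), ?_⟩
  set F' := F + c • G with hF'
  have hF'e : F' ∈ functionals k r e := Submodule.add_mem _ hF (Submodule.smul_mem _ _ hG)
  have hsup : ∀ i, act (forms k r i) F' ⊔ act (forms k r i) G =
      act (forms k r i) F ⊔ act (forms k r i) G := fun i => act_add_smul_sup _ F G c
  have h2 : Module.finrank k (act (forms k r 0) F' ⊔ act (forms k r 0) G : Submodule k _) = 2 := by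
    rw [hsup, ← hVector_pairAnn (zero_add e) hF hG, h.hVector_top]
  rcases hc with ⟨hinj, hle⟩ | ⟨A, x, z, hx, hx0, hA, hxF, hAG, hz⟩
  -- Faithful case: V^i G is absorbed by V^i F, so δ = 0.
  · refine ⟨0, fun i hi hie => ?_⟩
    obtain ⟨j, rfl⟩ := Nat.exists_eq_add_of_le' hi
    obtain ⟨v, hv, w, hw, hvw, hvG⟩ := exists_linearIndependent_smul_eq hinj hle
      (exists_contract_ne (by omega) hF'e hG h2)
    have h3 := finrank_act_pow_le_of_linearIndependent hle hv hw hvw hvG j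
    have h4 := act_pow_le_of_act_le hle j
    rw [forms_one_pow] at h3 h4
    rw [hfin] at h3
    rw [hVector_pairAnn (by omega : j + 1 + (e - (j + 1)) = e) hF hG, ← hsup,
      sup_eq_left.2 h4]
    exact ⟨rfl, h3⟩
  -- Extension case: each z^i G adds one dimension, so δ = 1, while F loses a variable to x.
  · refine ⟨1, fun i hi hie => ?_⟩
    obtain ⟨j, rfl⟩ := Nat.exists_eq_add_of_le' hi
    have h3 := finrank_act_pow_sup_of_extension hA hxF hAG (hz (j + 1) hie)
    have h4 := finrank_act_pow_le_of_smul_eq_zero hx hx0 hxF j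
    rw [forms_one_pow] at h3 h4
    rw [hfin] at h4
    rw [hVector_pairAnn (by omega : j + 1 + (e - (j + 1)) = e) hF hG, ← hsup]
    exact ⟨h3, Nat.add_le_add_right h4 1⟩

/-- The upper bound for the entries of a level `h`-vector `(1, r, …, r, 2)` with `r ≤ 5`. -/
theorem IsLevel.hVector_le_of_eq [Infinite k] {I : Ideal (MvPolynomial (Fin r) k)} {e : ℕ}
    (he : 4 ≤ e) (hr5 : r ≤ 5) (h : IsLevel I e 2) (hr : hVector I (e - 1) = r) {i : ℕ}
    (hi : 1 ≤ i) (hie : i ≤ e - 1) :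
    hVector I (e - i) = hVector I i ∧
      hVector I (e - i) ≤ min ((r - 1).multichoose i + 1) ((r - 1).multichoose (e - i) + 1) := by
  obtain ⟨F, hF, δ, hδ⟩ := h.exists_gorenstein he hr5 hr
  have h1 := hδ i hi hie
  have h2 := hδ (e - i) (by omega) (by omega)
  rw [show e - (e - i) = i by omega] at h2
  -- Since δ does not depend on i, the symmetry for the single functional F passes to the h-vector,
  -- and the bound at e - i becomes the second term of the minimum.
  rw [finrank_act_symm (by omega : i + (e - i) = e) hF] at h1
  rw [← h1.1] at h2
  have h3 := hδ i hi hie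
  refine ⟨h2.1.symm, le_min ?_ ?_⟩
  · rw [h3.1]
    exact h3.2
  · exact h2.2

end LevelAlg
end

/-! ### Generic ranks and evaluation at points. -/

noncomputable section

namespace LevelAlg

/-- On a complement S of ker f choose a left inverse h of f. Then h(f + cg) = 1 + cB on S, which is
injective unless -1/c is one of the finitely many eigenvalues of B. -/
theorem eventually_finrank_range_le {k M N : Type*} [Field k] [AddCommGroup M] [Module k M]
    [FiniteDimensional k M] [AddCommGroup N] [Module k N] (f g : M →ₗ[k] N) :
    ∀ᶠ c : k in Filter.cofinite,
      Module.finrank k (LinearMap.range f) ≤ Module.finrank k (LinearMap.range (f + c • g)) := by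
  obtain ⟨S, hS⟩ := Submodule.exists_isCompl (LinearMap.ker f)
  have hSf : Module.finrank k S = Module.finrank k (LinearMap.range f) := by
    have h1 := Submodule.finrank_add_eq_of_isCompl hS
    have h2 := LinearMap.finrank_range_add_finrank_ker f
    omega
  have hinj : LinearMap.ker (f.domRestrict S) = ⊥ := by
    rw [LinearMap.ker_eq_bot']
    intro v hv
    have hv' : (v : M) ∈ LinearMap.ker f ⊓ S := ⟨hv, v.2⟩
    rw [hS.inf_eq_bot] at hv'
    exact Subtype.ext ((Submodule.mem_bot k).1 hv')
  obtain ⟨h, hh⟩ := LinearMap.exists_leftInverse_of_injective (f.domRestrict S) hinj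
  let B : Module.End k S := h ∘ₗ g.domRestrict S
  have hfin := (Module.End.finite_hasEigenvalue B)
  rw [Filter.eventually_cofinite]
  refine (hfin.image fun a => -a⁻¹).subset fun c hc => ?_
  by_contra hcon
  refine hc ?_
  have hker : LinearMap.ker ((f + c • g).domRestrict S) = ⊥ := by
    rw [LinearMap.ker_eq_bot']
    intro v hv
    by_contra hv0
    have h1 : h ((f + c • g).domRestrict S v) = v + c • B v := by
      have h2 : h (f.domRestrict S v) = v := LinearMap.congr_fun hh v
      have h3 : (f + c • g).domRestrict S v = f.domRestrict S v + c • g.domRestrict S v := rfl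
      rw [h3, map_add, map_smul, h2]
      rfl
    rw [hv, map_zero] at h1
    have hc0 : c ≠ 0 := by
      rintro rfl
      rw [zero_smul, add_zero] at h1
      exact hv0 h1.symm
    refine hcon ⟨-c⁻¹, ?_, by simp⟩
    refine Module.End.hasEigenvalue_of_hasEigenvector (x := v)
      (Module.End.hasEigenvector_iff.2 ⟨Module.End.mem_eigenspace_iff.2 ?_, hv0⟩)
    have h2 : c • B v = -v := (neg_eq_of_add_eq_zero_right h1.symm).symm
    rw [← inv_smul_smul₀ hc0 (B v), h2, smul_neg, neg_smul]
  rw [← hSf, ← LinearMap.finrank_range_of_inj (LinearMap.ker_eq_bot.1 hker),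
    LinearMap.range_domRestrict]
  exact Submodule.finrank_mono (LinearMap.map_le_range)

variable {k : Type*} [Field k] {r : ℕ}

/-- The bilinear pairing `(a, b) ↦ F (a * b)` between two spaces of polynomials. -/
def pairing (F : Functional k r) (A B : Submodule k (MvPolynomial (Fin r) k)) :
    A →ₗ[k] Module.Dual k B :=
  (B.dualRestrict ∘ₗ (LinearMap.toSpanSingleton _ (Functional k r) F).restrictScalars k).domRestrict A

@[simp] theorem pairing_apply (F : Functional k r) {A B : Submodule k (MvPolynomial (Fin r) k)}
    (a : A) (b : B) : pairing F A B a b = F (a * b) := rfl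

theorem pairing_add_smul (F E : Functional k r) (A B : Submodule k (MvPolynomial (Fin r) k))
    (c : k) : pairing (F + c • E) A B = pairing F A B + c • pairing E A B :=
  LinearMap.ext fun _ => LinearMap.ext fun _ => rfl

/-- The rank of the pairing `(a, b) ↦ F (a * b)`. -/
def pairingRank (F : Functional k r) (A B : Submodule k (MvPolynomial (Fin r) k)) : ℕ :=
  Module.finrank k (LinearMap.range (pairing F A B))

/-- Evaluation at the point `p` of the component of degree `e`. -/
def point (e : ℕ) (p : Fin r → k) : Functional k r :=
  (aeval p : MvPolynomial (Fin r) k →ₐ[k] k).toLinearMap ∘ₗ homogeneousComponent e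

theorem point_apply {e : ℕ} {p : Fin r → k} {q : MvPolynomial (Fin r) k} (hq : q ∈ forms k r e) :
    point e p q = eval p q := by
  change aeval p (homogeneousComponent e q) = _
  rw [homogeneousComponent_eq_self hq]
  rfl

theorem point_mem (e : ℕ) (p : Fin r → k) : point e p ∈ functionals k r e := fun d hd q hq => by
  change aeval p (homogeneousComponent e q) = 0
  rw [homogeneousComponent_of_mem hq, if_neg (Ne.symm hd), map_zero]

theorem contract_point {i j e : ℕ} (hij : i + j = e) (p : Fin r → k)
    {a : MvPolynomial (Fin r) k} (ha : a ∈ forms k r i) :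
    a • point e p = eval p a • point j p := by
  subst hij
  refine eq_of_mem_functionals (contract_mem_functionals rfl ha (point_mem _ p))
    (Submodule.smul_mem _ _ (point_mem j p)) fun q hq => ?_
  rw [contract_apply, point_apply (mul_mem_forms ha hq), map_mul, LinearMap.smul_apply,
    point_apply hq, smul_eq_mul]

theorem act_point_le {i j e : ℕ} (hij : i + j = e) (p : Fin r → k) :
    act (forms k r i) (point e p) ≤ Submodule.span k {point j p} := fun y hy => by
  obtain ⟨a, ha, rfl⟩ := mem_act.1 hy
  rw [contract_point hij p ha]
  exact Submodule.smul_mem _ _ (Submodule.mem_span_singleton_self _)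

theorem act_add_smul_le (S : Submodule k (MvPolynomial (Fin r) k)) (F E : Functional k r) (c : k) :
    act S (F + c • E) ≤ act S F ⊔ act S E := fun y hy => by
  obtain ⟨a, ha, rfl⟩ := mem_act.1 hy
  rw [smul_add, smul_comm a c]
  exact Submodule.add_mem_sup (smul_mem_act ha F) (Submodule.smul_mem _ _ (smul_mem_act ha E))

theorem finrank_sup_span_le {N : Submodule k (Functional k r)} [FiniteDimensional k N]
    {N' : Submodule k (Functional k r)} {φ : Functional k r}
    (h : N' ≤ N ⊔ Submodule.span k {φ}) : Module.finrank k N' ≤ Module.finrank k N + 1 :=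
  (Submodule.finrank_mono h).trans ((Submodule.finrank_add_le_finrank_add_finrank _ _).trans
    (Nat.add_le_add_left (finrank_span_singleton_le _) _))

/-- A pairing that is not of maximal rank can be improved by adding a multiple of a point. -/
theorem exists_point_pairingRank_lt [Infinite k] {i j e : ℕ} (hij : i + j = e)
    {A B : Submodule k (MvPolynomial (Fin r) k)} (hA : A ≤ forms k r i) (hB : B ≤ forms k r j)
    {F : Functional k r} (hFA : pairingRank F A B < Module.finrank k A)
    (hFB : pairingRank F A B < Module.finrank k B) :
    ∃ p : Fin r → k, ∀ c : k, c ≠ 0 →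
      pairingRank F A B < pairingRank (F + c • point e p) A B := by
  subst hij
  have hAfin : FiniteDimensional k A := Submodule.finiteDimensional_of_le hA
  have hBfin : FiniteDimensional k B := Submodule.finiteDimensional_of_le hB
  obtain ⟨f, hf, hf0⟩ : ∃ f : A, pairing F A B f = 0 ∧ f ≠ 0 := by
    have h1 := LinearMap.finrank_range_add_finrank_ker (pairing F A B)
    have h2 : LinearMap.ker (pairing F A B) ≠ ⊥ := fun h => by
      rw [h, finrank_bot] at h1
      exact hFA.ne h1
    obtain ⟨f, hf, hf0⟩ := Submodule.exists_mem_ne_zero_of_ne_bot h2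
    exact ⟨f, hf, hf0⟩
  obtain ⟨g, hg, hg0⟩ : ∃ g : B, (∀ a, pairing F A B a g = 0) ∧ g ≠ 0 := by
    have h1 := Subspace.finrank_add_finrank_dualCoannihilator_eq
      (LinearMap.range (pairing F A B))
    have h2 : (LinearMap.range (pairing F A B)).dualCoannihilator ≠ ⊥ := fun h => by
      rw [h, finrank_bot] at h1
      exact hFB.ne h1
    obtain ⟨g, hg, hg0⟩ := Submodule.exists_mem_ne_zero_of_ne_bot h2
    rw [Submodule.mem_dualCoannihilator] at hg
    exact ⟨g, fun a => hg _ (LinearMap.mem_range_self _ a), hg0⟩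
  -- Left and right kernel vectors f, g have a nonzero product, and over an infinite field a nonzero
  -- polynomial is nonzero at some point.
  obtain ⟨p, hp⟩ : ∃ p, eval p ((f : MvPolynomial (Fin r) k) * (g : MvPolynomial (Fin r) k)) ≠ 0 := by
    by_contra! hcon
    have : (f : MvPolynomial (Fin r) k) * (g : MvPolynomial (Fin r) k) = 0 := MvPolynomial.funext fun p => by
      rw [hcon p, map_zero]
    rcases mul_eq_zero.1 this with h | h
    · exact hf0 (Subtype.ext h)
    · exact hg0 (Subtype.ext h)
  rw [map_mul] at hp
  refine ⟨p, fun c hc => ?_⟩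
  have happ : ∀ (a : A) (b : B), pairing (F + c • point (i + j) p) A B a b =
      pairing F A B a b + c * (eval p (a : MvPolynomial (Fin r) k) * eval p (b : MvPolynomial (Fin r) k)) := by
    intro a b
    rw [pairing_apply, LinearMap.add_apply, LinearMap.smul_apply,
      point_apply (mul_mem_forms (hA a.2) (hB b.2)), map_mul (eval p), smul_eq_mul, pairing_apply]
  -- Pairing with g shows that a new kernel element vanishes at p, hence lies in the old kernel; f
  -- belongs only to the old one.
  have hlt : LinearMap.ker (pairing (F + c • point (i + j) p) A B) <
      LinearMap.ker (pairing F A B) := by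
    refine lt_of_le_of_ne (fun a ha => ?_) fun h => ?_
    · have h0 : ∀ b, pairing (F + c • point (i + j) p) A B a b = 0 := fun b => by
        rw [LinearMap.mem_ker.1 ha, LinearMap.zero_apply]
      have h1 := h0 g
      rw [happ, hg, zero_add] at h1
      have h2 : eval p (a : MvPolynomial (Fin r) k) = 0 :=
        (mul_eq_zero.1 ((mul_eq_zero.1 h1).resolve_left hc)).resolve_right (right_ne_zero_of_mul hp)
      refine LinearMap.ext fun b => ?_
      have h3 := h0 b
      rwa [happ, h2, zero_mul, mul_zero, add_zero] at h3
    · have hfk : f ∈ LinearMap.ker (pairing (F + c • point (i + j) p) A B) := by rw [h]; exact hf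
      have h1 := happ f g
      rw [LinearMap.mem_ker.1 hfk, hf, LinearMap.zero_apply, zero_add] at h1
      exact mul_ne_zero hc hp h1.symm
  have h1 := Submodule.finrank_lt_finrank_of_lt hlt
  have h2 := LinearMap.finrank_range_add_finrank_ker (pairing F A B)
  have h3 := LinearMap.finrank_range_add_finrank_ker (pairing (F + c • point (i + j) p) A B)
  unfold pairingRank
  omega

/-- Double annihilator: adjoining φ does not change the vanishing forms, hence not the dimension. -/
theorem mem_of_forall_vanishing {j : ℕ} {N : Submodule k (Functional k r)}
    (hN : N ≤ functionals k r j) {φ : Functional k r} (hφ : φ ∈ functionals k r j)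
    (h : ∀ q ∈ vanishing j N, φ q = 0) : φ ∈ N := by
  have hle : N ⊔ Submodule.span k {φ} ≤ functionals k r j := sup_le hN (by simpa using hφ)
  have h1 := finrank_add_finrank_vanishing hN
  have h2 := finrank_add_finrank_vanishing hle
  have h3 : vanishing j (N ⊔ Submodule.span k {φ}) = vanishing j N := by
    refine le_antisymm (fun q hq => ⟨hq.1, fun ψ hψ => hq.2 ψ (Submodule.mem_sup_left hψ)⟩)
      fun q hq => ⟨hq.1, fun ψ hψ => ?_⟩
    obtain ⟨ψ₁, hψ₁, ψ₂, hψ₂, rfl⟩ := Submodule.mem_sup.1 hψ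
    obtain ⟨a, rfl⟩ := Submodule.mem_span_singleton.1 hψ₂
    rw [LinearMap.add_apply, LinearMap.smul_apply, hq.2 _ hψ₁, h q hq, smul_zero, add_zero]
  rw [h3] at h2
  have : FiniteDimensional k (N ⊔ Submodule.span k {φ} : Submodule k (Functional k r)) :=
    Submodule.finiteDimensional_of_le hle
  rw [Submodule.eq_of_le_of_finrank_le (le_sup_left : N ≤ N ⊔ Submodule.span k {φ}) (by omega)]
  exact Submodule.mem_sup_right (Submodule.mem_span_singleton_self φ)

/-- The part of `forms k r i • F` outside `N` is measured by a pairing. -/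
theorem finrank_sup_act {i j e : ℕ} (hij : i + j = e) {N : Submodule k (Functional k r)}
    (hN : N ≤ functionals k r j) {F : Functional k r} (hF : F ∈ functionals k r e) :
    Module.finrank k (N ⊔ act (forms k r i) F : Submodule k _) =
      Module.finrank k N + pairingRank F (forms k r i) (vanishing j N) := by
  have hle : N ⊔ act (forms k r i) F ≤ functionals k r j :=
    sup_le hN (act_le_functionals hij hF)
  have : FiniteDimensional k (N ⊔ act (forms k r i) F : Submodule k (Functional k r)) :=
    Submodule.finiteDimensional_of_le hle
  have h1 := finrank_map_add_finrank_inf_ker (vanishing j N).dualRestrict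
    (N ⊔ act (forms k r i) F)
  -- Restricting functionals to the forms on which N vanishes kills exactly N, so the rank of this
  -- restriction counts what F adds.
  have h2 : (N ⊔ act (forms k r i) F) ⊓ LinearMap.ker (vanishing j N).dualRestrict = N := by
    refine le_antisymm ?_ (le_inf le_sup_left fun φ hφ => ?_)
    · rintro φ ⟨hφ1, hφ2⟩
      exact mem_of_forall_vanishing hN (hle hφ1) fun q hq => LinearMap.congr_fun hφ2 ⟨q, hq⟩
    · exact LinearMap.ext fun q => q.2.2 φ hφ
  have h3 : Submodule.map (vanishing j N).dualRestrict N = ⊥ := by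
    rw [eq_bot_iff, Submodule.map_le_iff_le_comap]
    exact fun φ hφ => LinearMap.ext fun q => q.2.2 φ hφ
  rw [h2, Submodule.map_sup, h3, bot_sup_eq] at h1
  have h4 : Submodule.map (vanishing j N).dualRestrict (act (forms k r i) F) =
      LinearMap.range (pairing F (forms k r i) (vanishing j N)) := by
    rw [pairing, LinearMap.range_domRestrict, Submodule.map_comp, act]
  rw [← h1, h4, add_comm, pairingRank]

theorem vanishing_bot (j : ℕ) : vanishing j (⊥ : Submodule k (Functional k r)) = forms k r j :=
  le_antisymm (vanishing_le _ _) fun q hq => ⟨hq, fun φ hφ => by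
    rw [(Submodule.mem_bot k).1 hφ, LinearMap.zero_apply]⟩

theorem finrank_act_eq_pairingRank {i j e : ℕ} (hij : i + j = e) {F : Functional k r}
    (hF : F ∈ functionals k r e) :
    Module.finrank k (act (forms k r i) F) = pairingRank F (forms k r i) (forms k r j) := by
  have h := finrank_sup_act hij bot_le hF
  rwa [bot_sup_eq, finrank_bot, zero_add, vanishing_bot] at h

theorem eventually_pairingRank_le {A B : Submodule k (MvPolynomial (Fin r) k)}
    [FiniteDimensional k A] (F E : Functional k r) :
    ∀ᶠ c : k in Filter.cofinite, pairingRank F A B ≤ pairingRank (F + c • E) A B := by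
  filter_upwards [eventually_finrank_range_le (pairing F A B) (pairing E A B)] with c hc
  rwa [pairingRank, pairingRank, pairing_add_smul]

theorem eventually_finrank_act_sup_le (S : Submodule k (MvPolynomial (Fin r) k))
    [FiniteDimensional k S] (F E G E' : Functional k r) :
    ∀ᶠ c : k in Filter.cofinite, Module.finrank k (act S F ⊔ act S G : Submodule k _) ≤
      Module.finrank k (act S (F + c • E) ⊔ act S (G + c • E') : Submodule k _) := by
  have h : ∀ c : k, pairMap S (F + c • E) (G + c • E') = pairMap S F G + c • pairMap S E E' :=
    fun c => LinearMap.ext fun z => by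
      rw [LinearMap.add_apply, LinearMap.smul_apply, pairMap_apply, pairMap_apply, pairMap_apply,
        smul_add, smul_add, smul_comm _ c, smul_comm _ c, smul_add]
      abel
  filter_upwards [eventually_finrank_range_le (pairMap S F G) (pairMap S E E')] with c hc
  rwa [← range_pairMap, ← range_pairMap, h]

theorem eventually_ne_zero : ∀ᶠ c : k in Filter.cofinite, c ≠ 0 := by
  simp [Filter.eventually_cofinite]

end LevelAlg
end

/-! ### Functionals with prescribed or maximal contraction dimensions. -/

noncomputable section

namespace LevelAlg

variable {k : Type*} [Field k] {r : ℕ}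

/-- A sum of `n` points with a pairing of rank at least `n`. -/
theorem exists_sum_points [Infinite k] {i j e : ℕ} (hij : i + j = e)
    {A B : Submodule k (MvPolynomial (Fin r) k)} (hA : A ≤ forms k r i) (hB : B ≤ forms k r j)
    (n : ℕ) (hnA : n ≤ Module.finrank k A) (hnB : n ≤ Module.finrank k B) :
    ∃ F ∈ functionals k r e, n ≤ pairingRank F A B ∧
      ∀ i' j', i' + j' = e → Module.finrank k (act (forms k r i') F) ≤ n := by
  induction n with
  | zero => exact ⟨0, Submodule.zero_mem _, Nat.zero_le _, fun i' j' _ => by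
      rw [act_zero, finrank_bot]⟩
  | succ n ih =>
    obtain ⟨F, hF, hFn, hFact⟩ := ih (by omega) (by omega)
    by_cases h : n + 1 ≤ pairingRank F A B
    · exact ⟨F, hF, h, fun i' j' hij' => (hFact i' j' hij').trans n.le_succ⟩
    obtain ⟨p, hp⟩ := exists_point_pairingRank_lt hij hA hB (F := F) (by omega) (by omega)
    refine ⟨F + (1 : k) • point e p, Submodule.add_mem _ hF
      (Submodule.smul_mem _ _ (point_mem e p)), ?_, fun i' j' hij' => ?_⟩
    · have := hp 1 one_ne_zero
      omega
    · refine (finrank_sup_span_le (N := act (forms k r i') F) (φ := point j' p) ?_).trans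
        (Nat.add_le_add_right (hFact i' j' hij') 1)
      exact (act_add_smul_le _ _ _ _).trans (sup_le_sup_left (act_point_le hij' p) _)

/-- Every value up to the maximal one is attained by adding points to `F`. -/
theorem exists_finrank_act_sup_eq [Infinite k] {i j e : ℕ} (hij : i + j = e)
    {F₀ G : Functional k r} (hF₀ : F₀ ∈ functionals k r e) (hG : G ∈ functionals k r e) {v : ℕ}
    (hv : Module.finrank k (act (forms k r i) F₀ ⊔ act (forms k r i) G : Submodule k _) ≤ v)
    (hvi : v ≤ r.multichoose i + Module.finrank k (act (forms k r i) G))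
    (hvj : v ≤ r.multichoose j) :
    ∃ F ∈ functionals k r e,
      Module.finrank k (act (forms k r i) F ⊔ act (forms k r i) G : Submodule k _) = v ∧
      Module.finrank k (act (forms k r 1) F₀ ⊔ act (forms k r 1) G : Submodule k _) ≤
        Module.finrank k (act (forms k r 1) F ⊔ act (forms k r 1) G : Submodule k _) := by
  obtain ⟨n, hn⟩ := Nat.exists_eq_add_of_le hv
  induction n generalizing F₀ with
  | zero => exact ⟨F₀, hF₀, hn.symm, le_rfl⟩
  | succ n ih =>
    have hGj := act_le_functionals hij hG
    have hrank : ∀ {F : Functional k r}, F ∈ functionals k r e →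
        Module.finrank k (act (forms k r i) F ⊔ act (forms k r i) G : Submodule k _) =
        Module.finrank k (act (forms k r i) G) +
          pairingRank F (forms k r i) (vanishing j (act (forms k r i) G)) := fun hF => by
      rw [sup_comm, finrank_sup_act hij hGj hF]
    have h1 := hrank hF₀
    have h2 := finrank_add_finrank_vanishing hGj
    have h3 := finrank_forms k r i
    have h4 := finrank_forms k r j
    obtain ⟨p, hp⟩ := exists_point_pairingRank_lt hij (A := forms k r i) le_rfl
      (vanishing_le j (act (forms k r i) G)) (F := F₀) (by omega) (by omega)
    -- A nonzero c raises the value in degree i, and a generic c does not lower the dimension of the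
    -- first contractions.
    obtain ⟨c, hc0, hc⟩ := (eventually_ne_zero.and
      (eventually_finrank_act_sup_le (forms k r 1) F₀ (point e p) G 0)).exists
    rw [smul_zero, add_zero] at hc
    have hF : F₀ + c • point e p ∈ functionals k r e :=
      Submodule.add_mem _ hF₀ (Submodule.smul_mem _ _ (point_mem e p))
    have h5 := hp c hc0
    -- A point adds at most one dimension, so the value rises by exactly one and no v is skipped.
    have h6 : Module.finrank k (act (forms k r i) (F₀ + c • point e p) ⊔ act (forms k r i) G :
        Submodule k _) ≤
        Module.finrank k (act (forms k r i) F₀ ⊔ act (forms k r i) G : Submodule k _) + 1 := by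
      refine finrank_sup_span_le (φ := point j p) (sup_le ?_ (le_sup_right.trans le_sup_left))
      refine (act_add_smul_le _ _ _ _).trans (sup_le_sup le_sup_left (act_point_le hij p))
    have h7 := hrank hF
    obtain ⟨F, hF', hFv, hF1⟩ := ih hF (by omega) (by omega)
    exact ⟨F, hF', hFv, hc.trans hF1⟩

/-- A single functional has pairings of maximal rank with prescribed spaces in all degrees. -/
theorem exists_forall_pairingRank [Infinite k] {e : ℕ}
    (B : ℕ → Submodule k (MvPolynomial (Fin r) k)) (hB : ∀ i, B i ≤ forms k r (e - i))
    (s : Finset ℕ) (hs : ∀ i ∈ s, i ≤ e) :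
    ∃ F ∈ functionals k r e, ∀ i ∈ s,
      min (Module.finrank k (forms k r i)) (Module.finrank k (B i)) ≤
        pairingRank F (forms k r i) (B i) := by
  classical
  induction s using Finset.induction_on with
  | empty => exact ⟨0, Submodule.zero_mem _, by simp⟩
  | insert a s ha ih =>
    obtain ⟨F, hF, hFs⟩ := ih fun i hi => hs i (Finset.mem_insert_of_mem hi)
    have hae := hs a (Finset.mem_insert_self a s)
    obtain ⟨n, hn⟩ : ∃ n, min (Module.finrank k (forms k r a)) (Module.finrank k (B a)) ≤
        pairingRank F (forms k r a) (B a) + n := ⟨_, Nat.le_add_left _ _⟩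
    induction n generalizing F with
    | zero =>
      refine ⟨F, hF, fun i hi => ?_⟩
      rcases Finset.mem_insert.1 hi with rfl | hi
      · exact hn
      · exact hFs i hi
    | succ n ihn =>
      by_cases hlt : min (Module.finrank k (forms k r a)) (Module.finrank k (B a)) ≤
          pairingRank F (forms k r a) (B a)
      · exact ihn F hF hFs (by omega)
      rw [not_le, lt_min_iff] at hlt
      obtain ⟨p, hp⟩ := exists_point_pairingRank_lt (by omega : a + (e - a) = e)
        (A := forms k r a) le_rfl (hB a) hlt.1 hlt.2
      -- Only finitely many c could spoil the degrees already treated.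
      obtain ⟨c, hc0, hc⟩ := (eventually_ne_zero.and ((Filter.eventually_all_finset s).2
        fun i _ => eventually_pairingRank_le (A := forms k r i) (B := B i) F (point e p))).exists
      have h5 := hp c hc0
      exact ihn (F + c • point e p)
        (Submodule.add_mem _ hF (Submodule.smul_mem _ _ (point_mem e p)))
        (fun i hi => (hFs i hi).trans (hc i hi)) (by omega)

/-- Functionals whose contractions together with given spaces have maximal dimension. -/
theorem exists_forall_finrank_sup_act [Infinite k] {e : ℕ}
    (N : ℕ → Submodule k (Functional k r)) (hN : ∀ i ≤ e, N i ≤ functionals k r (e - i)) :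
    ∃ F ∈ functionals k r e, ∀ i ≤ e,
      min (Module.finrank k (N i) + r.multichoose i) (r.multichoose (e - i)) ≤
        Module.finrank k (N i ⊔ act (forms k r i) F : Submodule k _) := by
  obtain ⟨F, hF, h⟩ := exists_forall_pairingRank (e := e) (fun i => vanishing (e - i) (N i))
    (fun i => vanishing_le _ _) (Finset.range (e + 1))
    (fun i hi => Nat.lt_succ_iff.1 (Finset.mem_range.1 hi))
  refine ⟨F, hF, fun i hi => ?_⟩
  have h1 := h i (Finset.mem_range.2 (Nat.lt_succ_of_le hi))
  have h2 := finrank_add_finrank_vanishing (hN i hi)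
  rw [finrank_forms] at h1 h2
  rw [finrank_sup_act (by omega : i + (e - i) = e) (hN i hi) hF]
  omega

/-- The projection onto the polynomials in the first `b` variables. -/
def project (k : Type*) [Field k] (r b : ℕ) : MvPolynomial (Fin r) k →ₐ[k] MvPolynomial (Fin b) k :=
  aeval fun j => if h : (j : ℕ) < b then X ⟨j, h⟩ else 0

theorem project_mem_forms {b d : ℕ} {p : MvPolynomial (Fin r) k} (hp : p ∈ forms k r d) :
    project k r b p ∈ forms k b d := by
  have h : (forms k r 1).map (project k r b).toLinearMap ≤ forms k b 1 := by
    rw [forms, homogeneousSubmodule_one_eq_span_X, Submodule.map_span, Submodule.span_le]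
    rintro _ ⟨_, ⟨j, rfl⟩, rfl⟩
    have : (project k r b).toLinearMap (X j) = if h : (j : ℕ) < b then X ⟨j, h⟩ else 0 := by
      simp [project]
    rw [this]
    split_ifs with hj
    · exact X_mem_forms _
    · exact Submodule.zero_mem _
  have h2 : (forms k r 1 ^ d).map (project k r b).toLinearMap ≤ forms k b 1 ^ d := by
    rw [Submodule.map_pow]
    exact pow_le_pow_left' h d
  rw [forms_one_pow, forms_one_pow] at h2
  exact h2 ⟨p, hp, rfl⟩

theorem exists_project_eq {b d : ℕ} (hb : b ≤ r) {q : MvPolynomial (Fin b) k}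
    (hq : q ∈ forms k b d) : ∃ p ∈ forms k r d, project k r b p = q := by
  refine ⟨rename (Fin.castLE hb) q, IsHomogeneous.rename_isHomogeneous hq, ?_⟩
  have : (project k r b).comp (rename (Fin.castLE hb)) = AlgHom.id k _ := by
    refine MvPolynomial.algHom_ext fun j => ?_
    simp [project]
  exact AlgHom.congr_fun this q

/-- Functionals in `b` variables, viewed as functionals in `r` variables. -/
def pull (k : Type*) [Field k] (r b : ℕ) : Functional k b →ₗ[k] Functional k r :=
  (project k r b).toLinearMap.dualMap

theorem pull_apply {b : ℕ} (φ : Functional k b) (p : MvPolynomial (Fin r) k) :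
    pull k r b φ p = φ (project k r b p) := rfl

theorem pull_mem {b e : ℕ} {φ : Functional k b} (hφ : φ ∈ functionals k b e) :
    pull k r b φ ∈ functionals k r e := fun d hd _ hq => hφ d hd _ (project_mem_forms hq)

theorem contract_pull {b : ℕ} (p : MvPolynomial (Fin r) k) (φ : Functional k b) :
    p • pull k r b φ = pull k r b (project k r b p • φ) := LinearMap.ext fun q => by
  rw [contract_apply, pull_apply, pull_apply, map_mul, contract_apply]

theorem pull_injective {b : ℕ} (hb : b ≤ r) : Function.Injective (pull k r b) := fun φ ψ h =>
  functional_ext fun _ _ hq => by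
    obtain ⟨p, -, rfl⟩ := exists_project_eq hb hq
    rw [← pull_apply, h, pull_apply]

theorem act_pull {b : ℕ} (hb : b ≤ r) (i : ℕ) (φ : Functional k b) :
    act (forms k r i) (pull k r b φ) = (act (forms k b i) φ).map (pull k r b) := by
  ext y
  rw [mem_act, Submodule.mem_map]
  constructor
  · rintro ⟨p, hp, rfl⟩
    exact ⟨_, smul_mem_act (project_mem_forms hp) φ, (contract_pull p φ).symm⟩
  · rintro ⟨_, hψ, rfl⟩
    obtain ⟨q, hq, rfl⟩ := mem_act.1 hψ
    obtain ⟨p, hp, rfl⟩ := exists_project_eq hb hq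
    exact ⟨p, hp, contract_pull p φ⟩

theorem finrank_act_pull {b : ℕ} (hb : b ≤ r) (i : ℕ) (φ : Functional k b) :
    Module.finrank k (act (forms k r i) (pull k r b φ)) =
      Module.finrank k (act (forms k b i) φ) := by
  rw [act_pull hb]
  exact (Submodule.equivMapOfInjective _ (pull_injective hb) _).finrank_eq.symm

/-- Points in `b` variables are added to `G` until either the value `v` is attained or the
contractions of `G` have maximal dimension. -/
theorem exists_pull_finrank [Infinite k] {b i j e : ℕ} (hb : b ≤ r) (hij : i + j = e)
    (F : Functional k r) {G₀ : Functional k b} (hG₀ : G₀ ∈ functionals k b e) {v : ℕ}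
    (hv : Module.finrank k (act (forms k r i) F ⊔ act (forms k r i) (pull k r b G₀) :
      Submodule k _) ≤ v) :
    ∃ G ∈ functionals k b e,
      Module.finrank k (act (forms k r 1) F ⊔ act (forms k r 1) (pull k r b G₀) :
        Submodule k _) ≤
        Module.finrank k (act (forms k r 1) F ⊔ act (forms k r 1) (pull k r b G) :
        Submodule k _) ∧
      Module.finrank k (act (forms k r i) F ⊔ act (forms k r i) (pull k r b G) :
        Submodule k _) ≤ v ∧
      (Module.finrank k (act (forms k r i) F ⊔ act (forms k r i) (pull k r b G) :
        Submodule k _) = v ∨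
        min (b.multichoose i) (b.multichoose j) ≤ Module.finrank k (act (forms k b i) G)) := by
  obtain ⟨n, hn⟩ : ∃ n, min (b.multichoose i) (b.multichoose j) ≤
      Module.finrank k (act (forms k b i) G₀) + n := ⟨_, Nat.le_add_left _ _⟩
  induction n generalizing G₀ with
  | zero => exact ⟨G₀, hG₀, le_rfl, hv, Or.inr hn⟩
  | succ n ih =>
    by_cases hlt : min (b.multichoose i) (b.multichoose j) ≤
      Module.finrank k (act (forms k b i) G₀)
    · exact ⟨G₀, hG₀, le_rfl, hv, Or.inr hlt⟩
    rcases hv.eq_or_lt with heq | hvlt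
    · exact ⟨G₀, hG₀, le_rfl, hv, Or.inl heq⟩
    have h1 := finrank_act_eq_pairingRank hij hG₀
    have h3 := finrank_forms k b i
    have h4 := finrank_forms k b j
    obtain ⟨p, hp⟩ := exists_point_pairingRank_lt hij (A := forms k b i) (B := forms k b j)
      le_rfl le_rfl (F := G₀) (by omega) (by omega)
    obtain ⟨c, hc0, hc⟩ := (eventually_ne_zero.and (eventually_finrank_act_sup_le (forms k r 1) F 0
      (pull k r b G₀) (pull k r b (point e p)))).exists
    rw [smul_zero, add_zero, ← map_smul, ← map_add] at hc
    have hG : G₀ + c • point e p ∈ functionals k b e :=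
      Submodule.add_mem _ hG₀ (Submodule.smul_mem _ _ (point_mem e p))
    have h5 := hp c hc0
    have h6 : Module.finrank k (act (forms k r i) F ⊔
        act (forms k r i) (pull k r b (G₀ + c • point e p)) : Submodule k _) ≤
        Module.finrank k (act (forms k r i) F ⊔ act (forms k r i) (pull k r b G₀) :
          Submodule k _) + 1 := by
      refine finrank_sup_span_le (φ := pull k r b (point j p))
        (sup_le (le_sup_left.trans le_sup_left) ?_)
      rw [act_pull hb, act_pull hb]
      refine (Submodule.map_mono ((act_add_smul_le _ _ _ _).trans
        (sup_le_sup_left (act_point_le hij p) _))).trans ?_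
      rw [Submodule.map_sup, Submodule.map_span, Set.image_singleton]
      exact sup_le_sup_right le_sup_right _
    have h7 := finrank_act_eq_pairingRank hij hG
    obtain ⟨G, hG', hG1, hG2, hG3⟩ := ih hG (by omega) (by omega)
    exact ⟨G, hG', hc.trans hG1, hG2, hG3⟩

end LevelAlg
end

/-! ### Existence of level algebras with the required entries. -/

noncomputable section

namespace LevelAlg

variable {k : Type*} [Field k] {r : ℕ}

theorem multichoose_mono_right {n : ℕ} (hn : 1 ≤ n) {i j : ℕ} (h : i ≤ j) :
    n.multichoose i ≤ n.multichoose j := by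
  obtain ⟨n, rfl⟩ := Nat.exists_eq_add_of_le' hn
  exact monotone_nat_of_le_succ (f := (n + 1).multichoose)
    (fun i => by rw [Nat.multichoose_succ_succ]; omega) h

/-- Guarantees room in degree e - 1 ≥ 3 for first contractions of total dimension a ≤ 2r. -/
theorem two_mul_le_multichoose {n d : ℕ} (hn : 2 ≤ n) (hd : 3 ≤ d) : 2 * n ≤ n.multichoose d := by
  refine le_trans ?_ (multichoose_mono_right (by omega) hd)
  induction n, hn using Nat.le_induction with
  | base => simp [Nat.multichoose_two]
  | succ n hn ih =>
    have h : (n + 1).multichoose 3 = n.multichoose 3 + (n + 1).multichoose 2 :=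
      Nat.multichoose_succ_succ n 2
    have := multichoose_mono_right (n := n + 1) (by omega) (show 1 ≤ 2 by omega)
    rw [Nat.multichoose_one_right] at this
    omega

theorem choose_eq_multichoose {n : ℕ} (hn : 1 ≤ n) (i : ℕ) :
    (n - 1 + i).choose i = n.multichoose i := by
  rw [Nat.multichoose_eq]
  congr 1
  omega

theorem IsLevel.hVector_zero {I : Ideal (MvPolynomial (Fin r) k)} {e t : ℕ} (h : IsLevel I e t) :
    hVector I 0 = 1 := by
  have h1 := hVector_le I 0
  rw [Nat.multichoose_zero_right] at h1
  have h2 : hVector I 0 ≠ 0 := fun h0 => h.top_ne_zero (hVector_eq_zero_iff.2 fun p _ => by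
    have : (1 : MvPolynomial (Fin r) k) ∈ I := hVector_eq_zero_iff.1 h0 1 (isHomogeneous_one _ _)
    rw [I.eq_top_of_isUnit_mem this isUnit_one]
    trivial)
  omega

theorem hVector_one_eq_iff {I : Ideal (MvPolynomial (Fin r) k)} :
    hVector I 1 = r ↔ ∀ f ∈ I, f ∈ forms k r 1 → f = 0 := by
  have h1 := hVector_add_finrank I 1
  rw [finrank_forms, Nat.multichoose_one_right] at h1
  have : FiniteDimensional k (forms k r 1 ⊓ I.restrictScalars k : Submodule k _) :=
    Submodule.finiteDimensional_of_le inf_le_left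
  have h2 : hVector I 1 = r ↔ (forms k r 1 ⊓ I.restrictScalars k : Submodule k _) = ⊥ := by
    rw [← Submodule.finrank_eq_zero]
    omega
  rw [h2, Submodule.eq_bot_iff]
  exact ⟨fun h f hf hf1 => h f ⟨hf1, hf⟩, fun h f hf => h f hf.2 hf.1⟩

theorem IsLevel.hVector_one {I : Ideal (MvPolynomial (Fin r) k)} {e t : ℕ} (h : IsLevel I e t) :
    hVector I 1 = r := hVector_one_eq_iff.2 h.no_linear_form

theorem one_mem_forms : (1 : MvPolynomial (Fin r) k) ∈ forms k r 0 := isHomogeneous_one _ _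

theorem finrank_act_forms_zero {F : Functional k r} (hF : F ≠ 0) :
    Module.finrank k (act (forms k r 0) F) = 1 := by
  have h1 := finrank_act_le (forms k r 0) F
  rw [finrank_forms, Nat.multichoose_zero_right] at h1
  have h2 : Module.finrank k (act (forms k r 0) F) ≠ 0 := fun h0 => by
    rw [Submodule.finrank_eq_zero] at h0
    have h3 := smul_mem_act (one_mem_forms (k := k) (r := r)) F
    rw [h0, one_smul] at h3
    exact hF ((Submodule.mem_bot k).1 h3)
  omega

/-- A form in `r` variables and a form in `b` variables with independent first contractions
define a level algebra. -/
theorem isLevel_pull {b e : ℕ} (hb : 1 ≤ b) (hbr : b ≤ r) (he : 1 ≤ e) {F : Functional k r}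
    (hF : F ∈ functionals k r e) {G : Functional k b} (hG : G ∈ functionals k b e)
    (h : r + b ≤ Module.finrank k (act (forms k r 1) F ⊔ act (forms k r 1) (pull k r b G) :
      Submodule k _)) :
    IsLevel (pairAnn F (pull k r b G)) e 2 ∧
      hVector (pairAnn F (pull k r b G)) (e - 1) = r + b := by
  have hFr := finrank_act_le (forms k r 1) F
  have hGr := finrank_act_le (forms k b 1) G
  rw [← finrank_act_pull hbr] at hGr
  rw [finrank_forms, Nat.multichoose_one_right] at hFr hGr
  have hsum := Submodule.finrank_add_le_finrank_add_finrank (act (forms k r 1) F)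
    (act (forms k r 1) (pull k r b G))
  -- The two spaces of first contractions have dimensions at most r and b, so a sum of dimension r +
  -- b forces dim VF = r, and no linear form kills F.
  have hker : ∀ x ∈ forms k r 1, x • F = 0 → x = 0 := fun x hx hxF => by
    have h1 := finrank_map_add_finrank_inf_ker
      ((LinearMap.toSpanSingleton (MvPolynomial (Fin r) k) _ F).restrictScalars k) (forms k r 1)
    have : FiniteDimensional k (forms k r 1 ⊓ LinearMap.ker
      ((LinearMap.toSpanSingleton (MvPolynomial (Fin r) k) _ F).restrictScalars k) :
        Submodule k _) := Submodule.finiteDimensional_of_le inf_le_left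
    have h2 : Module.finrank k (forms k r 1 ⊓ LinearMap.ker
      ((LinearMap.toSpanSingleton (MvPolynomial (Fin r) k) _ F).restrictScalars k) :
        Submodule k _) = 0 := by
      rw [finrank_forms, Nat.multichoose_one_right] at h1
      change Module.finrank k (act (forms k r 1) F) + _ = _ at h1
      omega
    rw [Submodule.finrank_eq_zero, Submodule.eq_bot_iff] at h2
    exact h2 x ⟨hx, hxF⟩
  have hF0 : F ≠ 0 := by
    rintro rfl
    have h0 : Module.finrank k (act (forms k r 1) (0 : Functional k r)) = 0 := by
      rw [act_zero, finrank_bot]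
    omega
  have hG0 : pull k r b G ≠ 0 := fun h0 => by
    have h1 : Module.finrank k (act (forms k r 1) (pull k r b G)) = 0 := by
      rw [h0, act_zero, finrank_bot]
    omega
  have hF1 := finrank_act_forms_zero hF0
  have hG1 := finrank_act_forms_zero hG0
  have hzero := Submodule.finrank_add_le_finrank_add_finrank (act (forms k r 0) F)
    (act (forms k r 0) (pull k r b G))
  have htwo : Module.finrank k (act (forms k r 0) F ⊔ act (forms k r 0) (pull k r b G) :
      Submodule k _) = 2 := by
    -- Otherwise G would be a multiple of F, and VF + VG = VF would have dimension at most r < r +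
    -- b.
    by_contra hne
    have heq := Submodule.eq_of_le_of_finrank_le (le_sup_left : act (forms k r 0) F ≤
      act (forms k r 0) F ⊔ act (forms k r 0) (pull k r b G)) (by omega)
    have hmem : pull k r b G ∈ act (forms k r 0) F := by
      rw [heq]
      have h3 := smul_mem_act (one_mem_forms (k := k) (r := r)) (pull k r b G)
      rw [one_smul] at h3
      exact Submodule.mem_sup_right h3
    obtain ⟨p, hp, hpG⟩ := mem_act.1 hmem
    have hle : act (forms k r 1) F ⊔ act (forms k r 1) (pull k r b G) ≤ act (forms k r 1) F := by
      refine sup_le le_rfl fun y hy => ?_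
      obtain ⟨v, hv, rfl⟩ := mem_act.1 hy
      rw [← hpG, ← mul_smul]
      exact smul_mem_act (mul_mem_forms hv hp) F
    have := Submodule.finrank_mono hle
    omega
  refine ⟨isLevel_pairAnn hF (pull_mem hG) htwo fun x hx hxF _ => hker x hx hxF, ?_⟩
  rw [hVector_pairAnn (by omega : 1 + (e - 1) = e) hF (pull_mem hG)]
  omega

/-- Every value between `a` and the upper bound is attained, for `r < a`. -/
theorem exists_isLevel_of_lt [Infinite k] {a e i v : ℕ} (hr : 2 ≤ r) (he : 4 ≤ e) (ha : r < a)
    (ha2 : a ≤ 2 * r) (hie : i ≤ e) (hav : a ≤ v)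
    (hvi : v ≤ r.multichoose i + (a - r).multichoose i) (hvj : v ≤ r.multichoose (e - i)) :
    ∃ I : Ideal (MvPolynomial (Fin r) k), IsLevel I e 2 ∧ hVector I (e - 1) = a ∧
      hVector I (e - i) = v := by
  obtain ⟨b, rfl⟩ := Nat.exists_eq_add_of_lt ha
  rw [show r + b + 1 - r = b + 1 by omega] at hvi
  have hb : b + 1 ≤ r := by omega
  have hij : i + (e - i) = e := by omega
  have hone : 1 + (e - 1) = e := by omega
  -- With a = r + (b + 1), start from sums of at most b + 1 and r points: the first contractions
  -- already have dimension a, while every other contraction space stays at or below a ≤ v.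
  obtain ⟨G₀, hG₀, hG₀1, hG₀2⟩ := exists_sum_points (k := k) hone
    (A := forms k (b + 1) 1) (B := forms k (b + 1) (e - 1)) le_rfl le_rfl (b + 1)
    (by rw [finrank_forms, Nat.multichoose_one_right])
    (by
      rw [finrank_forms]
      have := multichoose_mono_right (n := b + 1) (by omega) (show 1 ≤ e - 1 by omega)
      rwa [Nat.multichoose_one_right] at this)
  rw [← finrank_act_eq_pairingRank hone hG₀, ← finrank_act_pull hb] at hG₀1
  have hG₀le := act_le_functionals hone (pull_mem (r := r) hG₀)
  have hG₀3 := finrank_add_finrank_vanishing hG₀le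
  rw [finrank_act_pull hb, finrank_forms] at hG₀3
  have hG₀4 := hG₀2 1 (e - 1) hone
  have h2r := two_mul_le_multichoose hr (show 3 ≤ e - 1 by omega)
  obtain ⟨F₀, hF₀, hF₀1, hF₀2⟩ := exists_sum_points (k := k) hone (A := forms k r 1)
    (B := vanishing (e - 1) (act (forms k r 1) (pull k r (b + 1) G₀))) le_rfl
    (vanishing_le _ _) r (by rw [finrank_forms, Nat.multichoose_one_right]) (by omega)
  have hstart := finrank_sup_act hone hG₀le hF₀
  rw [sup_comm] at hstart
  have hi₀ : Module.finrank k (act (forms k r i) F₀ ⊔ act (forms k r i) (pull k r (b + 1) G₀) :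
      Submodule k _) ≤ v := by
    have h1 := Submodule.finrank_add_le_finrank_add_finrank (act (forms k r i) F₀)
      (act (forms k r i) (pull k r (b + 1) G₀))
    have h2 := hF₀2 i (e - i) hij
    have h3 := hG₀2 i (e - i) hij
    rw [finrank_act_pull hb] at h1
    omega
  -- G is raised before F because the cap on what F can achieve involves the dimension contributed
  -- by G.
  obtain ⟨G, hG, hG1, hG2, hG3⟩ := exists_pull_finrank hb hij F₀ hG₀ hi₀
  obtain ⟨F, hF, hFv, hF1⟩ : ∃ F ∈ functionals k r e,
      Module.finrank k (act (forms k r i) F ⊔ act (forms k r i) (pull k r (b + 1) G) :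
        Submodule k _) = v ∧
      Module.finrank k (act (forms k r 1) F₀ ⊔ act (forms k r 1) (pull k r (b + 1) G) :
        Submodule k _) ≤
        Module.finrank k (act (forms k r 1) F ⊔ act (forms k r 1) (pull k r (b + 1) G) :
        Submodule k _) := by
    rcases hG3 with hG3 | hG3
    · exact ⟨F₀, hF₀, hG3, le_rfl⟩
    · refine exists_finrank_act_sup_eq hij hF₀ (pull_mem hG) hG2 ?_ hvj
      rw [finrank_act_pull hb]
      -- For i ≤ e - i, G contributes its full multichoose(b + 1, i) and `hvi` applies; otherwise
      -- multichoose(r, e - i) ≤ multichoose(r, i), and `hvj` suffices.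
      rcases le_total i (e - i) with hle | hle
      · have := multichoose_mono_right (n := b + 1) (by omega) hle
        omega
      · have := multichoose_mono_right (n := r) (by omega) hle
        omega
  obtain ⟨hlevel, htop⟩ := isLevel_pull (by omega) hb (by omega) hF hG (by omega)
  exact ⟨_, hlevel, by rw [htop]; omega, by rw [hVector_pairAnn hij hF (pull_mem hG), hFv]⟩

/-- All upper bounds are attained simultaneously, for `r < a`. -/
theorem exists_isLevel_max_of_lt [Infinite k] {a e : ℕ} (hr : 2 ≤ r) (he : 4 ≤ e) (ha : r < a)
    (ha2 : a ≤ 2 * r) :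
    ∃ I : Ideal (MvPolynomial (Fin r) k), IsLevel I e 2 ∧ hVector I (e - 1) = a ∧
      ∀ i, 1 ≤ i → i ≤ e → hVector I (e - i) =
        min (r.multichoose i + (a - r).multichoose i) (r.multichoose (e - i)) := by
  obtain ⟨b, rfl⟩ := Nat.exists_eq_add_of_lt ha
  have hb : b + 1 ≤ r := by omega
  have hone : 1 + (e - 1) = e := by omega
  obtain ⟨G, hG, hGi⟩ := exists_forall_finrank_sup_act (k := k) (r := b + 1) (e := e)
    (fun _ => ⊥) (fun _ _ => bot_le)
  obtain ⟨F, hF, hFi⟩ := exists_forall_finrank_sup_act (k := k) (r := r) (e := e)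
    (fun i => act (forms k r i) (pull k r (b + 1) G))
    (fun i hi => act_le_functionals (by omega) (pull_mem hG))
  have key : ∀ i ≤ e, min (r.multichoose i + (b + 1).multichoose i) (r.multichoose (e - i)) ≤
      Module.finrank k (act (forms k r i) F ⊔ act (forms k r i) (pull k r (b + 1) G) :
        Submodule k _) := fun i hi => by
    have h1 := hGi i hi
    have h2 := hFi i hi
    rw [sup_comm, finrank_act_pull hb] at h2
    rw [bot_sup_eq, finrank_bot, zero_add] at h1
    -- In the lower range G attains multichoose(b + 1, i); in the upper range the term
    -- multichoose(r, e - i) is the minimum whatever G contributes.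
    rcases le_total i (e - i) with hle | hle
    · have := multichoose_mono_right (n := b + 1) (by omega) hle
      omega
    · have := multichoose_mono_right (n := r) (by omega) hle
      omega
  have h2r := two_mul_le_multichoose hr (show 3 ≤ e - 1 by omega)
  have h1 := key 1 (by omega)
  rw [Nat.multichoose_one_right, Nat.multichoose_one_right] at h1
  obtain ⟨hlevel, htop⟩ := isLevel_pull (by omega) hb (by omega) hF hG (by omega)
  refine ⟨_, hlevel, by rw [htop]; omega, fun i hi hie => le_antisymm ?_ ?_⟩
  · have := hlevel.hVector_le_of_lt (by omega) hi hie
    rwa [htop] at this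
  · rw [hVector_pairAnn (by omega : i + (e - i) = e) hF (pull_mem hG),
      show r + b + 1 - r = b + 1 by omega]
    exact key i hie

/-- The last coordinate point. -/
def lastPoint (k : Type*) [Field k] (n e : ℕ) : Functional k (n + 1) :=
  point e (Pi.single (Fin.last n) 1)

theorem lastPoint_mem (n e : ℕ) : lastPoint k n e ∈ functionals k (n + 1) e := point_mem e _

/-- The contractions of the last point form a line spanned by a point of degree j + 1 > 0, which is
nonzero on a power of the last variable, whereas functionals pulled back from n variables vanish
there. In residual degree 0 this would fail. -/
theorem finrank_act_pull_sup_lastPoint {n i j e : ℕ} (hij : i + (j + 1) = e) (F : Functional k n) :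
    Module.finrank k (act (forms k (n + 1) i) (pull k (n + 1) n F) ⊔
      act (forms k (n + 1) i) (lastPoint k n e) : Submodule k _) =
      Module.finrank k (act (forms k n i) F) + 1 := by
  have hX : ∀ d, (X (Fin.last n) : MvPolynomial (Fin (n + 1)) k) ^ d ∈ forms k (n + 1) d :=
    fun d => by simpa using (isHomogeneous_X k (Fin.last n)).pow d
  have hact : act (forms k (n + 1) i) (lastPoint k n e) =
      Submodule.span k {lastPoint k n (j + 1)} := by
    refine le_antisymm (act_point_le hij _) ?_
    rw [Submodule.span_singleton_le_iff_mem]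
    have h := smul_mem_act (hX i) (lastPoint k n e)
    rw [lastPoint, contract_point hij _ (hX i)] at h
    simpa [lastPoint] using h
  have hnot : lastPoint k n (j + 1) ∉ act (forms k (n + 1) i) (pull k (n + 1) n F) := fun h => by
    obtain ⟨p, hp, hpF⟩ := mem_act.1 h
    have h1 := LinearMap.congr_fun hpF (X (Fin.last n) ^ (j + 1))
    have hproj : project k (n + 1) n (X (Fin.last n)) = 0 := by simp [project]
    rw [lastPoint, point_apply (hX (j + 1)), contract_pull, pull_apply, map_pow, hproj,
      zero_pow (by omega), map_zero] at h1
    simp at h1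
  rw [hact, ← finrank_act_pull (Nat.le_succ n)]
  refine le_antisymm ?_ (Nat.succ_le_of_lt (finrank_lt_finrank_sup_span hnot))
  exact finrank_sup_span_le le_rfl

/-- The type is read off at i = 0 and the codimension at i = e - 1, where symmetry turns (e - 1)-st
contractions of F into first ones. -/
theorem isLevel_lastPoint {n e : ℕ} (hn : 1 ≤ n) (he : 2 ≤ e) {F : Functional k n}
    (hF : F ∈ functionals k n e) (h : n ≤ Module.finrank k (act (forms k n 1) F)) :
    IsLevel (pairAnn (pull k (n + 1) n F) (lastPoint k n e)) e 2 ∧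
      ∀ i, i < e → hVector (pairAnn (pull k (n + 1) n F) (lastPoint k n e)) (e - i) =
        Module.finrank k (act (forms k n i) F) + 1 := by
  have hval : ∀ i, i < e → hVector (pairAnn (pull k (n + 1) n F) (lastPoint k n e)) (e - i) =
      Module.finrank k (act (forms k n i) F) + 1 := fun i hi => by
    rw [hVector_pairAnn (by omega : i + (e - i) = e) (pull_mem hF) (lastPoint_mem n e),
      finrank_act_pull_sup_lastPoint (j := e - i - 1) (by omega) F]
  refine ⟨isLevel_pairAnn (pull_mem hF) (lastPoint_mem n e) ?_ ?_, hval⟩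
  · have hF0 : F ≠ 0 := by
      rintro rfl
      rw [act_zero, finrank_bot] at h
      omega
    rw [← hVector_pairAnn (zero_add e) (pull_mem hF) (lastPoint_mem n e)]
    have := hval 0 (by omega)
    rwa [Nat.sub_zero, finrank_act_forms_zero hF0] at this
  · have h1 := hval (e - 1) (by omega)
    rw [show e - (e - 1) = 1 by omega,
      finrank_act_symm (by omega : (e - 1) + 1 = e) hF] at h1
    have h2 := finrank_act_le (forms k n 1) F
    rw [finrank_forms, Nat.multichoose_one_right] at h2
    rw [show Module.finrank k (act (forms k n 1) F) = n by omega, hVector_one_eq_iff] at h1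
    exact fun x hx hxF hxG => h1 x (mem_pairAnn.2 ⟨hxF, hxG⟩) hx

/-- Every value between `r` and the upper bound is attained, for `a = r`. -/
theorem exists_isLevel_of_eq [Infinite k] {n e i v : ℕ} (hn : 1 ≤ n) (he : 4 ≤ e) (hie : i < e)
    (hv : n + 1 ≤ v) (hvi : v ≤ n.multichoose i + 1) (hvj : v ≤ n.multichoose (e - i) + 1) :
    ∃ I : Ideal (MvPolynomial (Fin (n + 1)) k), IsLevel I e 2 ∧ hVector I (e - 1) = n + 1 ∧
      hVector I (e - i) = v := by
  have hij : i + (e - i) = e := by omega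
  have hone : 1 + (e - 1) = e := by omega
  obtain ⟨F₀, hF₀, hF₀1, hF₀2⟩ := exists_sum_points (k := k) hone
    (A := forms k n 1) (B := forms k n (e - 1)) le_rfl le_rfl n
    (by rw [finrank_forms, Nat.multichoose_one_right])
    (by
      rw [finrank_forms]
      have := multichoose_mono_right hn (show 1 ≤ e - 1 by omega)
      rwa [Nat.multichoose_one_right] at this)
  rw [← finrank_act_eq_pairingRank hone hF₀] at hF₀1
  -- The target is v - 1 because the last point supplies the remaining dimension; the second
  -- functional is taken to be zero.
  obtain ⟨F, hF, hFv, hF1⟩ := exists_finrank_act_sup_eq hij hF₀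
    (Submodule.zero_mem (functionals k n e)) (v := v - 1) (by
      rw [act_zero, sup_bot_eq]
      have := hF₀2 i (e - i) hij
      omega) (by omega) (by omega)
  rw [act_zero, sup_bot_eq] at hFv
  rw [act_zero, sup_bot_eq, sup_bot_eq] at hF1
  obtain ⟨hlevel, hval⟩ := isLevel_lastPoint hn (by omega) hF (hF₀1.trans hF1)
  have h2 := finrank_act_le (forms k n 1) F
  rw [finrank_forms, Nat.multichoose_one_right] at h2
  refine ⟨_, hlevel, ?_, ?_⟩
  · rw [hval 1 (by omega)]
    omega
  · rw [hval i hie]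
    omega

/-- All upper bounds are attained simultaneously, for `a = r`. -/
theorem exists_isLevel_max_of_eq [Infinite k] {n e : ℕ} (hn : 1 ≤ n) (he : 4 ≤ e) :
    ∃ I : Ideal (MvPolynomial (Fin (n + 1)) k), IsLevel I e 2 ∧ hVector I (e - 1) = n + 1 ∧
      ∀ i, i < e → hVector I (e - i) =
        min (n.multichoose i + 1) (n.multichoose (e - i) + 1) := by
  obtain ⟨F, hF, hFi⟩ := exists_forall_finrank_sup_act (k := k) (r := n) (e := e)
    (fun _ => ⊥) (fun _ _ => bot_le)
  have key : ∀ i ≤ e, Module.finrank k (act (forms k n i) F) =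
      min (n.multichoose i) (n.multichoose (e - i)) := fun i hi => by
    have h1 := hFi i hi
    rw [bot_sup_eq, finrank_bot, zero_add] at h1
    have h2 := finrank_act_le (forms k n i) F
    have h3 := finrank_act_le (forms k n (e - i)) F
    rw [← finrank_act_symm (by omega : i + (e - i) = e) hF] at h3
    rw [finrank_forms] at h2 h3
    omega
  have h1 := key 1 (by omega)
  have hmono := multichoose_mono_right hn (show 1 ≤ e - 1 by omega)
  rw [Nat.multichoose_one_right] at h1 hmono
  rw [min_eq_left hmono] at h1
  obtain ⟨hlevel, hval⟩ := isLevel_lastPoint hn (by omega) hF h1.ge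
  refine ⟨_, hlevel, by rw [hval 1 (by omega), h1], fun i hi => ?_⟩
  rw [hval i hi, key i hi.le]
  omega

end LevelAlg
end

/-! ### Assembly of the three statements. -/

theorem theorem3p8 (k : Type*) [Field k] [CharZero k] (r e : ℕ) (hr : 2 ≤ r) (he : 4 ≤ e) :
    -- (i) the case `a = r ≤ 5`
    (r ≤ 5 → ∀ i : ℕ, 2 ≤ i → i ≤ e - 2 →
      (∀ h : ℕ → ℕ, IsLevelHVector k r e 2 h → h (e - 1) = r →
        h (e - i) = h i ∧
        h (e - i) ≤
          min ((r - 2 + i).choose i + 1) ((r - 2 + (e - i)).choose (e - i) + 1)) ∧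
      (∀ v : ℕ, r ≤ v →
        v ≤ min ((r - 2 + i).choose i + 1) ((r - 2 + (e - i)).choose (e - i) + 1) →
        ∃ h : ℕ → ℕ, IsLevelHVector k r e 2 h ∧ h (e - 1) = r ∧ h (e - i) = v)) ∧
    -- (ii) the case `r < a ≤ 2r`
    (∀ a : ℕ, r < a → a ≤ 2 * r → ∀ i : ℕ, 2 ≤ i → i ≤ e - 2 →
      (∀ h : ℕ → ℕ, IsLevelHVector k r e 2 h → h (e - 1) = a →
        h (e - i) ≤
          min ((r - 1 + i).choose i + (a - r - 1 + i).choose i)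
            ((r - 1 + (e - i)).choose (e - i))) ∧
      (∀ v : ℕ, a ≤ v →
        v ≤ min ((r - 1 + i).choose i + (a - r - 1 + i).choose i)
            ((r - 1 + (e - i)).choose (e - i)) →
        ∃ h : ℕ → ℕ, IsLevelHVector k r e 2 h ∧ h (e - 1) = a ∧ h (e - i) = v)) ∧
    -- (iii) all the upper bounds are attained simultaneously, by the entrywise greatest `h`-vector
    (∀ a : ℕ, r ≤ a → a ≤ 2 * r → (a = r → r ≤ 5) →
      IsGreatest {h : ℕ → ℕ | IsLevelHVector k r e 2 h ∧ h (e - 1) = a}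
        (maxHVector r a e)) := by
  have hchoose : ∀ i, (r - 2 + i).choose i = (r - 1).multichoose i := fun i =>
    LevelAlg.choose_eq_multichoose (n := r - 1) (by omega) i
  have hchoose' : ∀ i, (r - 1 + i).choose i = r.multichoose i := fun i =>
    LevelAlg.choose_eq_multichoose (by omega) i
  obtain ⟨n, rfl⟩ : ∃ n, r = n + 1 := ⟨r - 1, by omega⟩
  refine ⟨fun hr5 i hi hie => ⟨?_, fun v hv hv' => ?_⟩,
    fun a ha ha2 i hi hie => ⟨?_, fun v hv hv' => ?_⟩, fun a ha ha2 ha5 => ?_⟩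
  · rintro _ ⟨I, hI, rfl⟩ hr'
    rw [hchoose, hchoose]
    exact hI.hVector_le_of_eq he hr5 hr' (by omega) (by omega)
  · rw [hchoose, hchoose, le_min_iff] at hv'
    obtain ⟨I, hI, h1, h2⟩ := LevelAlg.exists_isLevel_of_eq (k := k) (n := n) (by omega) he
      (show i < e by omega) hv hv'.1 hv'.2
    exact ⟨_, ⟨I, hI, rfl⟩, h1, h2⟩
  · rintro _ ⟨I, hI, rfl⟩ rfl
    rw [hchoose', hchoose', LevelAlg.choose_eq_multichoose (by omega)]
    exact hI.hVector_le_of_lt (by omega) (by omega) (by omega)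
  · rw [hchoose', hchoose', LevelAlg.choose_eq_multichoose (by omega), le_min_iff] at hv'
    obtain ⟨I, hI, h1, h2⟩ := LevelAlg.exists_isLevel_of_lt (k := k) hr he ha ha2
      (show i ≤ e by omega) hv hv'.1 hv'.2
    exact ⟨_, ⟨I, hI, rfl⟩, h1, h2⟩
  -- The entries in degrees 0, 1, e - 1, e and above are already determined by levelness and a, so
  -- only the middle degrees need the bounds.
  · have hends : ∀ I : Ideal (MvPolynomial (Fin (n + 1)) k), LevelAlg.IsLevel I e 2 →
        LevelAlg.hVector I (e - 1) = a → ∀ j, (j < 2 ∨ e < j + 2) →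
        LevelAlg.hVector I j = maxHVector (n + 1) a e j := fun I hI hIa j hj => by
      unfold maxHVector
      split_ifs with h0 h1 h2 h3 h4
      · rw [h0, hI.hVector_zero]
      · rw [h1, hI.hVector_one]
      · omega
      · rw [← hIa, ← h3, Nat.add_sub_cancel]
      · rw [h4, hI.hVector_top]
      · exact hI.eq_zero_above j (by omega)
    have hmid : ∀ j, ¬ (j < 2 ∨ e < j + 2) →
        maxHVector (n + 1) a e j = entryBound (n + 1) a e (e - j) := fun j hj => by
      unfold maxHVector
      rw [if_neg (by omega), if_neg (by omega), if_pos (by omega)]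
    constructor
    · rcases ha.eq_or_lt with rfl | hlt
      · obtain ⟨I, hI, h1, h2⟩ := LevelAlg.exists_isLevel_max_of_eq (k := k) (n := n)
          (by omega) he
        refine ⟨⟨I, hI, funext fun j => ?_⟩, ?_⟩
        · by_cases hj : j < 2 ∨ e < j + 2
          · exact hends I hI h1 j hj
          · have h3 := h2 (e - j) (by omega)
            rw [hmid j hj, entryBound, if_pos rfl, hchoose, hchoose]
            rwa [show e - (e - j) = j by omega] at h3 ⊢
        · rw [← hends I hI h1 (e - 1) (by omega), h1]
      · obtain ⟨I, hI, h1, h2⟩ := LevelAlg.exists_isLevel_max_of_lt (k := k) hr he hlt ha2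
        refine ⟨⟨I, hI, funext fun j => ?_⟩, ?_⟩
        · by_cases hj : j < 2 ∨ e < j + 2
          · exact hends I hI h1 j hj
          · have h3 := h2 (e - j) (by omega) (by omega)
            rw [hmid j hj, entryBound, if_neg (by omega), hchoose', hchoose',
              LevelAlg.choose_eq_multichoose (by omega)]
            rwa [show e - (e - j) = j by omega] at h3 ⊢
        · rw [← hends I hI h1 (e - 1) (by omega), h1]
    · rintro _ ⟨⟨I, hI, rfl⟩, hIa⟩ j
      by_cases hj : j < 2 ∨ e < j + 2
      · exact (hends I hI hIa j hj).le
      · rw [hmid j hj, entryBound]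
        have hjj : e - (e - j) = j := by omega
        split_ifs with har
        · subst har
          have h3 := (hI.hVector_le_of_eq he (ha5 rfl) hIa (i := e - j) (by omega) (by omega)).2
          rw [hchoose, hchoose]
          rwa [hjj] at h3 ⊢
        · have h3 := hI.hVector_le_of_lt (by omega) (i := e - j) (by omega) (by omega)
          rw [hchoose', hchoose', LevelAlg.choose_eq_multichoose (by omega)]
          rw [hIa] at h3
          rwa [hjj] at h3 ⊢
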